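/- **Setting.** For a subset $F$ of a metric space and $r>0$ let $N_r(F)$ be the minimal number of sets of radius at most $r$ needed to cover $F$. A *dimension function* is a function $\phi\colon(0,1)\to[0,\infty)$ such that $\phi(x)$ and $\phi(x)|\log x|$ are monotone (in either direction) on some interval $(0,\delta)$. Put $$\dim_A^\phi F=\inf\Big\{s\ge 0:\ \exists C>0\ \ \forall\, 0<r=R^{1+\phi(R)}<R<1\ \ \sup_{x\in F}N_r(F\cap B(x,R))\le C\Big(\frac Rr\Big)^s\Big\},$$ let $\dim_A F$ (the Assouad dimension) be defined in the same way but with all pairs $0<r\le R<1$ allowed, and let $\dim_B F=\lim_{r\to0}\frac{\log N_r(F)}{-\log r}$ be the box-counting dimension. By convention all dimensions of $\emptyset$ are $0$. Let $(\mathbb I_\lambda)_{\lambda\in\Lambda}$ be a finite family of iterated function systems $\mathbb I_\lambda=\{f_1^\lambda,\dots,f_{N_\lambda}^\lambda\}$, $N_\lambda\ge 0$, where each $f_i^\lambda$ is a similarity of $\mathbb R^d$ with contraction ratio in $(0,1)$. Assume the uniform open set condition: there is a non-empty open set $U$ such that, for every $\lambda$, the sets $f_i^\lambda(U)$, $1\le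 i\le N_\lambda$, are pairwise disjoint subsets of $U$. Let $\Delta$ be a non-empty compact set with $f_i^\lambda(\Delta)\subseteq\Delta$ for all $\lambda,i$. Attach to the finite words $w$ of indices independent identically distributed $\Lambda$-valued random variables $\lambda(w)$. The associated *stochastically self-similar set* is $$F_\tau=\bigcap_{k\ge1}\ \bigcup_{i_1\cdots i_k} f_{i_1}^{\lambda(\emptyset)}\circ f_{i_2}^{\lambda(i_1)}\circ\cdots\circ f_{i_k}^{\lambda(i_1\cdots i_{k-1})}(\Delta),$$ the union being over all words with $1\le i_j\le N_{\lambda(i_1\cdots i_{j-1})}$ for $1\le j\le k$. **Corollary.** Let $\phi$ be a dimension function. 1. If $\dfrac{\log|\log x|}{|\log x|}=o(\phi(x))$ as $x\to0^+$, then almost surely the box-counting dimension of $F_\tau$ exists and $\dim_A^\phi F_\tau=\dim_B F_\tau$. 2. If $\phi(x)=o\Big(\dfrac{\log|\log x|}{|\log x|}\Big)$ as $x\to0^+$ and $\phi(x)|\log x|\to\infty$ as $x\to0^+$, then almost surely $\dim_A^\phi F_\tau=\dim_A F_\tau$. -/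

import Mathlib

open Set Filter Topology MeasureTheory ProbabilityTheory Asymptotics
open scoped ENNReal NNReal

noncomputable section

/-- `N_r(A)`: the minimal number of sets of radius at most `r`, equivalently of closed balls of
radius `r` with arbitrary centres, needed to cover `A`. -/
def coverNum {X : Type*} [PseudoMetricSpace X] (r : ℝ) (A : Set X) : ℕ∞ :=
  Metric.externalCoveringNumber r.toNNReal A

/-- A dimension function: `φ` is non-negative on `(0,1)`, and both `φ(x)` and `φ(x)|log x|` are
monotone (in either direction) in some right neighbourhood of `0`. -/
structure IsDimensionFunction (φ : ℝ → ℝ) : Prop where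
  nonneg : ∀ x ∈ Ioo (0 : ℝ) 1, 0 ≤ φ x
  monotone : ∃ δ > 0, MonotoneOn φ (Ioo 0 δ) ∨ AntitoneOn φ (Ioo 0 δ)
  monotone_mul_log : ∃ δ > 0, MonotoneOn (fun x => φ x * |Real.log x|) (Ioo 0 δ) ∨
    AntitoneOn (fun x => φ x * |Real.log x|) (Ioo 0 δ)

/-- The generalised Assouad spectrum (`φ`-Assouad dimension) of `F`. The exponents are taken to be
non-negative, so that the empty set has dimension `0`. -/
def phiAssouadDim {X : Type*} [PseudoMetricSpace X] (φ : ℝ → ℝ) (F : Set X) : ℝ :=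
  sInf {s : ℝ | 0 ≤ s ∧ ∃ C : ℝ, 0 < C ∧ ∀ r R : ℝ, 0 < r → r = R ^ (1 + φ R) → r < R →
    0 < R → R < 1 → ∀ x ∈ F,
      ((coverNum r (F ∩ Metric.closedBall x R) : ℕ∞) : ℝ≥0∞) ≤ ENNReal.ofReal (C * (R / r) ^ s)}

/-- The Assouad dimension of a bounded set `F`, with non-negative exponents. -/
def assouadDim {X : Type*} [PseudoMetricSpace X] (F : Set X) : ℝ :=
  sInf {s : ℝ | 0 ≤ s ∧ ∃ C : ℝ, 0 < C ∧ ∀ r R : ℝ, 0 < r → r ≤ R → R < 1 → ∀ x ∈ F,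
      ((coverNum r (F ∩ Metric.closedBall x R) : ℕ∞) : ℝ≥0∞) ≤ ENNReal.ofReal (C * (R / r) ^ s)}

/-- The box-counting dimension of the totally bounded set `F` exists and equals `s`. For totally
bounded `F` the covering numbers are finite. The empty set has box-counting dimension `0`. -/
def HasBoxDim {X : Type*} [PseudoMetricSpace X] (F : Set X) (s : ℝ) : Prop :=
  TotallyBounded F ∧
    Tendsto (fun r : ℝ => Real.log ((coverNum r F).toNat : ℝ) / (-Real.log r)) (𝓝[>] 0) (𝓝 s)

/-- A finite (possibly empty) family of contracting similarities of `ℝ^d`. -/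
structure SelfSimilarIFS (d : ℕ) where
  /-- the number of maps -/
  card : ℕ
  /-- the maps -/
  map : Fin card → EuclideanSpace ℝ (Fin d) → EuclideanSpace ℝ (Fin d)
  /-- the contraction ratios -/
  ratio : Fin card → ℝ
  ratio_pos : ∀ i, 0 < ratio i
  ratio_lt_one : ∀ i, ratio i < 1
  dist_map : ∀ i x y, dist (map i x) (map i y) = ratio i * dist x y

/-- The uniform open set condition for a family of iterated function systems: one non-empty open
set `U` works for all the systems of the family. -/
def UniformOSC {d : ℕ} {Λ : Type*} (I : Λ → SelfSimilarIFS d) : Prop :=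
  ∃ U : Set (EuclideanSpace ℝ (Fin d)), IsOpen U ∧ U.Nonempty ∧ ∀ l : Λ,
    (∀ i, (I l).map i '' U ⊆ U) ∧
    Pairwise fun i j => Disjoint ((I l).map i '' U) ((I l).map j '' U)

/-- The `k`-th level set of a tree of systems. A node is the word `w` of indices chosen so far, and
`t w` is the system used at that node, so that the children of `w` are `w ++ [i]` with
`i < (t w).card`. The `k`-th level set is the union of the images
`f_{i₁}^{t []} ∘ f_{i₂}^{t [i₁]} ∘ ⋯ ∘ f_{i_k}^{t [i₁, …, i_{k-1}]} (Δ)` over all nodes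
`[i₁, …, i_k]` of the tree. The tree `fun w => t (i :: w)` is the subtree rooted at the child `i`
of the root. -/
def levelSet {d : ℕ} (Δ : Set (EuclideanSpace ℝ (Fin d))) :
    ℕ → (List ℕ → SelfSimilarIFS d) → Set (EuclideanSpace ℝ (Fin d))
  | 0, _ => Δ
  | k + 1, t => ⋃ i : Fin (t []).card,
      (t []).map i '' levelSet Δ k (fun w => t ((i : ℕ) :: w))

/-- The limit set of a tree of systems: the intersection of its level sets. -/
def treeLimitSet {d : ℕ} (Δ : Set (EuclideanSpace ℝ (Fin d))) (t : List ℕ → SelfSimilarIFS d) :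
    Set (EuclideanSpace ℝ (Fin d)) :=
  ⋂ k : ℕ, levelSet Δ k t

/-- The threshold function `log|log x| / |log x|`. -/
def threshold (x : ℝ) : ℝ := Real.log |Real.log x| / |Real.log x|

end

/-! Under the open set condition a ball meets boundedly many cylinders of its own size
(`exists_card_cutWords_le`). Covering numbers are therefore bounded above by cylinder counts and
below by counts of surviving cylinders, up to constants. These counts (`cutSum`) have a branching
structure: given the root label, the count at threshold `δ` is the sum of independent copies at the
thresholds `δ / ratio i`.

Above the threshold. If `E ∑ ratio ^ s < 1`, the counts times `δ ^ s` have bounded exponential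
moments, so a count exceeds `δ ^ (-s - ε)` with probability at most `exp (C - θ * δ ^ (-ε))`. This
beats a union bound over all nodes of depth at most `δ ^ (-ε / 2)`, and Borel–Cantelli controls all
these nodes at once (`exists_ae_eventually_cutSum_le`). A ball of radius `R` corresponds to depth of
order `|log R|`, while `R / r = exp (φ R * |log R|)` exceeds every power of `|log R|`. Hence every
ball obeys the exponent `s + ε`. Conversely, Laplace transforms show that on survival the counts
grow at every rate below the critical exponent (`exists_ae_eventually_lt_cutSum`). Chaining the
scales `R ↦ R ^ (1 + φ R)` shows that a `φ`-Assouad exponent dominates every lower box-counting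
exponent (`le_of_isPhiAssouadExponent`).

Below the threshold. If `∑ ratio ^ s ≤ 1` for every label of positive probability, then `s` is an
Assouad exponent, deterministically. If some such label `l` has `∑ ratio ^ s ≥ 1`, a subtree carries
only the label `l` for `k` generations with probability at least `β ^ (B ^ k)`. A surviving tree has
exponentially many nodes at depth `n`, so such subtrees with `k` of order `log n` occur for
infinitely many `n` (`ae_frequently_notMem_avoidTrees`). Since `R / r` is now smaller than every
power of `|log R|`, these `k` generations cover all scales from `R` to `r`, and the exponent is at
least `s`. -/

/-- The subtree of a labelled tree at the child `i` of the root. -/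
def subtree {Λ : Type*} (t : List ℕ → Λ) (i : ℕ) : List ℕ → Λ := fun w => t (i :: w)

/-! ### Independence of the root label and the subtrees. -/

section Branching

variable {Λ : Type*} [MeasurableSpace Λ]

lemma measurable_subtree (i : ℕ) : Measurable fun t : List ℕ → Λ => subtree t i :=
  measurable_pi_lambda _ fun _ => measurable_pi_apply _

/-- The words starting from a child of the root, together with the empty word. -/
def rootSplitIndex : (Σ o : Option ℕ, Option.elim o Unit fun _ => List ℕ) → List ℕ
  | ⟨none, _⟩ => []
  | ⟨some i, w⟩ => i :: (show List ℕ from w)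

lemma rootSplitIndex_injective : Function.Injective rootSplitIndex := by
  rintro ⟨_ | i, a⟩ ⟨_ | j, b⟩ h
  · rfl
  · simp [rootSplitIndex] at h
  · simp [rootSplitIndex] at h
  · obtain ⟨h1, h2⟩ := List.cons.inj (show i :: (show List ℕ from a) = j :: b from h)
    subst h1
    exact congrArg _ h2

/-- Words are grouped into the empty word and, for each `i`, the words beginning with `i`. Grouping
the coordinates of a product measure gives a product measure, that is, independent blocks. -/
lemma iIndepFun_rootSplit (ν : Measure Λ) [IsProbabilityMeasure ν] :
    iIndepFun (fun (o : Option ℕ) (t : List ℕ → Λ)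
      (j : Option.elim o Unit fun _ => List ℕ) => t (rootSplitIndex ⟨o, j⟩))
      (Measure.infinitePi fun _ : List ℕ => ν) := by
  rw [iIndepFun_iff_map_fun_eq_infinitePi_map (fun o => by fun_prop)]
  have h1 := Measure.map_infinitePi_infinitePi_of_inj (P := fun _ : List ℕ => ν)
    rootSplitIndex_injective
  have h2 := Measure.infinitePi_map_piCurry
    (fun (o : Option ℕ) (_ : Option.elim o Unit fun _ => List ℕ) => ν)
  rw [← h1, Measure.map_map (by fun_prop) (by fun_prop)] at h2
  refine Eq.trans ?_ (h2.trans ?_)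
  · rfl
  · congr 1
    funext o
    exact (Measure.map_infinitePi_infinitePi_of_inj (P := fun _ : List ℕ => ν)
      (f := fun j => rootSplitIndex ⟨o, j⟩)
      (fun a b h => by simpa using rootSplitIndex_injective h)).symm

lemma map_subtree_infinitePi (ν : Measure Λ) [IsProbabilityMeasure ν] (i : ℕ) :
    (Measure.infinitePi fun _ : List ℕ => ν).map (fun t => subtree t i) =
      Measure.infinitePi fun _ : List ℕ => ν :=
  Measure.map_infinitePi_infinitePi_of_inj (P := fun _ : List ℕ => ν)
    (f := fun w => i :: w) (fun a b h => by simpa using h)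

lemma lintegral_subtree (ν : Measure Λ) [IsProbabilityMeasure ν] (i : ℕ)
    {G : (List ℕ → Λ) → ℝ≥0∞} (hG : Measurable G) :
    ∫⁻ t, G (subtree t i) ∂(Measure.infinitePi fun _ : List ℕ => ν) =
      ∫⁻ t, G t ∂(Measure.infinitePi fun _ : List ℕ => ν) := by
  conv_rhs => rw [← map_subtree_infinitePi ν i]
  rw [lintegral_map hG (measurable_subtree i)]

variable [Fintype Λ] [MeasurableSingletonClass Λ]

/-- The index type `Option (Fin n)` picks the root block and the first `n` subtree blocks of
`iIndepFun_rootSplit`; the expectation of a product of independent factors splits. -/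
lemma lintegral_root_mul_prod (ν : Measure Λ) [IsProbabilityMeasure ν] (H : Λ → ℝ≥0∞)
    (n : ℕ) {G : Fin n → (List ℕ → Λ) → ℝ≥0∞} (hG : ∀ i, Measurable (G i)) :
    ∫⁻ t, H (t []) * ∏ i, G i (subtree t i) ∂(Measure.infinitePi fun _ : List ℕ => ν) =
      (∫⁻ l, H l ∂ν) * ∏ i, ∫⁻ t, G i t ∂(Measure.infinitePi fun _ : List ℕ => ν) := by
  let g : (o : Option (Fin n)) →
      ((Option.elim (o.map Fin.val) Unit fun _ => List ℕ) → Λ) → ℝ≥0∞ := fun o =>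
    match o with
    | none => fun a => H (a ())
    | some i => fun a => G i a
  have hH : Measurable H := measurable_of_finite H
  have hg : ∀ o, Measurable (g o) := by
    rintro (_ | i)
    · exact hH.comp (measurable_pi_apply _)
    · exact hG i
  have h1 := ((iIndepFun_rootSplit ν).precomp
    (g := fun o : Option (Fin n) => o.map Fin.val)
    (Option.map_injective Fin.val_injective)).comp g hg
  have h2 := lintegral_prod_eq_prod_lintegral_of_indepFun Finset.univ _ h1
    (fun o => (hg o).comp (by fun_prop))
  rw [Fintype.prod_option] at h2
  simp only [Fintype.prod_option] at h2
  refine Eq.trans ?_ (h2.trans ?_)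
  · rfl
  · congr 1
    · change ∫⁻ t : List ℕ → Λ, H (t []) ∂_ = _
      conv_rhs => rw [← Measure.infinitePi_map_eval (fun _ : List ℕ => ν) []]
      rw [lintegral_map hH (measurable_pi_apply _)]
    · exact Finset.prod_congr rfl fun i _ => lintegral_subtree ν i (hG i)

/-- A function of a tree that is determined by a case distinction on the root label. -/
lemma measurable_of_root {β : Type*} [MeasurableSpace β] {H : Λ → (List ℕ → Λ) → β}
    (hH : ∀ l, Measurable (H l)) : Measurable fun t => H (t []) t := by
  have : Measurable (Function.uncurry H) := measurable_from_prod_countable_right hH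
  exact this.comp (f := fun t : List ℕ → Λ => (t [], t))
    ((measurable_pi_apply []).prodMk measurable_id)

/-- The branching property: given the root label, the subtrees at the children of the root are
independent copies of the whole tree. -/
theorem lintegral_prod_subtree (ν : Measure Λ) [IsProbabilityMeasure ν] (N : Λ → ℕ)
    {G : (l : Λ) → Fin (N l) → (List ℕ → Λ) → ℝ≥0∞} (hG : ∀ l i, Measurable (G l i)) :
    ∫⁻ t, ∏ i, G (t []) i (subtree t i) ∂(Measure.infinitePi fun _ : List ℕ => ν) =
      ∑ l, ν {l} * ∏ i, ∫⁻ t, G l i t ∂(Measure.infinitePi fun _ : List ℕ => ν) := by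
  classical
  -- The number of factors depends on the root label, so the integrand is split over the finitely
  -- many values of that label.
  have h : ∀ t : List ℕ → Λ, ∏ i, G (t []) i (subtree t i) =
      ∑ l, (if t [] = l then 1 else 0) * ∏ i, G l i (subtree t i) := by
    intro t
    simp
  simp_rw [h]
  rw [lintegral_finsetSum]
  · refine Finset.sum_congr rfl fun l _ => ?_
    rw [lintegral_root_mul_prod ν (fun l' => if l' = l then 1 else 0) (N l) (hG l)]
    congr 1
    have : (fun l' : Λ => if l' = l then (1 : ℝ≥0∞) else 0) = Set.indicator {l} 1 := by
      ext l'
      simp [Set.indicator_apply]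
    rw [this, lintegral_indicator_one (measurableSet_singleton l)]
  · intro l _
    refine Measurable.mul ?_ ?_
    · exact (measurable_of_finite (fun l' : Λ => if l' = l then (1 : ℝ≥0∞) else 0)).comp
        (measurable_pi_apply [])
    · exact Finset.measurable_prod _ fun i _ => (hG l i).comp (measurable_subtree i)

end Branching

/-! ### Covering numbers, separated points and similarities. -/

section Covering

lemma coverNum_le_card {X : Type*} [PseudoMetricSpace X] {r : ℝ} (hr : 0 ≤ r) {A : Set X}
    {T : Finset X} (h : ∀ x ∈ A, ∃ y ∈ T, dist x y ≤ r) : coverNum r A ≤ T.card := by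
  have : Metric.IsCover r.toNNReal A (T : Set X) := by
    rw [Metric.isCover_iff_subset_iUnion_closedBall]
    intro x hx
    obtain ⟨y, hy, hxy⟩ := h x hx
    simp only [mem_iUnion]
    exact ⟨y, hy, by simpa [Real.coe_toNNReal r hr] using hxy⟩
  refine this.externalCoveringNumber_le_encard.trans ?_
  simp

lemma exists_finset_card_eq_coverNum {X : Type*} [PseudoMetricSpace X] {r : ℝ} (hr : 0 ≤ r)
    {A : Set X} (h : coverNum r A ≠ ⊤) :
    ∃ T : Finset X, (T.card : ℕ∞) = coverNum r A ∧ ∀ x ∈ A, ∃ y ∈ T, dist x y ≤ r := by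
  classical
  have h' : ∃ C : {C : Set X // Metric.IsCover r.toNNReal A C},
      (C : Set X).encard = coverNum r A := by
    have : coverNum r A = ⨅ C : {C : Set X // Metric.IsCover r.toNNReal A C},
        (C : Set X).encard := by
      rw [coverNum, Metric.externalCoveringNumber, iInf_subtype]
    rw [this]
    have : Nonempty {C : Set X // Metric.IsCover r.toNNReal A C} := ⟨⟨A, Metric.IsCover.rfl⟩⟩
    exact ciInf_mem _
  obtain ⟨⟨C, hC⟩, hCc⟩ := h'
  simp only at hCc
  have hfin : C.Finite := by
    rw [← Set.encard_ne_top_iff, hCc]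
    exact h
  refine ⟨hfin.toFinset, ?_, ?_⟩
  · rw [← hCc, hfin.encard_eq_coe_toFinset_card]
  · intro x hx
    have := Metric.isCover_iff_subset_iUnion_closedBall.1 hC hx
    simp only [mem_iUnion] at this
    obtain ⟨y, hy, hxy⟩ := this
    exact ⟨y, by simpa using hy, by simpa [Real.coe_toNNReal r hr] using hxy⟩

lemma coverNum_anti {X : Type*} [PseudoMetricSpace X] {r r' : ℝ} (h : r ≤ r') (A : Set X) :
    coverNum r' A ≤ coverNum r A :=
  Metric.externalCoveringNumber_anti (Real.toNNReal_le_toNNReal h)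

lemma coverNum_mono {X : Type*} [PseudoMetricSpace X] (r : ℝ) {A B : Set X} (h : A ⊆ B) :
    coverNum r A ≤ coverNum r B :=
  Metric.externalCoveringNumber_mono_set h

lemma coverNum_ne_top {X : Type*} [PseudoMetricSpace X] {r : ℝ} (hr : 0 < r) {A : Set X}
    (hA : TotallyBounded A) : coverNum r A ≠ ⊤ := by
  obtain ⟨C, -, hC, h⟩ := Metric.exists_finite_isCover_of_totallyBounded
    (ε := r.toNNReal) (by simpa using hr) hA
  refine ne_top_of_le_ne_top ?_ h.externalCoveringNumber_le_encard
  exact Set.encard_ne_top_iff.2 hC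

/-- A separated family of points in a ball has bounded cardinality, uniformly in the scale. -/
lemma exists_card_le_of_separated {E : Type*} [NormedAddCommGroup E] [NormedSpace ℝ E]
    [ProperSpace E] (C : ℝ) {η : ℝ} (hη : 0 < η) :
    ∃ M : ℕ, ∀ {ι : Type} (s : Finset ι) (p : ι → E) (x : E) (δ : ℝ), 0 < δ →
      (∀ i ∈ s, dist (p i) x ≤ C * δ) →
      (∀ i ∈ s, ∀ j ∈ s, i ≠ j → η * δ ≤ dist (p i) (p j)) → s.card ≤ M := by
  -- After rescaling by `δ⁻¹` the points lie in a fixed ball. Two points in the same ball of radius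
  -- `η / 2` would be too close, so the size of one finite cover bounds every such family.
  obtain ⟨T, -, hT⟩ := (isCompact_closedBall (0 : E) C).elim_finite_subcover_image
    (b := univ) (c := fun y => Metric.ball y (η / 2)) (fun _ _ => Metric.isOpen_ball)
    (fun y _ => mem_iUnion₂.2 ⟨y, mem_univ _, Metric.mem_ball_self (by positivity)⟩)
  obtain ⟨hTf, hT⟩ := hT
  refine ⟨hTf.toFinset.card, fun {ι} s p x δ hδ h1 h2 => ?_⟩
  have h3 : ∀ i ∈ s, ∃ y ∈ hTf.toFinset, dist (δ⁻¹ • (p i - x)) y < η / 2 := by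
    intro i hi
    have : δ⁻¹ • (p i - x) ∈ Metric.closedBall (0 : E) C := by
      rw [mem_closedBall_zero_iff, norm_smul, ← dist_eq_norm, Real.norm_of_nonneg (by positivity),
        inv_mul_le_iff₀ hδ, mul_comm]
      exact h1 i hi
    obtain ⟨y, hy, hxy⟩ := mem_iUnion₂.1 (hT this)
    exact ⟨y, by simpa using hy, hxy⟩
  choose! q hq hdist using h3
  refine Finset.card_le_card_of_injOn q hq ?_
  intro i hi j hj hij
  by_contra hne
  have h4 := h2 i hi j hj hne
  have h5 : dist (δ⁻¹ • (p i - x)) (δ⁻¹ • (p j - x)) < η := by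
    have := hdist i hi
    have h6 := hdist j hj
    rw [← hij, dist_comm] at h6
    linarith [dist_triangle (δ⁻¹ • (p i - x)) (q i) (δ⁻¹ • (p j - x))]
  rw [dist_smul₀, dist_sub_right, Real.norm_of_nonneg (by positivity), inv_mul_lt_iff₀ hδ] at h5
  linarith

/-- The content is that a similarity, given only by its effect on distances, is onto: `c⁻¹ • f` is
an isometry, hence affine by strict convexity, and an injective linear endomorphism in finite
dimension is surjective. -/
lemma image_ball_of_dist_eq {d : ℕ}
    {f : EuclideanSpace ℝ (Fin d) → EuclideanSpace ℝ (Fin d)} {c : ℝ} (hc : 0 < c)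
    (hf : ∀ x y, dist (f x) (f y) = c * dist x y) (x : EuclideanSpace ℝ (Fin d)) (r : ℝ) :
    Metric.ball (f x) (c * r) ⊆ f '' Metric.ball x r := by
  have hi : Isometry fun x => c⁻¹ • f x := by
    refine Isometry.of_dist_eq fun x y => ?_
    rw [dist_smul₀, hf, Real.norm_of_nonneg (by positivity), inv_mul_cancel_left₀ hc.ne']
  have hs : Function.Surjective fun x => c⁻¹ • f x := by
    have h1 : Function.Surjective hi.affineIsometryOfStrictConvexSpace.linear := by
      have := LinearMap.surjective_of_injective
        (f := hi.affineIsometryOfStrictConvexSpace.linear)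
        hi.affineIsometryOfStrictConvexSpace.linearIsometry.injective
      exact this
    exact (AffineMap.linear_surjective_iff _).1 h1
  intro y hy
  obtain ⟨z, hz⟩ := hs (c⁻¹ • y)
  have hz' : f z = y := by
    have := congrArg (fun v => c • v) hz
    simpa [smul_smul, hc.ne'] using this
  refine ⟨z, ?_, hz'⟩
  rw [← hz', Metric.mem_ball, hf] at hy
  exact lt_of_mul_lt_mul_left hy hc.le

end Covering

/-! ### Limit sets and their self-similar decomposition. -/

section LimitSet

variable {d : ℕ} {Λ : Type*}

/-- Uniform bounds for the contraction ratios and the numbers of maps of a family of systems. -/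
structure RatioBounds (I : Λ → SelfSimilarIFS d) (a b : ℝ) (N : ℕ) : Prop where
  pos : 0 < a
  le : a ≤ b
  lt_one : b < 1
  le_ratio : ∀ l i, a ≤ (I l).ratio i
  ratio_le : ∀ l i, (I l).ratio i ≤ b
  card_le : ∀ l, (I l).card ≤ N

lemma exists_ratioBounds [Finite Λ] (I : Λ → SelfSimilarIFS d) :
    ∃ a b N, RatioBounds I a b N := by
  have hN : ∃ N, ∀ l, (I l).card ≤ N := by
    obtain ⟨N, hN⟩ := (Set.finite_range fun l => (I l).card).bddAbove
    exact ⟨N, fun l => hN ⟨l, rfl⟩⟩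
  obtain ⟨N, hN⟩ := hN
  rcases isEmpty_or_nonempty (Σ l, Fin (I l).card) with h | h
  · exact ⟨1 / 2, 1 / 2, N, by norm_num, le_rfl, by norm_num, fun l i => h.elim ⟨l, i⟩,
      fun l i => h.elim ⟨l, i⟩, hN⟩
  · obtain ⟨x, hx⟩ := Finite.exists_min fun p : Σ l, Fin (I l).card => (I p.1).ratio p.2
    obtain ⟨y, hy⟩ := Finite.exists_max fun p : Σ l, Fin (I l).card => (I p.1).ratio p.2
    exact ⟨_, _, N, (I x.1).ratio_pos x.2, hx y, (I y.1).ratio_lt_one y.2,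
      fun l i => hx ⟨l, i⟩, fun l i => hy ⟨l, i⟩, hN⟩

/-- The limit set of a labelled tree. -/
abbrev limitSet (I : Λ → SelfSimilarIFS d) (Δ : Set (EuclideanSpace ℝ (Fin d)))
    (t : List ℕ → Λ) : Set (EuclideanSpace ℝ (Fin d)) :=
  treeLimitSet Δ fun w => I (t w)

variable {I : Λ → SelfSimilarIFS d} {Δ : Set (EuclideanSpace ℝ (Fin d))}

lemma SelfSimilarIFS.map_injective (S : SelfSimilarIFS d) (i : Fin S.card) :
    Function.Injective (S.map i) := by
  intro x y h
  have h1 := S.dist_map i x y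
  rw [h, dist_self] at h1
  have := (mul_eq_zero.1 h1.symm).resolve_left (S.ratio_pos i).ne'
  exact dist_eq_zero.1 this

lemma levelSet_succ_subset (hΔ : ∀ l i, (I l).map i '' Δ ⊆ Δ) (k : ℕ) (t : List ℕ → Λ) :
    levelSet Δ (k + 1) (fun w => I (t w)) ⊆ levelSet Δ k (fun w => I (t w)) := by
  induction k generalizing t with
  | zero => exact iUnion_subset fun i => hΔ _ i
  | succ k ih => exact iUnion_mono fun i => image_mono (ih (subtree t i))

lemma levelSet_antitone (hΔ : ∀ l i, (I l).map i '' Δ ⊆ Δ) (t : List ℕ → Λ) :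
    Antitone fun k => levelSet Δ k (fun w => I (t w)) :=
  antitone_nat_of_succ_le fun k => levelSet_succ_subset hΔ k t

lemma limitSet_subset (t : List ℕ → Λ) : limitSet I Δ t ⊆ Δ := iInter_subset _ 0

lemma isCompact_levelSet (hΔc : IsCompact Δ) (k : ℕ) (t : List ℕ → Λ) :
    IsCompact (levelSet Δ k (fun w => I (t w))) := by
  induction k generalizing t with
  | zero => exact hΔc
  | succ k ih =>
    refine isCompact_iUnion fun i => (ih (subtree t i)).image ?_
    have : LipschitzWith ((I (t [])).ratio i).toNNReal ((I (t [])).map i) :=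
      LipschitzWith.of_dist_le_mul fun x y => by
        rw [(I (t [])).dist_map, Real.coe_toNNReal _ ((I (t [])).ratio_pos i).le]
    exact this.continuous

lemma limitSet_nonempty_iff (hΔc : IsCompact Δ) (hΔ : ∀ l i, (I l).map i '' Δ ⊆ Δ)
    (t : List ℕ → Λ) :
    (limitSet I Δ t).Nonempty ↔ ∀ k, (levelSet Δ k (fun w => I (t w))).Nonempty := by
  refine ⟨fun h k => h.mono (iInter_subset _ k), fun h => ?_⟩
  exact IsCompact.nonempty_iInter_of_sequence_nonempty_isCompact_isClosed _
    (fun k => levelSet_succ_subset hΔ k t) h (isCompact_levelSet hΔc 0 t)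
    (fun k => (isCompact_levelSet hΔc k t).isClosed)

/-- A point of the limit set may use a different child of the root at each level. By the pigeonhole
principle one child occurs infinitely often; its map is injective, so the preimage is the same each
time, and the levels decrease. -/
lemma limitSet_eq (hΔ : ∀ l i, (I l).map i '' Δ ⊆ Δ) (t : List ℕ → Λ) :
    limitSet I Δ t =
      ⋃ i : Fin (I (t [])).card, (I (t [])).map i '' limitSet I Δ (subtree t i) := by
  apply Subset.antisymm
  · intro x hx
    have h1 : ∀ k, ∃ i : Fin (I (t [])).card,
        x ∈ (I (t [])).map i '' levelSet Δ k (fun w => I (subtree t i w)) := by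
      intro k
      exact mem_iUnion.1 (mem_iInter.1 hx (k + 1))
    choose i hi using h1
    obtain ⟨j, hj⟩ := Finite.exists_infinite_fiber i
    rw [Set.infinite_coe_iff] at hj
    refine mem_iUnion.2 ⟨j, ?_⟩
    obtain ⟨k0, hk0⟩ := hj.nonempty
    have hy := hi k0
    rw [show i k0 = j from hk0] at hy
    obtain ⟨y, -, rfl⟩ := hy
    refine ⟨y, mem_iInter.2 fun k => ?_, rfl⟩
    obtain ⟨k', hk', hkk⟩ := hj.exists_gt k
    have hy' := hi k'
    rw [show i k' = j from hk', (SelfSimilarIFS.map_injective _ j).mem_set_image] at hy'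
    exact levelSet_antitone hΔ (subtree t j) hkk.le hy'
  · refine iUnion_subset fun i => ?_
    rintro _ ⟨y, hy, rfl⟩
    refine mem_iInter.2 fun k => ?_
    cases k with
    | zero => exact hΔ _ i ⟨y, limitSet_subset _ hy, rfl⟩
    | succ k => exact mem_iUnion.2 ⟨i, y, mem_iInter.1 hy k, rfl⟩

lemma limitSet_nonempty_iff_exists (hΔ : ∀ l i, (I l).map i '' Δ ⊆ Δ) (t : List ℕ → Λ) :
    (limitSet I Δ t).Nonempty ↔
      ∃ i : Fin (I (t [])).card, (limitSet I Δ (subtree t i)).Nonempty := by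
  rw [limitSet_eq hΔ]
  simp [nonempty_iUnion]

end LimitSet

/-! ### Cylinders of a given size and covering numbers. -/

section Words

variable {d : ℕ} {Λ : Type*}

/-- The subtree of a labelled tree at the node `w`. -/
def subtreeAt (t : List ℕ → Λ) (w : List ℕ) : List ℕ → Λ := fun u => t (w ++ u)

@[simp] lemma subtreeAt_nil (t : List ℕ → Λ) : subtreeAt t [] = t := rfl

/-- The words `w` of the tree at which the product of the contraction ratios first drops
below `δ`, cut off at depth `k`. -/
noncomputable def cutWords (I : Λ → SelfSimilarIFS d) :
    ℕ → ℝ → (List ℕ → Λ) → Finset (List ℕ)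
  | 0, _, _ => {[]}
  -- Passing to a child divides the threshold by the ratio, so the product of ratios along a word is
  -- below the initial `δ` exactly when the current threshold exceeds `1`.
  | k + 1, δ, t => if 1 < δ then {[]} else
      Finset.univ.biUnion fun i : Fin (I (t [])).card =>
        (cutWords I k (δ / (I (t [])).ratio i) (subtree t i)).image (List.cons (i : ℕ))

/-- The sum of `Y` over the subtrees at the words of `cutWords`. -/
noncomputable def cutSum (I : Λ → SelfSimilarIFS d) (Y : (List ℕ → Λ) → ℝ) :
    ℕ → ℝ → (List ℕ → Λ) → ℝ
  | 0, _, t => Y t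
  | k + 1, δ, t => if 1 < δ then Y t else
      ∑ i : Fin (I (t [])).card, cutSum I Y k (δ / (I (t [])).ratio i) (subtree t i)

/-- The `i`-th map of a system, extended by the identity to all `i`. -/
def SelfSimilarIFS.extMap (S : SelfSimilarIFS d) (i : ℕ) :
    EuclideanSpace ℝ (Fin d) → EuclideanSpace ℝ (Fin d) :=
  if h : i < S.card then S.map ⟨i, h⟩ else id

/-- The `i`-th ratio of a system, extended by `1` to all `i`. -/
noncomputable def SelfSimilarIFS.extRatio (S : SelfSimilarIFS d) (i : ℕ) : ℝ :=
  if h : i < S.card then S.ratio ⟨i, h⟩ else 1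

@[simp] lemma SelfSimilarIFS.extMap_val (S : SelfSimilarIFS d) (i : Fin S.card) :
    S.extMap i = S.map i := by simp [SelfSimilarIFS.extMap]

@[simp] lemma SelfSimilarIFS.extRatio_val (S : SelfSimilarIFS d) (i : Fin S.card) :
    S.extRatio i = S.ratio i := by simp [SelfSimilarIFS.extRatio]

/-- The composition of the maps along a word. -/
def wordMap (I : Λ → SelfSimilarIFS d) :
    List ℕ → (List ℕ → Λ) → EuclideanSpace ℝ (Fin d) → EuclideanSpace ℝ (Fin d)
  | [], _ => id
  | i :: w, t => (I (t [])).extMap i ∘ wordMap I w (subtree t i)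

/-- The product of the contraction ratios along a word. -/
noncomputable def wordRatio (I : Λ → SelfSimilarIFS d) : List ℕ → (List ℕ → Λ) → ℝ
  | [], _ => 1
  | i :: w, t => (I (t [])).extRatio i * wordRatio I w (subtree t i)

variable {I : Λ → SelfSimilarIFS d} {Δ : Set (EuclideanSpace ℝ (Fin d))} {a b : ℝ} {N : ℕ}

lemma wordRatio_pos (w : List ℕ) (t : List ℕ → Λ) : 0 < wordRatio I w t := by
  induction w generalizing t with
  | nil => exact one_pos
  | cons i w ih =>
    refine mul_pos ?_ (ih _)
    unfold SelfSimilarIFS.extRatio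
    split_ifs with h
    · exact (I (t [])).ratio_pos _
    · exact one_pos

lemma dist_wordMap (w : List ℕ) (t : List ℕ → Λ) (x y : EuclideanSpace ℝ (Fin d)) :
    dist (wordMap I w t x) (wordMap I w t y) = wordRatio I w t * dist x y := by
  induction w generalizing t with
  | nil => simp [wordMap, wordRatio]
  | cons i w ih =>
    rw [wordMap, wordRatio, mul_assoc, ← ih]
    simp only [Function.comp]
    unfold SelfSimilarIFS.extMap SelfSimilarIFS.extRatio
    split_ifs with h
    · exact (I (t [])).dist_map _ _ _
    · simp

lemma wordMap_image_subset {A : Set (EuclideanSpace ℝ (Fin d))}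
    (hA : ∀ l i, (I l).map i '' A ⊆ A) (w : List ℕ) (t : List ℕ → Λ) :
    wordMap I w t '' A ⊆ A := by
  induction w generalizing t with
  | nil => simp [wordMap]
  | cons i w ih =>
    rw [wordMap, image_comp]
    refine (image_mono (ih _)).trans ?_
    unfold SelfSimilarIFS.extMap
    split_ifs with h
    · exact hA _ _
    · simp

lemma mem_cutWords_succ {k : ℕ} {δ : ℝ} (hδ : ¬ 1 < δ) {t : List ℕ → Λ} {w : List ℕ} :
    w ∈ cutWords I (k + 1) δ t ↔ ∃ i : Fin (I (t [])).card,
      ∃ u ∈ cutWords I k (δ / (I (t [])).ratio i) (subtree t i), (i : ℕ) :: u = w := by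
  simp [cutWords, hδ]

lemma cutSum_eq_sum (Y : (List ℕ → Λ) → ℝ) (k : ℕ) (δ : ℝ) (t : List ℕ → Λ) :
    cutSum I Y k δ t = ∑ w ∈ cutWords I k δ t, Y (subtreeAt t w) := by
  induction k generalizing δ t with
  | zero => simp [cutSum, cutWords]
  | succ k ih =>
    by_cases hδ : 1 < δ
    · simp [cutSum, cutWords, hδ]
    · simp only [cutSum, cutWords, hδ, if_false]
      rw [Finset.sum_biUnion]
      · refine Finset.sum_congr rfl fun i _ => ?_
        rw [ih, Finset.sum_image (fun x _ y _ h => (List.cons.inj h).2)]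
        rfl
      · intro i _ j _ hij
        rw [Function.onFun, Finset.disjoint_left]
        intro w hw hw'
        obtain ⟨u, -, rfl⟩ := Finset.mem_image.1 hw
        obtain ⟨v, -, h⟩ := Finset.mem_image.1 hw'
        exact hij (Fin.ext (List.cons.inj h).1.symm)

lemma cutSum_one (k : ℕ) (δ : ℝ) (t : List ℕ → Λ) :
    cutSum I (fun _ => 1) k δ t = (cutWords I k δ t).card := by
  simp [cutSum_eq_sum]

lemma length_le_of_mem_cutWords {k : ℕ} {δ : ℝ} {t : List ℕ → Λ} {w : List ℕ}
    (hw : w ∈ cutWords I k δ t) : w.length ≤ k := by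
  induction k generalizing δ t w with
  | zero => simp_all [cutWords]
  | succ k ih =>
    by_cases hδ : 1 < δ
    · simp_all [cutWords]
    · obtain ⟨i, u, hu, rfl⟩ := (mem_cutWords_succ hδ).1 hw
      simpa using ih hu

/-- The invariant `b ^ k < δ` passes to the children with `k` lowered by one. At `k = 0` it reads `1
< δ`, so the depth cut-off in `cutWords` never interferes. -/
lemma RatioBounds.pow_lt_div (h : RatioBounds I a b N) {k : ℕ} {δ : ℝ} (hδ : b ^ (k + 1) < δ)
    (l : Λ) (i : Fin (I l).card) : b ^ k < δ / (I l).ratio i := by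
  rw [lt_div_iff₀ ((I l).ratio_pos i)]
  refine lt_of_le_of_lt ?_ hδ
  rw [pow_succ]
  have := h.pos.trans_le h.le
  gcongr
  exact h.ratio_le l i

lemma wordRatio_lt_of_mem_cutWords (h : RatioBounds I a b N) {k : ℕ} {δ : ℝ}
    (hδ : b ^ k < δ) {t : List ℕ → Λ} {w : List ℕ} (hw : w ∈ cutWords I k δ t) :
    wordRatio I w t < δ := by
  induction k generalizing δ t w with
  | zero =>
    simp only [cutWords, Finset.mem_singleton] at hw
    subst hw
    simpa [wordRatio] using hδ
  | succ k ih =>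
    by_cases h1 : 1 < δ
    · simp only [cutWords, h1, if_true, Finset.mem_singleton] at hw
      subst hw
      simpa [wordRatio] using h1
    · obtain ⟨i, u, hu, rfl⟩ := (mem_cutWords_succ h1).1 hw
      have := ih (h.pow_lt_div hδ _ i) hu
      rw [lt_div_iff₀ ((I _).ratio_pos i)] at this
      simpa [wordRatio, mul_comm] using this

/-- The last letter of a word overshoots the threshold by at most one ratio, which is at least `a`.
-/
lemma mul_le_wordRatio_of_mem_cutWords (h : RatioBounds I a b N) {k : ℕ} {δ : ℝ}
    (hδ : a * δ ≤ 1) {t : List ℕ → Λ} {w : List ℕ} (hw : w ∈ cutWords I k δ t) :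
    a * δ ≤ wordRatio I w t := by
  induction k generalizing δ t w with
  | zero =>
    simp only [cutWords, Finset.mem_singleton] at hw
    subst hw
    simpa [wordRatio] using hδ
  | succ k ih =>
    by_cases h1 : 1 < δ
    · simp only [cutWords, h1, if_true, Finset.mem_singleton] at hw
      subst hw
      simpa [wordRatio] using hδ
    · obtain ⟨i, u, hu, rfl⟩ := (mem_cutWords_succ h1).1 hw
      have hp := (I (t [])).ratio_pos i
      have h2 : a * (δ / (I (t [])).ratio i) ≤ 1 := by
        rw [mul_div_assoc', div_le_one hp]
        have := h.le_ratio _ i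
        have := h.pos
        nlinarith
      have := ih h2 hu
      rw [mul_div_assoc', div_le_iff₀ hp] at this
      simpa [wordRatio, mul_comm] using this

/-- Distinct cut words are not prefixes of one another; at the first letter where they differ the
images of `U` separate. -/
lemma disjoint_wordMap_image {U : Set (EuclideanSpace ℝ (Fin d))}
    (hU : ∀ l i, (I l).map i '' U ⊆ U)
    (hd : ∀ l, Pairwise fun i j => Disjoint ((I l).map i '' U) ((I l).map j '' U))
    {k : ℕ} {δ : ℝ} {t : List ℕ → Λ} {w w' : List ℕ} (hw : w ∈ cutWords I k δ t)
    (hw' : w' ∈ cutWords I k δ t) (hne : w ≠ w') :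
    Disjoint (wordMap I w t '' U) (wordMap I w' t '' U) := by
  induction k generalizing δ t w w' with
  | zero =>
    simp only [cutWords, Finset.mem_singleton] at hw hw'
    exact absurd (hw.trans hw'.symm) hne
  | succ k ih =>
    by_cases h1 : 1 < δ
    · simp only [cutWords, h1, if_true, Finset.mem_singleton] at hw hw'
      exact absurd (hw.trans hw'.symm) hne
    · obtain ⟨i, u, hu, rfl⟩ := (mem_cutWords_succ h1).1 hw
      obtain ⟨j, v, hv, rfl⟩ := (mem_cutWords_succ h1).1 hw'
      simp only [wordMap, image_comp, SelfSimilarIFS.extMap_val]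
      by_cases hij : i = j
      · subst hij
        exact (disjoint_image_iff (SelfSimilarIFS.map_injective _ i)).2
          (ih hu hv fun h => hne (by rw [h]))
      · exact (hd _ hij).mono (image_mono (wordMap_image_subset hU _ _))
          (image_mono (wordMap_image_subset hU _ _))

lemma limitSet_eq_biUnion_cutWords (hΔ : ∀ l i, (I l).map i '' Δ ⊆ Δ) (k : ℕ) (δ : ℝ)
    (t : List ℕ → Λ) :
    limitSet I Δ t =
      ⋃ w ∈ cutWords I k δ t, wordMap I w t '' limitSet I Δ (subtreeAt t w) := by
  induction k generalizing δ t with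
  | zero => simp [cutWords, wordMap]
  | succ k ih =>
    by_cases h1 : 1 < δ
    · simp [cutWords, wordMap, h1]
    · ext x
      rw [limitSet_eq hΔ]
      simp only [mem_iUnion, mem_cutWords_succ h1]
      constructor
      · rintro ⟨i, y, hy, rfl⟩
        rw [ih (δ / (I (t [])).ratio i) (subtree t i)] at hy
        simp only [mem_iUnion] at hy
        obtain ⟨u, hu, z, hz, rfl⟩ := hy
        exact ⟨_, ⟨i, u, hu, rfl⟩, z, hz, by simp [wordMap]⟩
      · rintro ⟨_, ⟨i, u, hu, rfl⟩, z, hz, rfl⟩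
        refine ⟨i, wordMap I u (subtree t i) z, ?_, by simp [wordMap]⟩
        rw [ih (δ / (I (t [])).ratio i) (subtree t i)]
        exact mem_biUnion hu ⟨z, hz, rfl⟩

lemma coverNum_limitSet_le (h : RatioBounds I a b N) (hΔ : ∀ l i, (I l).map i '' Δ ⊆ Δ)
    {D : ℝ} (hD : ∀ x ∈ Δ, ∀ y ∈ Δ, dist x y ≤ D) {y₀ : EuclideanSpace ℝ (Fin d)}
    (hy₀ : y₀ ∈ Δ) {k : ℕ} {δ r : ℝ} (hδ : b ^ k < δ) (hr : δ * D ≤ r) (t : List ℕ → Λ) :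
    coverNum r (limitSet I Δ t) ≤ (cutWords I k δ t).card := by
  classical
  have hD0 : 0 ≤ D := (dist_self y₀).symm.le.trans (hD _ hy₀ _ hy₀)
  have hδ0 : 0 < δ := (pow_pos (h.pos.trans_le h.le) k).trans hδ
  refine (coverNum_le_card (T := (cutWords I k δ t).image fun w => wordMap I w t y₀)
    ((mul_nonneg hδ0.le hD0).trans hr) ?_).trans (by exact_mod_cast Finset.card_image_le)
  intro x hx
  rw [limitSet_eq_biUnion_cutWords hΔ k δ] at hx
  simp only [mem_iUnion] at hx
  obtain ⟨w, hw, z, hz, rfl⟩ := hx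
  refine ⟨_, Finset.mem_image_of_mem _ hw, ?_⟩
  rw [dist_wordMap]
  refine le_trans ?_ hr
  exact mul_le_mul (wordRatio_lt_of_mem_cutWords h hδ hw).le
    (hD _ (limitSet_subset _ hz) _ hy₀) dist_nonneg hδ0.le

/-- At most boundedly many of the cylinders of size about `δ` meet a ball of radius `2 * δ`. -/
lemma exists_card_cutWords_le (h : RatioBounds I a b N) (hU : UniformOSC I)
    (hΔc : IsCompact Δ) :
    ∃ M : ℕ, 0 < M ∧ ∀ (t : List ℕ → Λ) (k : ℕ) (δ : ℝ) (x : EuclideanSpace ℝ (Fin d))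
      (s : Finset (List ℕ)), δ ≤ 1 → b ^ k < δ → s ⊆ cutWords I k δ t →
      (∀ w ∈ s, ∃ y ∈ Δ, dist (wordMap I w t y) x ≤ 2 * δ) → s.card ≤ M := by
  obtain ⟨U, hUo, ⟨v, hv⟩, hU⟩ := hU
  obtain ⟨ρ, hρ, hball⟩ := Metric.isOpen_iff.1 hUo v hv
  obtain ⟨D, hD⟩ := hΔc.isBounded.subset_closedBall v
  -- The images of the fixed point `v` of `U` serve as markers: they lie within `(2 + |D|) * δ` of
  -- `x`, and each image of `U` contains a ball of radius `a * δ * ρ` about its marker.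
  obtain ⟨M, hM⟩ := exists_card_le_of_separated (E := EuclideanSpace ℝ (Fin d)) (2 + |D|)
    (mul_pos h.pos hρ)
  refine ⟨M + 1, Nat.succ_pos _, fun t k δ x s hδ1 hδ hs hx => (hM s
    (fun w => wordMap I w t v) x δ ?_ ?_ ?_).trans (Nat.le_succ M)⟩
  · exact (pow_pos (h.pos.trans_le h.le) k).trans hδ
  · intro w hw
    obtain ⟨y, hy, hyx⟩ := hx w hw
    have h1 : dist (wordMap I w t v) (wordMap I w t y) ≤ δ * |D| := by
      rw [dist_wordMap]
      refine mul_le_mul (wordRatio_lt_of_mem_cutWords h hδ (hs hw)).le ?_ dist_nonneg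
        ((pow_pos (h.pos.trans_le h.le) k).trans hδ).le
      rw [dist_comm]
      exact (hD hy).trans (le_abs_self D)
    have := dist_triangle (wordMap I w t v) (wordMap I w t y) x
    linarith
  · intro w hw w' hw' hne
    by_contra! hlt
    have haδ : a * δ ≤ 1 := by
      have := h.pos
      have := h.le.trans_lt h.lt_one
      nlinarith [(pow_pos (h.pos.trans_le h.le) k).trans hδ]
    have h1 := mul_le_wordRatio_of_mem_cutWords h haδ (hs hw)
    -- Markers closer than `a * ρ * δ` would make two disjoint images of `U` meet.
    have h2 : wordMap I w' t v ∈ wordMap I w t '' U := by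
      refine image_mono hball (image_ball_of_dist_eq (wordRatio_pos w t)
        (dist_wordMap w t) v ρ ?_)
      rw [Metric.mem_ball, dist_comm]
      refine hlt.trans_le ?_
      calc a * ρ * δ = (a * δ) * ρ := by ring
        _ ≤ _ := by gcongr
    exact (disjoint_wordMap_image (fun l => (hU l).1) (fun l => (hU l).2) (hs hw) (hs hw')
      hne).le_bot ⟨h2, v, hv, rfl⟩

/-- The upper estimate for local covering numbers. -/
lemma coverNum_limitSet_inter_closedBall_le (h : RatioBounds I a b N)
    (hΔ : ∀ l i, (I l).map i '' Δ ⊆ Δ)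
    {D : ℝ} (hD : ∀ x ∈ Δ, ∀ y ∈ Δ, dist x y ≤ D) {y₀ : EuclideanSpace ℝ (Fin d)}
    (hy₀ : y₀ ∈ Δ) {M : ℕ}
    (hM : ∀ (t : List ℕ → Λ) (k : ℕ) (δ : ℝ) (x : EuclideanSpace ℝ (Fin d))
      (s : Finset (List ℕ)), δ ≤ 1 → b ^ k < δ → s ⊆ cutWords I k δ t →
      (∀ w ∈ s, ∃ y ∈ Δ, dist (wordMap I w t y) x ≤ 2 * δ) → s.card ≤ M)
    {k k' : ℕ} {R δ r B : ℝ} (hR1 : R ≤ 1) (hR : b ^ k < R) (hδ : b ^ k' < δ)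
    (hr : R * (δ * D) ≤ r) {t : List ℕ → Λ} (hB : 0 ≤ B)
    (hw : ∀ w ∈ cutWords I k R t, cutSum I (fun _ => 1) k' δ (subtreeAt t w) ≤ B)
    (x : EuclideanSpace ℝ (Fin d)) :
    ((coverNum r (limitSet I Δ t ∩ Metric.closedBall x R) : ℕ∞) : ℝ≥0∞) ≤
      ENNReal.ofReal (M * B) := by
  classical
  have hD0 : 0 ≤ D := (dist_self y₀).symm.le.trans (hD _ hy₀ _ hy₀)
  have hδ0 : 0 < δ := (pow_pos (h.pos.trans_le h.le) k').trans hδ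
  have hR0 : 0 < R := (pow_pos (h.pos.trans_le h.le) k).trans hR
  set S := (cutWords I k R t).filter
    fun w => ∃ y ∈ Δ, dist (wordMap I w t y) x ≤ 2 * R with hS
  have hSM : S.card ≤ M := hM t k R x S hR1 hR (Finset.filter_subset _ _)
    fun w hw => (Finset.mem_filter.1 hw).2
  set T := S.biUnion fun w => (cutWords I k' δ (subtreeAt t w)).image
    fun u => wordMap I w t (wordMap I u (subtreeAt t w) y₀) with hT
  have hcov : coverNum r (limitSet I Δ t ∩ Metric.closedBall x R) ≤ T.card := by
    refine coverNum_le_card ((by positivity : (0:ℝ) ≤ R * (δ * D)).trans hr) ?_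
    rintro z ⟨hz, hzx⟩
    rw [limitSet_eq_biUnion_cutWords hΔ k R] at hz
    simp only [mem_iUnion] at hz
    obtain ⟨w, hw1, z, hz, rfl⟩ := hz
    have hwS : w ∈ S := Finset.mem_filter.2 ⟨hw1, z, limitSet_subset _ hz, by
      have := Metric.mem_closedBall.1 hzx
      linarith⟩
    rw [limitSet_eq_biUnion_cutWords hΔ k' δ] at hz
    simp only [mem_iUnion] at hz
    obtain ⟨u, hu, z, hz, rfl⟩ := hz
    refine ⟨_, Finset.mem_biUnion.2 ⟨w, hwS, Finset.mem_image_of_mem _ hu⟩, ?_⟩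
    rw [dist_wordMap, dist_wordMap]
    refine le_trans ?_ hr
    refine mul_le_mul (wordRatio_lt_of_mem_cutWords h hR hw1).le ?_ ?_ hR0.le
    · exact mul_le_mul (wordRatio_lt_of_mem_cutWords h hδ hu).le
        (hD _ (limitSet_subset _ hz) _ hy₀) dist_nonneg hδ0.le
    · exact mul_nonneg (wordRatio_pos _ _).le dist_nonneg
  have hTc : (T.card : ℝ) ≤ M * B := by
    calc (T.card : ℝ) ≤ ∑ w ∈ S, (((cutWords I k' δ (subtreeAt t w)).image
          fun u => wordMap I w t (wordMap I u (subtreeAt t w) y₀)).card : ℝ) := by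
          exact_mod_cast Finset.card_biUnion_le
      _ ≤ ∑ w ∈ S, B := by
          refine Finset.sum_le_sum fun w hwS => ?_
          refine le_trans ?_ (hw w (Finset.mem_filter.1 hwS).1)
          rw [cutSum_one]
          exact_mod_cast Finset.card_image_le
      _ = S.card * B := by simp
      _ ≤ M * B := by
          gcongr
  calc ((coverNum r (limitSet I Δ t ∩ Metric.closedBall x R) : ℕ∞) : ℝ≥0∞)
      ≤ ((T.card : ℕ∞) : ℝ≥0∞) := ENat.toENNReal_le.2 hcov
    _ = ENNReal.ofReal (T.card : ℝ) := by simp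
    _ ≤ _ := ENNReal.ofReal_le_ofReal hTc

open Classical in
/-- The indicator function of survival. -/
noncomputable def survivalIndicator (I : Λ → SelfSimilarIFS d)
    (Δ : Set (EuclideanSpace ℝ (Fin d))) (t : List ℕ → Λ) : ℝ :=
  if (limitSet I Δ t).Nonempty then 1 else 0

/-- The lower estimate for covering numbers, for a similar copy of the limit set. -/
lemma cutSum_survivalIndicator_le (h : RatioBounds I a b N)
    (hΔ : ∀ l i, (I l).map i '' Δ ⊆ Δ) {M : ℕ} (hM0 : 0 < M)
    (hM : ∀ (t : List ℕ → Λ) (k : ℕ) (δ : ℝ) (x : EuclideanSpace ℝ (Fin d))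
      (s : Finset (List ℕ)), δ ≤ 1 → b ^ k < δ → s ⊆ cutWords I k δ t →
      (∀ w ∈ s, ∃ y ∈ Δ, dist (wordMap I w t y) x ≤ 2 * δ) → s.card ≤ M)
    {g : EuclideanSpace ℝ (Fin d) → EuclideanSpace ℝ (Fin d)} {c : ℝ} (hc : 0 < c)
    (hg : ∀ x y, dist (g x) (g y) = c * dist x y)
    {k : ℕ} {δ : ℝ} (hδ1 : δ ≤ 1) (hδ : b ^ k < δ) (t : List ℕ → Λ) :
    ENNReal.ofReal (cutSum I (survivalIndicator I Δ) k δ t) ≤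
      M * ((coverNum (c * δ) (g '' limitSet I Δ t) : ℕ∞) : ℝ≥0∞) := by
  classical
  have hδ0 : 0 < δ := (pow_pos (h.pos.trans_le h.le) k).trans hδ
  by_cases htop : coverNum (c * δ) (g '' limitSet I Δ t) = ⊤
  · rw [htop, ENat.toENNReal_top, ENNReal.mul_top (by exact_mod_cast hM0.ne')]
    exact le_top
  obtain ⟨T, hTc, hT⟩ := exists_finset_card_eq_coverNum (by positivity) htop
  set S := (cutWords I k δ t).filter fun w => (limitSet I Δ (subtreeAt t w)).Nonempty with hS
  have hsum : cutSum I (survivalIndicator I Δ) k δ t = S.card := by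
    rw [cutSum_eq_sum]
    simp [survivalIndicator, hS]
  have hx : ∀ w ∈ S, ∃ z, z ∈ limitSet I Δ (subtreeAt t w) :=
    fun w hw => (Finset.mem_filter.1 hw).2
  choose! z hz using hx
  have hy : ∀ w ∈ S, ∃ y ∈ T, dist (g (wordMap I w t (z w))) y ≤ c * δ := by
    intro w hw
    refine hT _ ⟨_, ?_, rfl⟩
    rw [limitSet_eq_biUnion_cutWords hΔ k δ]
    exact mem_biUnion (Finset.mem_filter.1 hw).1 ⟨_, hz w hw, rfl⟩
  choose! y hyT hy using hy
  -- Cylinders served by the same centre contain points whose images under `g` are within `2 * c *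
  -- δ`; undoing `g` gives `2 * δ`, and bounded overlap leaves at most `M` of them.
  have hcard : S.card ≤ M * T.card := by
    refine Finset.card_le_mul_card_image_of_maps_to hyT M fun q _ => ?_
    rcases (S.filter fun w => y w = q).eq_empty_or_nonempty with he | ⟨w₀, hw₀⟩
    · rw [he]
      simp
    · refine hM t k δ (wordMap I w₀ t (z w₀)) _ hδ1 hδ
        ((Finset.filter_subset _ _).trans (Finset.filter_subset _ _)) fun w hw => ?_
      rw [Finset.mem_filter] at hw hw₀
      refine ⟨z w, limitSet_subset _ (hz w hw.1), ?_⟩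
      have h1 := hy w hw.1
      have h2 := hy w₀ hw₀.1
      rw [hw.2] at h1
      rw [hw₀.2, dist_comm] at h2
      have h3 := dist_triangle (g (wordMap I w t (z w))) q (g (wordMap I w₀ t (z w₀)))
      rw [hg] at h3
      have : c * dist (wordMap I w t (z w)) (wordMap I w₀ t (z w₀)) ≤ c * (2 * δ) := by linarith
      exact le_of_mul_le_mul_left this hc
  rw [hsum, ← hTc]
  simp only [ENNReal.ofReal_natCast, ENat.toENNReal_coe]
  exact_mod_cast hcard

end Words

/-! ### Upper tails of cylinder counts via exponential moments. -/

section UpperTail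

/-- The law of a tree of independent labels with law `ν`. -/
noncomputable abbrev treeMeasure {Λ : Type*} [MeasurableSpace Λ] (ν : Measure Λ) :
    Measure (List ℕ → Λ) :=
  Measure.infinitePi fun _ : List ℕ => ν

/-- The sum of the `s`-th powers of the contraction ratios of a system. -/
noncomputable def SelfSimilarIFS.ratioSum {d : ℕ} (S : SelfSimilarIFS d) (s : ℝ) : ℝ :=
  ∑ i, S.ratio i ^ s

variable {d : ℕ} {Λ : Type*} {I : Λ → SelfSimilarIFS d}
  {a b : ℝ} {N : ℕ}

lemma SelfSimilarIFS.ratioSum_nonneg (S : SelfSimilarIFS d) (s : ℝ) : 0 ≤ S.ratioSum s :=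
  Finset.sum_nonneg fun i _ => Real.rpow_nonneg (S.ratio_pos i).le s

lemma RatioBounds.ratioSum_le (h : RatioBounds I a b N) {s : ℝ} (hs : 0 ≤ s) (l : Λ) :
    (I l).ratioSum s ≤ N := by
  calc (I l).ratioSum s ≤ ∑ _i : Fin (I l).card, (1 : ℝ) :=
        Finset.sum_le_sum fun i _ =>
          Real.rpow_le_one ((I l).ratio_pos i).le ((I l).ratio_lt_one i).le hs
    _ = (I l).card := by simp
    _ ≤ N := by exact_mod_cast h.card_le l

lemma lt_of_mem_of_mem_cutWords (h : RatioBounds I a b N) {k : ℕ} {δ : ℝ} {t : List ℕ → Λ}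
    {w : List ℕ} (hw : w ∈ cutWords I k δ t) : ∀ x ∈ w, x < N := by
  induction k generalizing δ t w with
  | zero => simp_all [cutWords]
  | succ k ih =>
    by_cases hδ : 1 < δ
    · simp_all [cutWords]
    · obtain ⟨i, u, hu, rfl⟩ := (mem_cutWords_succ hδ).1 hw
      intro x hx
      rcases List.mem_cons.1 hx with rfl | hx
      · exact i.2.trans_le (h.card_le _)
      · exact ih hu x hx

/-- An elementary estimate for exponential moments of a variable with mean less than one. -/
lemma sum_mul_exp_le_exp {ι : Type*} [Fintype ι] {p S : ι → ℝ} (hp : ∀ l, 0 ≤ p l)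
    (hp1 : ∑ l, p l = 1) {N u : ℝ} (hS0 : ∀ l, 0 ≤ S l) (hSN : ∀ l, S l ≤ N) (hu : 0 ≤ u)
    (huN : u * N ≤ 1) (huN2 : u * N ^ 2 ≤ 1 - ∑ l, p l * S l) :
    ∑ l, p l * Real.exp (u * S l) ≤ Real.exp u := by
  have h1 : ∀ l, Real.exp (u * S l) ≤ 1 + u * S l + u ^ 2 * N ^ 2 := by
    intro l
    have h2 : 0 ≤ u * S l := mul_nonneg hu (hS0 l)
    have h3 : u * S l ≤ u * N := by gcongr; exact hSN l
    have h4 := abs_le.1 (Real.abs_exp_sub_one_sub_id_le (x := u * S l)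
      (by rw [abs_of_nonneg h2]; linarith))
    have h5 : (u * S l) ^ 2 ≤ (u * N) ^ 2 := by gcongr
    have h6 : (u * N) ^ 2 = u ^ 2 * N ^ 2 := by ring
    linarith [h4.2]
  calc ∑ l, p l * Real.exp (u * S l) ≤ ∑ l, p l * (1 + u * S l + u ^ 2 * N ^ 2) :=
        Finset.sum_le_sum fun l _ => mul_le_mul_of_nonneg_left (h1 l) (hp l)
    _ = (∑ l, p l) * (1 + u ^ 2 * N ^ 2) + u * ∑ l, p l * S l := by
        rw [Finset.sum_mul, Finset.mul_sum, ← Finset.sum_add_distrib]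
        exact Finset.sum_congr rfl fun l _ => by ring
    _ ≤ 1 + u := by
        rw [hp1]
        nlinarith
    _ ≤ Real.exp u := by linarith [Real.add_one_le_exp u]

variable [MeasurableSpace Λ]

/-- A union bound over the nodes of the tree of bounded depth. -/
lemma measure_exists_subtreeAt_le (ν : Measure Λ) [IsProbabilityMeasure ν] (N : ℕ)
    (Q : (List ℕ → Λ) → Prop) (n : ℕ) :
    treeMeasure ν {t | ∃ w : List ℕ, w.length ≤ n ∧ (∀ x ∈ w, x < N) ∧ Q (subtreeAt t w)} ≤
      (N + 1) ^ n * treeMeasure ν {t | Q t} := by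
  induction n with
  | zero =>
    simp only [pow_zero, one_mul]
    refine measure_mono ?_
    rintro t ⟨w, hw, -, hQ⟩
    rw [Nat.le_zero, List.length_eq_zero_iff] at hw
    subst hw
    exact hQ
  | succ n ih =>
    set A := {t | ∃ w : List ℕ, w.length ≤ n ∧ (∀ x ∈ w, x < N) ∧ Q (subtreeAt t w)} with hA
    have h1 : {t | ∃ w : List ℕ, w.length ≤ n + 1 ∧ (∀ x ∈ w, x < N) ∧ Q (subtreeAt t w)} ⊆
        {t | Q t} ∪ ⋃ i ∈ Finset.range N, (fun t : List ℕ → Λ => subtree t i) ⁻¹' A := by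
      rintro t ⟨w, hw, hwN, hQ⟩
      cases w with
      | nil => exact Or.inl hQ
      | cons i w =>
        refine Or.inr (mem_biUnion (Finset.mem_coe.2 (Finset.mem_range.2 (hwN i (by simp)))) ?_)
        exact ⟨w, by simpa using hw, fun x hx => hwN x (List.mem_cons_of_mem _ hx), hQ⟩
    -- As `Q` is arbitrary these sets may fail to be measurable; the inequality for preimages holds
    -- regardless.
    have h2 : ∀ i, treeMeasure ν ((fun t : List ℕ → Λ => subtree t i) ⁻¹' A) ≤
        treeMeasure ν A := by
      intro i
      conv_rhs => rw [treeMeasure, ← map_subtree_infinitePi ν i]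
      exact Measure.le_map_apply (measurable_subtree i).aemeasurable A
    have h3 : treeMeasure ν {t | Q t} ≤ (N + 1) ^ n * treeMeasure ν {t | Q t} :=
      le_mul_of_one_le_left zero_le (one_le_pow₀ (by simp))
    calc _ ≤ _ := measure_mono h1
      _ ≤ treeMeasure ν {t | Q t} + ∑ i ∈ Finset.range N,
          treeMeasure ν ((fun t : List ℕ → Λ => subtree t i) ⁻¹' A) :=
          (measure_union_le _ _).trans (add_le_add le_rfl (measure_biUnion_finset_le _ _))
      _ ≤ (N + 1) ^ n * treeMeasure ν {t | Q t} + ∑ i ∈ Finset.range N,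
          (N + 1) ^ n * treeMeasure ν {t | Q t} :=
          add_le_add h3 (Finset.sum_le_sum fun i _ => (h2 i).trans ih)
      _ = _ := by
          simp only [Finset.sum_const, Finset.card_range, nsmul_eq_mul]
          ring

variable [Fintype Λ] [MeasurableSingletonClass Λ]

lemma sum_measureReal_singleton_eq_one (ν : Measure Λ) [IsProbabilityMeasure ν] :
    ∑ l, ν.real {l} = 1 := by
  rw [sum_measureReal_singleton]
  simp

lemma lintegral_prod_subtree_le (ν : Measure Λ) [IsProbabilityMeasure ν] (N : Λ → ℕ)
    {G : (l : Λ) → Fin (N l) → (List ℕ → Λ) → ℝ≥0∞} (hG : ∀ l i, Measurable (G l i))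
    {c : (l : Λ) → Fin (N l) → ℝ} (hc : ∀ l i, 0 ≤ c l i)
    (h : ∀ l i, ∫⁻ t, G l i t ∂treeMeasure ν ≤ ENNReal.ofReal (c l i)) :
    ∫⁻ t, ∏ i, G (t []) i (subtree t i) ∂treeMeasure ν ≤
      ENNReal.ofReal (∑ l, ν.real {l} * ∏ i, c l i) := by
  rw [lintegral_prod_subtree ν N hG, ENNReal.ofReal_sum_of_nonneg
    fun l _ => mul_nonneg measureReal_nonneg (Finset.prod_nonneg fun i _ => hc l i)]
  refine Finset.sum_le_sum fun l _ => ?_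
  rw [ENNReal.ofReal_mul measureReal_nonneg, ENNReal.ofReal_prod_of_nonneg fun i _ => hc l i,
    ofReal_measureReal]
  gcongr with i
  exact h l i

lemma measurable_cutSum {Y : (List ℕ → Λ) → ℝ} (hY : Measurable Y) (k : ℕ) (δ : ℝ) :
    Measurable (cutSum I Y k δ) := by
  induction k generalizing δ with
  | zero => exact hY
  | succ k ih =>
    by_cases hδ : 1 < δ
    · have : cutSum I Y (k + 1) δ = Y := by
        ext t
        simp [cutSum, hδ]
      rwa [this]
    · have h1 : ∀ l : Λ, Measurable fun t : List ℕ → Λ =>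
          ∑ i : Fin (I l).card, cutSum I Y k (δ / (I l).ratio i) (subtree t i) := fun l =>
        Finset.measurable_sum (M := ℝ) _ fun i _ => (ih _).comp (measurable_subtree _)
      have h2 : cutSum I Y (k + 1) δ = fun t =>
          ∑ i : Fin (I (t [])).card, cutSum I Y k (δ / (I (t [])).ratio i) (subtree t i) := by
        ext t
        simp [cutSum, hδ]
      rw [h2]
      exact measurable_of_root h1

/-- The exponential turns the sum over the children into a product, to which the branching property
applies. This is the common induction step for exponential moments and Laplace transforms. -/
lemma lintegral_exp_cutSum_succ_le (ν : Measure Λ) [IsProbabilityMeasure ν]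
    {Y : (List ℕ → Λ) → ℝ} (hY : Measurable Y) {k : ℕ} {δ τ : ℝ} (hδ : ¬ 1 < δ)
    {c : (l : Λ) → Fin (I l).card → ℝ} (hc : ∀ l i, 0 ≤ c l i)
    (h : ∀ l i, ∫⁻ t, ENNReal.ofReal (Real.exp (τ * cutSum I Y k (δ / (I l).ratio i) t))
      ∂treeMeasure ν ≤ ENNReal.ofReal (c l i)) :
    ∫⁻ t, ENNReal.ofReal (Real.exp (τ * cutSum I Y (k + 1) δ t)) ∂treeMeasure ν ≤
      ENNReal.ofReal (∑ l, ν.real {l} * ∏ i, c l i) := by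
  refine le_trans (le_of_eq ?_) (lintegral_prod_subtree_le ν (fun l => (I l).card) (G := fun l i t =>
    ENNReal.ofReal (Real.exp (τ * cutSum I Y k (δ / (I l).ratio i) t))) (fun l i => ?_) hc h)
  · refine lintegral_congr fun t => ?_
    rw [← ENNReal.ofReal_prod_of_nonneg fun i _ => (Real.exp_pos _).le, ← Real.exp_sum,
      ← Finset.mul_sum]
    simp [cutSum, hδ]
  · exact ((measurable_cutSum hY _ _).const_mul τ).exp.ennreal_ofReal

/-- Exponential moments of the normalised numbers of cylinders. -/
lemma exists_lintegral_exp_cutSum_le (h : RatioBounds I a b N) (ν : Measure Λ)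
    [IsProbabilityMeasure ν] {s : ℝ} (hs : 0 ≤ s)
    (hE : ∑ l, ν.real {l} * (I l).ratioSum s < 1) :
    ∃ θ₀ > 0, ∃ K : ℝ, ∀ (k : ℕ) (δ θ : ℝ), b ^ k < δ → a * δ ≤ 1 → 0 ≤ θ → θ ≤ θ₀ →
      ∫⁻ t, ENNReal.ofReal (Real.exp (θ * δ ^ s * cutSum I (fun _ => 1) k δ t)) ∂treeMeasure ν ≤
        ENNReal.ofReal (Real.exp (K * θ)) := by
  have ha := h.pos
  -- `K` bounds `δ ^ s` at the nodes where the recursion stops, since `a * δ ≤ 1` there.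
  set K : ℝ := (a⁻¹) ^ s with hK
  have hKpos : 0 < K := Real.rpow_pos_of_pos (inv_pos.2 ha) s
  set ρ := ∑ l, ν.real {l} * (I l).ratioSum s with hρ
  -- These are the conditions of `sum_mul_exp_le_exp` with `u = K * θ`: the gap `1 - ρ` absorbs the
  -- quadratic error.
  obtain ⟨θ₀, hθ₀, h1, h2⟩ : ∃ θ₀ > 0, K * θ₀ * N ≤ 1 ∧ K * θ₀ * N ^ 2 ≤ 1 - ρ := by
    have hN : (0 : ℝ) < N + 1 := by positivity
    refine ⟨min (1 / (K * (N + 1))) ((1 - ρ) / (K * (N + 1) ^ 2)), ?_, ?_, ?_⟩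
    · exact lt_min (by positivity) (div_pos (by linarith) (by positivity))
    · calc K * min (1 / (K * (N + 1))) ((1 - ρ) / (K * (N + 1) ^ 2)) * N
          ≤ K * (1 / (K * (N + 1))) * (N + 1) := by
            gcongr
            · exact min_le_left _ _
            · linarith
        _ = 1 := by field_simp
    · calc K * min (1 / (K * (N + 1))) ((1 - ρ) / (K * (N + 1) ^ 2)) * N ^ 2
          ≤ K * ((1 - ρ) / (K * (N + 1) ^ 2)) * (N + 1) ^ 2 := by
            have : 0 ≤ (1 - ρ) / (K * (N + 1) ^ 2) := div_nonneg (by linarith) (by positivity)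
            gcongr
            · exact min_le_right _ _
            · linarith
        _ = 1 - ρ := by field_simp
  refine ⟨θ₀, hθ₀, K, fun k => ?_⟩
  have hbase : ∀ δ θ : ℝ, 0 < δ → a * δ ≤ 1 → 0 ≤ θ →
      ∫⁻ _t : List ℕ → Λ, ENNReal.ofReal (Real.exp (θ * δ ^ s * 1)) ∂treeMeasure ν ≤
        ENNReal.ofReal (Real.exp (K * θ)) := by
    intro δ θ hδ0 hδ hθ
    rw [lintegral_const, measure_univ, mul_one, mul_one]
    refine ENNReal.ofReal_le_ofReal (Real.exp_le_exp.2 ?_)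
    rw [mul_comm]
    gcongr
    rw [hK]
    gcongr
    rw [← one_div, le_div_iff₀ ha]
    linarith
  induction k with
  | zero =>
    intro δ θ hδ haδ hθ _
    exact hbase δ θ (by rw [pow_zero] at hδ; linarith) haδ hθ
  | succ k ih =>
    intro δ θ hδ haδ hθ hθ'
    have hδ0 : 0 < δ := (pow_pos (ha.trans_le h.le) _).trans hδ
    by_cases hδ1 : 1 < δ
    · simp only [cutSum, hδ1, if_true]
      exact hbase δ θ hδ0 haδ hθ
    -- Child `i` gets the parameter `θ * ratio i ^ s`, which keeps `θ * δ ^ s` unchanged. The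
    -- product of the children's bounds is `exp (K * θ * ratioSum s)`, whose mean is at most `exp (K
    -- * θ)`.
    · refine (lintegral_exp_cutSum_succ_le ν measurable_const hδ1
        (c := fun l i => Real.exp (K * (θ * (I l).ratio i ^ s)))
        (fun l i => (Real.exp_pos _).le) fun l i => ?_).trans (ENNReal.ofReal_le_ofReal ?_)
      · have hr := (I l).ratio_pos i
        have h3 : a * (δ / (I l).ratio i) ≤ 1 := by
          rw [mul_div_assoc', div_le_one hr]
          nlinarith [h.le_ratio l i]
        have h4 : (I l).ratio i ^ s ≤ 1 :=
          Real.rpow_le_one hr.le ((I l).ratio_lt_one i).le hs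
        have h5 : 0 ≤ (I l).ratio i ^ s := Real.rpow_nonneg hr.le s
        have h6 := ih (δ / (I l).ratio i) (θ * (I l).ratio i ^ s) (h.pow_lt_div hδ l i) h3
          (mul_nonneg hθ h5) (by nlinarith)
        have h7 : θ * (I l).ratio i ^ s * (δ / (I l).ratio i) ^ s = θ * δ ^ s := by
          rw [Real.div_rpow hδ0.le hr.le]
          have := (Real.rpow_pos_of_pos hr s).ne'
          field_simp
        rwa [h7] at h6
      · have h8 : ∀ l, ∏ i, Real.exp (K * (θ * (I l).ratio i ^ s)) =
            Real.exp (K * θ * (I l).ratioSum s) := by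
          intro l
          rw [← Real.exp_sum, SelfSimilarIFS.ratioSum, Finset.mul_sum]
          simp only [mul_assoc]
        simp_rw [h8]
        have h9 : K * θ ≤ K * θ₀ := by gcongr
        refine sum_mul_exp_le_exp (fun l => measureReal_nonneg) (sum_measureReal_singleton_eq_one ν)
          (N := N) (fun l => (I l).ratioSum_nonneg s) (h.ratioSum_le hs) (by positivity) ?_ ?_
        · exact le_trans (by gcongr) h1
        · exact le_trans (by gcongr) h2

/-- Chernoff's bound: Markov's inequality for the exponential moment. -/
lemma measure_lt_cutSum_le {ν : Measure Λ} {k : ℕ} {δ s θ C : ℝ} (hδ : 0 < δ) (hθ : 0 ≤ θ)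
    (h : ∫⁻ t, ENNReal.ofReal (Real.exp (θ * δ ^ s * cutSum I (fun _ => 1) k δ t))
      ∂treeMeasure ν ≤ ENNReal.ofReal (Real.exp C)) (v : ℝ) :
    treeMeasure ν {t | v * δ ^ (-s) < cutSum I (fun _ => 1) k δ t} ≤
      ENNReal.ofReal (Real.exp (C - θ * v)) := by
  have h1 : {t | v * δ ^ (-s) < cutSum I (fun _ => 1) k δ t} ⊆
      {t | ENNReal.ofReal (Real.exp (θ * v)) ≤
        ENNReal.ofReal (Real.exp (θ * δ ^ s * cutSum I (fun _ => 1) k δ t))} := by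
    intro t ht
    refine ENNReal.ofReal_le_ofReal (Real.exp_le_exp.2 ?_)
    have h2 : δ ^ s * δ ^ (-s) = 1 := by rw [← Real.rpow_add hδ]; simp
    have h3 : θ * v = θ * δ ^ s * (v * δ ^ (-s)) := by
      calc θ * v = θ * v * (δ ^ s * δ ^ (-s)) := by rw [h2, mul_one]
        _ = _ := by ring
    rw [h3]
    have := Real.rpow_pos_of_pos hδ s
    exact mul_le_mul_of_nonneg_left (le_of_lt ht) (by positivity)
  refine (measure_mono h1).trans ?_
  have h4 := meas_ge_le_lintegral_div (μ := treeMeasure ν)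
    (f := fun t => ENNReal.ofReal (Real.exp (θ * δ ^ s * cutSum I (fun _ => 1) k δ t)))
    ((measurable_cutSum measurable_const _ _).const_mul _).exp.ennreal_ofReal.aemeasurable
    (ε := ENNReal.ofReal (Real.exp (θ * v)))
    (by simpa using Real.exp_pos (θ * v)) ENNReal.ofReal_ne_top
  refine h4.trans ((ENNReal.div_le_div_right h _).trans ?_)
  rw [← ENNReal.ofReal_div_of_pos (Real.exp_pos _), ← Real.exp_sub]

/-- Almost surely, for all large `m` the number of cylinders at relative scale `α ^ m` is under
control below all nodes of depth at most `2 ^ m`. -/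
lemma exists_ae_eventually_cutSum_le (h : RatioBounds I a b N) (ν : Measure Λ)
    [IsProbabilityMeasure ν] {s : ℝ} (hs : 0 ≤ s)
    (hE : ∑ l, ν.real {l} * (I l).ratioSum s < 1) {ε : ℝ} (hε : 0 < ε) :
    ∃ α : ℝ, 0 < α ∧ α < 1 ∧ α ^ (-ε) = 4 ∧ ∃ κ : ℕ → ℕ, (∀ m, b ^ κ m < α ^ m) ∧
      ∀ᵐ t ∂treeMeasure ν, ∀ᶠ m : ℕ in atTop, ∀ w : List ℕ, w.length ≤ 2 ^ m →
        (∀ x ∈ w, x < N) →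
        cutSum I (fun _ => 1) (κ m) (α ^ m) (subtreeAt t w) ≤ (α ^ m) ^ (-(s + ε)) := by
  obtain ⟨θ, hθ, K, hK⟩ := exists_lintegral_exp_cutSum_le h ν hs hE
  have hb0 : 0 < b := h.pos.trans_le h.le
  -- Then `(α ^ m) ^ (-ε) = 4 ^ m`. In the exponent the deviation term `θ * 4 ^ m` beats the entropy
  -- `2 ^ m * log (N + 1)` of the nodes of depth at most `2 ^ m`.
  set α : ℝ := 4 ^ (-ε⁻¹) with hα
  have hα0 : 0 < α := Real.rpow_pos_of_pos (by norm_num) _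
  have hα1 : α < 1 := Real.rpow_lt_one_of_one_lt_of_neg (by norm_num) (by simpa using hε)
  have hα4 : α ^ (-ε) = 4 := by
    rw [hα, ← Real.rpow_mul (by norm_num)]
    simp [hε.ne']
  have hκ : ∀ m : ℕ, ∃ k, b ^ k < α ^ m := fun m =>
    exists_pow_lt_of_lt_one (pow_pos hα0 m) h.lt_one
  choose κ hκ using hκ
  refine ⟨α, hα0, hα1, hα4, κ, hκ, ?_⟩
  set A : ℕ → Set (List ℕ → Λ) := fun m => {t | ∃ w : List ℕ, w.length ≤ 2 ^ m ∧
    (∀ x ∈ w, x < N) ∧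
      (4 : ℝ) ^ m * (α ^ m) ^ (-s) < cutSum I (fun _ => 1) (κ m) (α ^ m) (subtreeAt t w)} with hA
  set c := Real.log (N + 1) with hc
  -- The maximum of `(c + 1) * x - θ * x ^ 2`. The extra `1` leaves a factor `exp (-2 ^ m)`, which
  -- makes the bounds summable.
  set C₀ := (c + 1) ^ 2 / (4 * θ) with hC₀
  have hbound : ∀ m, treeMeasure ν (A m) ≤
      ENNReal.ofReal (Real.exp (K * θ + C₀) * (1 / 2) ^ m) := by
    intro m
    have h1 := measure_exists_subtreeAt_le ν N (fun t => (4 : ℝ) ^ m * (α ^ m) ^ (-s) <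
      cutSum I (fun _ => 1) (κ m) (α ^ m) t) (2 ^ m)
    have h2 := measure_lt_cutSum_le (pow_pos hα0 m) hθ.le (hK (κ m) (α ^ m) θ (hκ m) (by
      have := h.le.trans_lt h.lt_one
      have := pow_le_one₀ hα0.le hα1.le (n := m)
      have := pow_pos hα0 m
      nlinarith [h.pos]) hθ.le le_rfl) ((4 : ℝ) ^ m)
    refine h1.trans ((mul_le_mul le_rfl h2 zero_le zero_le).trans ?_)
    have h3 : ((N : ℝ≥0∞) + 1) ^ 2 ^ m = ENNReal.ofReal (Real.exp (c * 2 ^ m)) := by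
      rw [hc, ← Real.rpow_def_of_pos (by positivity)]
      have : ((N : ℝ≥0∞) + 1) = ENNReal.ofReal ((N : ℝ) + 1) := by
        rw [ENNReal.ofReal_add (by positivity) (by norm_num)]
        simp
      rw [this, ← ENNReal.ofReal_pow (by positivity)]
      congr 1
      rw [← Real.rpow_natCast]
      simp
    rw [h3, ← ENNReal.ofReal_mul (Real.exp_pos _).le, ← Real.exp_add]
    refine ENNReal.ofReal_le_ofReal ?_
    have h4 : (1 / 2 : ℝ) ^ m ≥ Real.exp (-(2 : ℝ) ^ m) := by
      rw [Real.exp_neg, one_div, inv_pow]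
      gcongr
      linarith [Real.add_one_le_exp ((2 : ℝ) ^ m)]
    calc Real.exp (c * 2 ^ m + (K * θ - θ * 4 ^ m))
        ≤ Real.exp (K * θ + C₀ + -(2 : ℝ) ^ m) := by
          refine Real.exp_le_exp.2 ?_
          have h5 : (4 : ℝ) ^ m = (2 ^ m) ^ 2 := by rw [← pow_mul, mul_comm, pow_mul]; norm_num
          rw [h5]
          set x := (2 : ℝ) ^ m
          have h6 : C₀ - ((c + 1) * x - θ * x ^ 2) = (2 * θ * x - (c + 1)) ^ 2 / (4 * θ) := by
            rw [hC₀]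
            field_simp
            ring
          have h7 : 0 ≤ (2 * θ * x - (c + 1)) ^ 2 / (4 * θ) := by positivity
          linarith
      _ = Real.exp (K * θ + C₀) * Real.exp (-(2 : ℝ) ^ m) := Real.exp_add _ _
      _ ≤ _ := by gcongr
  have hsum : ∑' m, treeMeasure ν (A m) ≠ ⊤ := by
    refine ne_top_of_le_ne_top ?_ (ENNReal.tsum_le_tsum hbound)
    rw [← ENNReal.ofReal_tsum_of_nonneg (fun m => by positivity)
      (Summable.mul_left _ (summable_geometric_of_lt_one (by norm_num) (by norm_num)))]
    exact ENNReal.ofReal_ne_top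
  filter_upwards [ae_eventually_notMem hsum] with t ht
  filter_upwards [ht] with m hm w hw hwN
  have h1 : ¬ _ := fun hlt => hm ⟨w, hw, hwN, hlt⟩
  refine (not_lt.1 h1).trans (le_of_eq ?_)
  have h2 : (4 : ℝ) ^ m = (α ^ m) ^ (-ε) := by
    rw [← hα4, ← Real.rpow_natCast, ← Real.rpow_natCast, ← Real.rpow_mul hα0.le,
      ← Real.rpow_mul hα0.le, mul_comm]
  rw [h2, ← Real.rpow_add (pow_pos hα0 m)]
  congr 1
  ring

end UpperTail

/-! ### Iteration of probability generating functions. -/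

section GeneratingFunction

variable {ι : Type*} [Fintype ι]

/-- The probability generating function of an offspring distribution that takes the value `n l`
with probability `p l`. -/
def genFun (p : ι → ℝ) (n : ι → ℕ) (x : ℝ) : ℝ := ∑ l, p l * x ^ n l

variable {p : ι → ℝ} {n : ι → ℕ}

lemma genFun_nonneg (hp : ∀ l, 0 ≤ p l) {x : ℝ} (hx : 0 ≤ x) : 0 ≤ genFun p n x :=
  Finset.sum_nonneg fun l _ => mul_nonneg (hp l) (pow_nonneg hx _)

lemma genFun_mono (hp : ∀ l, 0 ≤ p l) {x y : ℝ} (hx : 0 ≤ x) (hxy : x ≤ y) :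
    genFun p n x ≤ genFun p n y := by
  unfold genFun
  gcongr with l
  exact hp l

lemma genFun_one (hp1 : ∑ l, p l = 1) : genFun p n 1 = 1 := by simp [genFun, hp1]

lemma genFun_iterate_nonneg (hp : ∀ l, 0 ≤ p l) {x : ℝ} (hx : 0 ≤ x) (j : ℕ) :
    0 ≤ (genFun p n)^[j] x := by
  induction j with
  | zero => exact hx
  | succ j ih =>
    rw [Function.iterate_succ_apply']
    exact genFun_nonneg hp ih

lemma hasDerivAt_genFun (x : ℝ) :
    HasDerivAt (genFun p n) (∑ l, p l * (n l * x ^ (n l - 1))) x := by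
  unfold genFun
  exact HasDerivAt.fun_sum fun l _ => (hasDerivAt_pow (n l) x).const_mul (p l)

lemma convexOn_genFun (hp : ∀ l, 0 ≤ p l) : ConvexOn ℝ (Ici 0) (genFun p n) := by
  have h : ∀ s : Finset ι, ConvexOn ℝ (Ici (0 : ℝ)) fun x => ∑ l ∈ s, p l * x ^ n l := by
    classical
    intro s
    induction s using Finset.induction_on with
    | empty => simpa using convexOn_const (0 : ℝ) (convex_Ici (0 : ℝ))
    | insert l s hl ih =>
      simp only [Finset.sum_insert hl]
      exact ((convexOn_pow (n l)).smul (hp l)).add ih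
  exact h Finset.univ

/-- In the supercritical case the generating function has, at some point below the diagonal,
a slope less than one. -/
lemma exists_genFun_lt (hp : ∀ l, 0 ≤ p l) (hp1 : ∑ l, p l = 1) (hmean : 1 < ∑ l, p l * n l) :
    ∃ x, 0 < x ∧ x < 1 ∧ genFun p n x < x ∧ ∑ l, p l * (n l * x ^ (n l - 1)) < 1 := by
  -- `g` is concave on `[0, ∞)`, vanishes at `1` and has negative slope there, so it is positive
  -- just to the left of `1`.
  set g : ℝ → ℝ := fun x => x - genFun p n x with hg
  have hder : ∀ x, HasDerivAt g (1 - ∑ l, p l * (n l * x ^ (n l - 1))) x := fun x =>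
    (hasDerivAt_id x).sub (hasDerivAt_genFun x)
  have hcont : Continuous g := continuous_iff_continuousAt.2 fun x => (hder x).continuousAt
  have hg1 : g 1 = 0 := by simp [hg, genFun_one hp1]
  have hg0 : g 0 ≤ 0 := by
    have := genFun_nonneg (n := n) hp (le_refl (0 : ℝ))
    simp only [hg]
    linarith
  have h1 : ∃ x₀, 0 < x₀ ∧ x₀ < 1 ∧ 0 < g x₀ := by
    have h2 := hder 1
    have h3 : 1 - ∑ l, p l * (n l * (1 : ℝ) ^ (n l - 1)) < 0 := by
      simp only [one_pow, mul_one]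
      linarith
    have h4 := (hasDerivAt_iff_tendsto_slope_left_right.1 h2).1
    have h5 : ∀ᶠ x in 𝓝[<] (1 : ℝ), slope g 1 x < 0 := h4.eventually (gt_mem_nhds h3)
    have h6 : ∀ᶠ x in 𝓝[<] (1 : ℝ), x ∈ Ioo (0 : ℝ) 1 := Ioo_mem_nhdsLT zero_lt_one
    obtain ⟨x, hx1, hx2⟩ := (h5.and h6).exists
    refine ⟨x, hx2.1, hx2.2, ?_⟩
    rw [slope_def_field, hg1, sub_zero, div_neg_iff] at hx1
    rcases hx1 with h | h
    · exact h.1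
    · linarith [hx2.2]
  obtain ⟨x₀, hx₀, hx₀1, hgx₀⟩ := h1
  -- Half the height makes `g` positive at both endpoints and strictly higher at `x₀`. The mean
  -- value theorem then gives a point of positive slope, where `g` is positive by concavity.
  obtain ⟨z, hz, hgz⟩ : ∃ z ∈ Icc 0 x₀, g z = g x₀ / 2 :=
    intermediate_value_Icc hx₀.le hcont.continuousOn ⟨by linarith, by linarith⟩
  have hzx : z < x₀ := lt_of_le_of_ne hz.2 fun h => by rw [h] at hgz; linarith
  obtain ⟨ξ, hξ, hgξ⟩ := exists_hasDerivAt_eq_slope g _ hzx hcont.continuousOn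
    fun x _ => hder x
  have hξ0 : 0 < ξ := hz.1.trans_lt hξ.1
  refine ⟨ξ, hξ0, hξ.2.trans hx₀1, ?_, ?_⟩
  · have hconc : ConcaveOn ℝ (Ici 0) g :=
      (concaveOn_id (convex_Ici 0)).sub (convexOn_genFun hp)
    have := hconc.min_le_of_mem_Icc (mem_Ici.2 hz.1) (mem_Ici.2 hx₀.le) ⟨hξ.1.le, hξ.2.le⟩
    have h2 : 0 < min (g z) (g x₀) := lt_min (by linarith) hgx₀
    have h3 : 0 < g ξ := h2.trans_le this
    simp only [hg] at h3
    linarith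
  · have : 0 < (g x₀ - g z) / (x₀ - z) := div_pos (by linarith) (by linarith)
    linarith

/-- By convexity the graph lies below the chord from `x₂` to `1`, whose slope is `1 + κ`. Thus `1`
repels: each iteration expands the distance to `1`. -/
lemma exists_mul_one_sub_le (hp : ∀ l, 0 ≤ p l) (hp1 : ∑ l, p l = 1) {x₂ : ℝ} (hx₂ : 0 < x₂)
    (hx₂1 : x₂ < 1) (hlt : genFun p n x₂ < x₂) :
    ∃ κ > 0, ∀ x, x₂ ≤ x → x ≤ 1 → (1 + κ) * (1 - x) ≤ 1 - genFun p n x := by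
  have h1 : 0 < 1 - x₂ := by linarith
  refine ⟨(x₂ - genFun p n x₂) / (1 - x₂), div_pos (by linarith) h1, fun x hx hx1 => ?_⟩
  have h2 := (convexOn_genFun (n := n) hp).2 (mem_Ici.2 hx₂.le)
    (mem_Ici.2 (zero_le_one (α := ℝ)))
    (show 0 ≤ (1 - x) / (1 - x₂) from div_nonneg (by linarith) h1.le)
    (show 0 ≤ (x - x₂) / (1 - x₂) from div_nonneg (by linarith) h1.le) (by field_simp; ring)
  simp only [smul_eq_mul, mul_one, genFun_one hp1] at h2
  have h3 : (1 - x) / (1 - x₂) * x₂ + (x - x₂) / (1 - x₂) = x := by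
    field_simp
    ring
  rw [h3] at h2
  have h4 : (1 + (x₂ - genFun p n x₂) / (1 - x₂)) * (1 - x) =
      1 - ((1 - x) / (1 - x₂) * genFun p n x₂ + (x - x₂) / (1 - x₂)) := by
    field_simp
    ring
  linarith

/-- An orbit staying above `x₂` for `j` steps would be at distance more than `1` from `1`, hence
negative. About `log (1 / (1 - y))` steps thus suffice to leave the neighbourhood of `1`. -/
lemma genFun_iterate_le_of_lt (hp : ∀ l, 0 ≤ p l) {x₂ κ : ℝ}
    (hlt : genFun p n x₂ ≤ x₂) (hκ : 0 < κ)
    (h : ∀ x, x₂ ≤ x → x ≤ 1 → (1 + κ) * (1 - x) ≤ 1 - genFun p n x) {y : ℝ} (hy0 : 0 ≤ y)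
    (hy1 : y ≤ 1) {j : ℕ} (hj : 1 < (1 + κ) ^ j * (1 - y)) : (genFun p n)^[j] y ≤ x₂ := by
  have key : ∀ i : ℕ, (genFun p n)^[i] y ≤ x₂ ∨
      (1 + κ) ^ i * (1 - y) ≤ 1 - (genFun p n)^[i] y := by
    intro i
    induction i with
    | zero => right; simp
    | succ i ih =>
      rw [Function.iterate_succ_apply']
      have h0 := genFun_iterate_nonneg (n := n) hp hy0 i
      rcases le_total ((genFun p n)^[i] y) x₂ with h1 | h1
      · exact Or.inl ((genFun_mono hp h0 h1).trans hlt)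
      · rcases ih with h2 | h2
        · exact Or.inl ((genFun_mono hp h0 h2).trans hlt)
        · right
          have h3 : 0 ≤ (1 + κ) ^ i * (1 - y) := mul_nonneg (by positivity) (by linarith)
          have h4 := h _ h1 (by linarith)
          calc (1 + κ) ^ (i + 1) * (1 - y) = (1 + κ) * ((1 + κ) ^ i * (1 - y)) := by ring
            _ ≤ (1 + κ) * (1 - (genFun p n)^[i] y) := by gcongr
            _ ≤ _ := h4
  rcases key j with h1 | h1
  · exact h1
  · have := genFun_iterate_nonneg (n := n) hp hy0 j
    linarith

/-- Up to `x₂` the derivative is at most its value at `x₂`, so the excess over the fixed point `q`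
shrinks by that factor; it is at most `1` initially. -/
lemma genFun_iterate_le_add_pow (hp : ∀ l, 0 ≤ p l) {x₂ q : ℝ} (hx₂ : 0 ≤ x₂) (hx₂1 : x₂ ≤ 1)
    (hlt : genFun p n x₂ ≤ x₂) (hq0 : 0 ≤ q) (hq : q ≤ x₂) (hqfix : genFun p n q = q)
    {y : ℝ} (hy0 : 0 ≤ y) (hy : y ≤ x₂) (j : ℕ) :
    (genFun p n)^[j] y ≤ q + (∑ l, p l * (n l * x₂ ^ (n l - 1))) ^ j := by
  set γ := ∑ l, p l * (n l * x₂ ^ (n l - 1)) with hγ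
  have hγ0 : 0 ≤ γ := Finset.sum_nonneg fun l _ => mul_nonneg (hp l) (by positivity)
  have key : (genFun p n)^[j] y ≤ x₂ ∧ (genFun p n)^[j] y ≤ q + γ ^ j := by
    induction j with
    | zero => exact ⟨hy, by simp; linarith⟩
    | succ j ih =>
      rw [Function.iterate_succ_apply']
      have h0 := genFun_iterate_nonneg (n := n) hp hy0 j
      refine ⟨(genFun_mono hp h0 ih.1).trans hlt, ?_⟩
      -- The bound is truncated at `x₂` because the derivative is controlled only up to there.
      set m := min x₂ (q + γ ^ j) with hm
      have hmq : q ≤ m := le_min hq (by linarith [pow_nonneg hγ0 j])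
      have hm0 : 0 ≤ m := hq0.trans hmq
      refine (genFun_mono hp h0 (le_min ih.1 ih.2)).trans ?_
      have h1 : ∀ l, m ^ n l ≤ q ^ n l + n l * x₂ ^ (n l - 1) * γ ^ j := by
        intro l
        have h2 := (le_abs_self _).trans (abs_pow_sub_pow_le m q (n l))
        rw [abs_of_nonneg (by linarith : 0 ≤ m - q), abs_of_nonneg hm0, abs_of_nonneg hq0,
          max_eq_left hmq] at h2
        have h3 : (m - q) * n l * m ^ (n l - 1) ≤ γ ^ j * n l * x₂ ^ (n l - 1) := by
          have : m - q ≤ γ ^ j := by linarith [min_le_right x₂ (q + γ ^ j)]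
          have := min_le_left x₂ (q + γ ^ j)
          gcongr
        linarith [mul_comm (γ ^ j * n l) (x₂ ^ (n l - 1)),
          (by ring : γ ^ j * n l * x₂ ^ (n l - 1) = n l * x₂ ^ (n l - 1) * γ ^ j)]
      calc genFun p n m ≤ ∑ l, p l * (q ^ n l + n l * x₂ ^ (n l - 1) * γ ^ j) :=
            Finset.sum_le_sum fun l _ => mul_le_mul_of_nonneg_left (h1 l) (hp l)
        _ = genFun p n q + γ * γ ^ j := by
            rw [genFun, hγ, Finset.sum_mul, ← Finset.sum_add_distrib]
            exact Finset.sum_congr rfl fun l _ => by ring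
        _ = q + γ ^ (j + 1) := by rw [hqfix, pow_succ']
  exact key.2

/-- A generating function of mean at most one that charges some value at least two has no fixed
point in `[0, 1)`. -/
lemma one_lt_mean_of_genFun_eq (hp : ∀ l, 0 ≤ p l) (hp1 : ∑ l, p l = 1) {q : ℝ} (hq0 : 0 ≤ q)
    (hq1 : q < 1) (hq : genFun p n q = q) {l₀ : ι} (hl₀ : 0 < p l₀) (hn : 2 ≤ n l₀) :
    1 < ∑ l, p l * n l := by
  -- Bernoulli's inequality, strict for exponents at least two. Averaging gives `1 + mean * (q - 1)
  -- < q`, which forces the mean above one.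
  have h1 : ∀ l, 1 + n l * (q - 1) ≤ q ^ n l := by
    intro l
    have := one_add_mul_le_pow (a := q - 1) (by linarith) (n l)
    simpa using this
  have h2 : 1 + n l₀ * (q - 1) < q ^ n l₀ := by
    obtain ⟨k, hk⟩ := Nat.exists_eq_add_of_le hn
    have h3 : 1 + (1 + k : ℝ) * (q - 1) ≤ q ^ (1 + k) := by
      have := one_add_mul_le_pow (a := q - 1) (by linarith) (1 + k)
      simpa using this
    rw [hk]
    have h4 : q ^ (2 + k) = q * q ^ (1 + k) := by rw [← pow_succ']; congr 1; omega
    rw [h4]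
    push_cast
    nlinarith [mul_le_mul_of_nonneg_left h3 hq0, sq_nonneg (1 - q),
      mul_pos (sub_pos.2 hq1) (sub_pos.2 hq1), Nat.cast_nonneg (α := ℝ) k,
      mul_nonneg (Nat.cast_nonneg (α := ℝ) k) (sq_nonneg (1 - q))]
  have h5 : ∑ l, p l * (1 + n l * (q - 1)) < genFun p n q :=
    Finset.sum_lt_sum (fun l _ => mul_le_mul_of_nonneg_left (h1 l) (hp l))
      ⟨l₀, Finset.mem_univ _, mul_lt_mul_of_pos_left h2 hl₀⟩
  have h6 : ∑ l, p l * (1 + n l * (q - 1)) = ∑ l, p l + (∑ l, p l * n l) * (q - 1) := by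
    rw [Finset.sum_mul, ← Finset.sum_add_distrib]
    exact Finset.sum_congr rfl fun l _ => by ring
  rw [h6, hq, hp1] at h5
  by_contra hle
  nlinarith

end GeneratingFunction

/-! ### Survival and the extinction probability. -/

section Survival

variable {d : ℕ} {Λ : Type*} {I : Λ → SelfSimilarIFS d}
  {Δ : Set (EuclideanSpace ℝ (Fin d))} {a b : ℝ} {N : ℕ}

lemma cutSum_survivalIndicator_eq_zero (hΔ : ∀ l i, (I l).map i '' Δ ⊆ Δ) (k : ℕ) (δ : ℝ)
    {t : List ℕ → Λ} (ht : ¬ (limitSet I Δ t).Nonempty) :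
    cutSum I (survivalIndicator I Δ) k δ t = 0 := by
  rw [cutSum_eq_sum]
  refine Finset.sum_eq_zero fun w hw => ?_
  rw [survivalIndicator, if_neg]
  rintro ⟨z, hz⟩
  refine ht ⟨wordMap I w t z, ?_⟩
  rw [limitSet_eq_biUnion_cutWords hΔ k δ]
  exact mem_biUnion hw ⟨z, hz, rfl⟩

lemma survivalIndicator_nonneg (t : List ℕ → Λ) : 0 ≤ survivalIndicator I Δ t := by
  unfold survivalIndicator
  split_ifs <;> norm_num

lemma cutSum_survivalIndicator_nonneg (k : ℕ) (δ : ℝ) (t : List ℕ → Λ) :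
    0 ≤ cutSum I (survivalIndicator I Δ) k δ t := by
  rw [cutSum_eq_sum]
  exact Finset.sum_nonneg fun w _ => survivalIndicator_nonneg _

variable [MeasurableSpace Λ] [Fintype Λ] [MeasurableSingletonClass Λ]

lemma measurableSet_forall_subtree {A : Set (List ℕ → Λ)} (hA : MeasurableSet A) :
    MeasurableSet {t : List ℕ → Λ | ∀ i : Fin (I (t [])).card, subtree t i ∈ A} := by
  have h1 : ∀ l : Λ, Measurable fun t : List ℕ → Λ =>
      ∀ i : Fin (I l).card, subtree t i ∈ A := by
    intro l
    refine measurableSet_setOfPred.1 ?_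
    rw [ofPred_forall]
    exact MeasurableSet.iInter fun i => measurable_subtree _ hA
  exact measurableSet_setOfPred.2 (measurable_of_root h1)

/-- Generating functions enter through this identity: it is applied to extinction, to empty level
sets and to `avoidTrees`. -/
lemma measureReal_forall_subtree (I : Λ → SelfSimilarIFS d) (ν : Measure Λ)
    [IsProbabilityMeasure ν] {A : Set (List ℕ → Λ)} (hA : MeasurableSet A) :
    (treeMeasure ν).real {t : List ℕ → Λ | ∀ i : Fin (I (t [])).card, subtree t i ∈ A} =
      genFun (fun l => ν.real {l}) (fun l => (I l).card) ((treeMeasure ν).real A) := by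
  classical
  have h1 := lintegral_prod_subtree ν (fun l => (I l).card)
    (G := fun _ _ => A.indicator 1) (fun l i => measurable_one.indicator hA)
  have h2 : ∀ t : List ℕ → Λ, ∏ i : Fin (I (t [])).card,
      A.indicator (1 : (List ℕ → Λ) → ℝ≥0∞) (subtree t i) =
      {t : List ℕ → Λ | ∀ i : Fin (I (t [])).card, subtree t i ∈ A}.indicator 1 t := by
    intro t
    by_cases ht : ∀ i : Fin (I (t [])).card, subtree t i ∈ A
    · rw [indicator_of_mem (show t ∈ {t : List ℕ → Λ |
        ∀ i : Fin (I (t [])).card, subtree t i ∈ A} from ht)]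
      exact Finset.prod_eq_one fun i _ => by simp [ht i]
    · rw [indicator_of_notMem (show t ∉ {t : List ℕ → Λ |
        ∀ i : Fin (I (t [])).card, subtree t i ∈ A} from ht)]
      push Not at ht
      obtain ⟨i, hi⟩ := ht
      exact Finset.prod_eq_zero (Finset.mem_univ i) (by simp [hi])
  simp_rw [h2] at h1
  rw [lintegral_indicator_one (measurableSet_forall_subtree hA)] at h1
  simp only [lintegral_indicator_one hA, Finset.prod_const, Finset.card_univ,
    Fintype.card_fin] at h1
  rw [measureReal_def, h1, ENNReal.toReal_sum]
  · simp [genFun, measureReal_def]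
  · intro l _
    exact ENNReal.mul_ne_top (measure_ne_top _ _) (ENNReal.pow_ne_top (measure_ne_top _ _))

lemma measurableSet_levelSet_eq_empty (k : ℕ) :
    MeasurableSet {t : List ℕ → Λ | levelSet Δ k (fun w => I (t w)) = ∅} := by
  induction k with
  | zero => exact MeasurableSet.const (Δ = ∅)
  | succ k ih =>
    refine (measurableSet_forall_subtree (I := I) ih).congr ?_
    ext t
    simp [levelSet, subtree]

lemma measurableSet_limitSet_nonempty (hΔc : IsCompact Δ) (hΔ : ∀ l i, (I l).map i '' Δ ⊆ Δ) :
    MeasurableSet {t : List ℕ → Λ | (limitSet I Δ t).Nonempty} := by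
  have : {t : List ℕ → Λ | (limitSet I Δ t).Nonempty} =
      ⋂ k, {t : List ℕ → Λ | levelSet Δ k (fun w => I (t w)) = ∅}ᶜ := by
    ext t
    simp only [mem_ofPred_eq, mem_iInter, mem_compl_iff, limitSet_nonempty_iff hΔc hΔ,
      nonempty_iff_ne_empty, ne_eq]
  rw [this]
  exact MeasurableSet.iInter fun k => (measurableSet_levelSet_eq_empty k).compl

lemma measurable_survivalIndicator (hΔc : IsCompact Δ) (hΔ : ∀ l i, (I l).map i '' Δ ⊆ Δ) :
    Measurable (survivalIndicator I Δ) :=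
  Measurable.ite (measurableSet_limitSet_nonempty hΔc hΔ) measurable_const measurable_const

/-- The extinction probability. -/
noncomputable def extinctionProb (I : Λ → SelfSimilarIFS d)
    (Δ : Set (EuclideanSpace ℝ (Fin d))) (ν : Measure Λ) : ℝ :=
  (treeMeasure ν).real {t | ¬ (limitSet I Δ t).Nonempty}

lemma genFun_extinctionProb (hΔc : IsCompact Δ) (hΔ : ∀ l i, (I l).map i '' Δ ⊆ Δ)
    (ν : Measure Λ) [IsProbabilityMeasure ν] :
    genFun (fun l => ν.real {l}) (fun l => (I l).card) (extinctionProb I Δ ν) =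
      extinctionProb I Δ ν := by
  unfold extinctionProb
  refine (measureReal_forall_subtree I ν
    (measurableSet_limitSet_nonempty hΔc hΔ).compl).symm.trans ?_
  congr 1
  ext t
  simp [limitSet_nonempty_iff_exists hΔ t]

/-- By compactness, extinction is the increasing union of the events that level `k` is empty. Their
probabilities are the iterates from `0`, which monotonicity keeps below `x`. -/
lemma extinctionProb_le (hΔc : IsCompact Δ) (hΔn : Δ.Nonempty)
    (hΔ : ∀ l i, (I l).map i '' Δ ⊆ Δ) (ν : Measure Λ) [IsProbabilityMeasure ν] {x : ℝ}
    (hx : 0 ≤ x) (hfx : genFun (fun l => ν.real {l}) (fun l => (I l).card) x ≤ x) :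
    extinctionProb I Δ ν ≤ x := by
  set A : ℕ → Set (List ℕ → Λ) := fun k => {t | levelSet Δ k (fun w => I (t w)) = ∅} with hA
  have h1 : ∀ k, (treeMeasure ν).real (A k) ≤ x := by
    intro k
    induction k with
    | zero => simpa [hA, levelSet, hΔn.ne_empty] using hx
    | succ k ih =>
      have h2 : A (k + 1) = {t : List ℕ → Λ | ∀ i : Fin (I (t [])).card, subtree t i ∈ A k} := by
        ext t
        simp [hA, levelSet, subtree]
      rw [h2, measureReal_forall_subtree I ν (measurableSet_levelSet_eq_empty k)]
      exact (genFun_mono (fun l => measureReal_nonneg) measureReal_nonneg ih).trans hfx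
  have h3 : {t : List ℕ → Λ | ¬ (limitSet I Δ t).Nonempty} = ⋃ k, A k := by
    ext t
    simp [hA, limitSet_nonempty_iff hΔc hΔ, not_nonempty_iff_eq_empty]
  have h4 : Monotone A := by
    intro j k hjk t ht
    exact subset_empty_iff.1 ((levelSet_antitone hΔ t hjk).trans_eq ht)
  have h5 := tendsto_measure_iUnion_atTop (μ := treeMeasure ν) h4
  have h6 := (ENNReal.tendsto_toReal (measure_ne_top _ _)).comp h5
  rw [extinctionProb, h3]
  exact le_of_tendsto' h6 h1

end Survival

/-! ### Lower tails of surviving cylinder counts via Laplace transforms. -/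

section LowerTail

variable {d : ℕ} {Λ : Type*} {I : Λ → SelfSimilarIFS d}
  {Δ : Set (EuclideanSpace ℝ (Fin d))} {a b : ℝ} {N : ℕ}

/-- An elementary estimate for the Laplace transform of a variable with mean above one. -/
lemma sum_mul_exp_neg_le {ι : Type*} [Fintype ι] {p S : ι → ℝ} (hp : ∀ l, 0 ≤ p l)
    (hp1 : ∑ l, p l = 1) {N u : ℝ} (hS0 : ∀ l, 0 ≤ S l) (hSN : ∀ l, S l ≤ N) (hu : 0 ≤ u)
    (huN : u * N ≤ 1) (huN2 : u * N ^ 2 ≤ ∑ l, p l * S l - 1) :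
    ∑ l, p l * Real.exp (-(u * S l)) ≤ 1 - u := by
  have h1 : ∀ l, Real.exp (-(u * S l)) ≤ 1 - u * S l + u ^ 2 * N ^ 2 := by
    intro l
    have h2 : 0 ≤ u * S l := mul_nonneg hu (hS0 l)
    have h3 : u * S l ≤ u * N := by gcongr; exact hSN l
    have h4 := abs_le.1 (Real.abs_exp_sub_one_sub_id_le (x := -(u * S l))
      (by rw [abs_neg, abs_of_nonneg h2]; linarith))
    have h5 : (u * S l) ^ 2 ≤ (u * N) ^ 2 := by gcongr
    have h6 : (u * N) ^ 2 = u ^ 2 * N ^ 2 := by ring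
    have h7 : (-(u * S l)) ^ 2 = (u * S l) ^ 2 := by ring
    linarith [h4.2]
  calc ∑ l, p l * Real.exp (-(u * S l)) ≤ ∑ l, p l * (1 - u * S l + u ^ 2 * N ^ 2) :=
        Finset.sum_le_sum fun l _ => mul_le_mul_of_nonneg_left (h1 l) (hp l)
    _ = (∑ l, p l) * (1 + u ^ 2 * N ^ 2) - u * ∑ l, p l * S l := by
        rw [Finset.sum_mul, Finset.mul_sum, ← Finset.sum_sub_distrib]
        exact Finset.sum_congr rfl fun l _ => by ring
    _ ≤ 1 - u := by
        rw [hp1]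
        nlinarith

variable [MeasurableSpace Λ] [Fintype Λ] [MeasurableSingletonClass Λ]

/-- The integral equals `q + (1 - q) * exp (-τ)` with `q` the extinction probability, and `exp (-θ)
≤ 1 - θ / 2` on `[0, 1]`. -/
lemma lintegral_exp_survivalIndicator_le (hΔc : IsCompact Δ)
    (hΔ : ∀ l i, (I l).map i '' Δ ⊆ Δ) (ν : Measure Λ) [IsProbabilityMeasure ν] {τ θ : ℝ}
    (hθ : 0 ≤ θ) (hθ1 : θ ≤ 1) (hτ : θ ≤ τ) :
    ∫⁻ t, ENNReal.ofReal (Real.exp (-τ * survivalIndicator I Δ t)) ∂treeMeasure ν ≤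
      ENNReal.ofReal (1 - (1 - extinctionProb I Δ ν) / 2 * θ) := by
  set A := {t : List ℕ → Λ | (limitSet I Δ t).Nonempty} with hA
  have hAm : MeasurableSet A := measurableSet_limitSet_nonempty hΔc hΔ
  have h1 : ∀ t, ENNReal.ofReal (Real.exp (-τ * survivalIndicator I Δ t)) =
      Aᶜ.indicator 1 t + ENNReal.ofReal (Real.exp (-τ)) * A.indicator 1 t := by
    intro t
    by_cases ht : (limitSet I Δ t).Nonempty
    · rw [indicator_of_mem (show t ∈ A from ht), indicator_of_notMem (notMem_compl_iff.2 (show t ∈ A from ht))]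
      simp [survivalIndicator, ht]
    · rw [indicator_of_notMem (show t ∉ A from ht), indicator_of_mem (mem_compl (s := A) ht)]
      simp [survivalIndicator, ht]
  simp_rw [h1]
  rw [lintegral_add_left (measurable_one.indicator hAm.compl),
    lintegral_const_mul _ (measurable_one.indicator hAm), lintegral_indicator_one hAm,
    lintegral_indicator_one hAm.compl, ← ofReal_measureReal (μ := treeMeasure ν) (s := A),
    ← ofReal_measureReal (μ := treeMeasure ν) (s := Aᶜ),
    ← ENNReal.ofReal_mul (Real.exp_pos _).le,
    ← ENNReal.ofReal_add measureReal_nonneg (by positivity)]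
  have h2 : (treeMeasure ν).real Aᶜ = extinctionProb I Δ ν := rfl
  have h3 : (treeMeasure ν).real A = 1 - extinctionProb I Δ ν := by
    rw [← h2, probReal_compl_eq_one_sub hAm]
    ring
  rw [h2, h3]
  refine ENNReal.ofReal_le_ofReal ?_
  have h4 : Real.exp (-τ) ≤ 1 - θ / 2 := by
    refine (Real.exp_le_exp.2 (neg_le_neg hτ)).trans ?_
    rw [Real.exp_neg, inv_le_comm₀ (Real.exp_pos _) (by linarith)]
    refine le_trans ?_ (Real.add_one_le_exp θ)
    rw [inv_le_iff_one_le_mul₀ (by linarith)]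
    nlinarith
  have h5 : 0 ≤ 1 - extinctionProb I Δ ν := by
    rw [← h3]
    exact measureReal_nonneg
  nlinarith

/-- A uniform bound for the Laplace transforms of the normalised numbers of surviving
cylinders. -/
lemma exists_lintegral_exp_neg_cutSum_le (h : RatioBounds I a b N) (hΔc : IsCompact Δ)
    (hΔ : ∀ l i, (I l).map i '' Δ ⊆ Δ) (ν : Measure Λ)
    [IsProbabilityMeasure ν] (hq : extinctionProb I Δ ν < 1) {s : ℝ} (hs : 0 ≤ s)
    (hE : 1 < ∑ l, ν.real {l} * (I l).ratioSum s) :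
    ∃ θ₀ > 0, ∃ y : ℝ, 0 ≤ y ∧ y < 1 ∧ ∀ (k : ℕ) (δ θ : ℝ), b ^ k < δ → θ₀ ≤ θ →
      ∫⁻ t, ENNReal.ofReal (Real.exp (-(θ * δ ^ s) * cutSum I (survivalIndicator I Δ) k δ t))
        ∂treeMeasure ν ≤ ENNReal.ofReal y := by
  have ha := h.pos
  set q := extinctionProb I Δ ν with hqdef
  have hq0 : 0 ≤ q := measureReal_nonneg
  set K : ℝ := (1 - q) / 2 with hK
  have hKpos : 0 < K := by rw [hK]; linarith
  have hK1 : K ≤ 1 / 2 := by rw [hK]; linarith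
  set ρ := ∑ l, ν.real {l} * (I l).ratioSum s with hρ
  obtain ⟨θ₀, hθ₀, hθ₀1, h1, h2⟩ : ∃ θ₀ > 0, θ₀ ≤ 1 ∧ K * θ₀ * N ≤ 1 ∧
      K * θ₀ * N ^ 2 ≤ ρ - 1 := by
    have hN : (0 : ℝ) < N + 1 := by positivity
    refine ⟨min (1 / (N + 1)) ((ρ - 1) / (N + 1) ^ 2), ?_, ?_, ?_, ?_⟩
    · exact lt_min (by positivity) (div_pos (by linarith) (by positivity))
    · refine (min_le_left _ _).trans ?_
      rw [div_le_one hN]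
      linarith [Nat.cast_nonneg (α := ℝ) N]
    · calc K * min (1 / ((N : ℝ) + 1)) ((ρ - 1) / (N + 1) ^ 2) * N
          ≤ 1 * (1 / ((N : ℝ) + 1)) * (N + 1) := by
            have : 0 ≤ min (1 / ((N : ℝ) + 1)) ((ρ - 1) / (N + 1) ^ 2) :=
              le_min (by positivity) (div_nonneg (by linarith) (by positivity))
            gcongr
            · linarith
            · exact min_le_left _ _
            · linarith
        _ = 1 := by field_simp
    · calc K * min (1 / ((N : ℝ) + 1)) ((ρ - 1) / (N + 1) ^ 2) * N ^ 2
          ≤ 1 * ((ρ - 1) / (N + 1) ^ 2) * (N + 1) ^ 2 := by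
            have : 0 ≤ (ρ - 1) / ((N : ℝ) + 1) ^ 2 := div_nonneg (by linarith) (by positivity)
            have : 0 ≤ min (1 / ((N : ℝ) + 1)) ((ρ - 1) / (N + 1) ^ 2) :=
              le_min (by positivity) (div_nonneg (by linarith) (by positivity))
            gcongr
            · linarith
            · exact min_le_right _ _
            · linarith
        _ = ρ - 1 := by field_simp
  -- Again child `i` gets `θ * ratio i ^ s`. By `1 - x ≤ exp (-x)` the product becomes `exp (-(K * θ
  -- * ratioSum s))`, and the mean above one pays for the quadratic error.
  have key : ∀ (k : ℕ) (δ θ : ℝ), b ^ k < δ → 0 ≤ θ → θ ≤ θ₀ →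
      ∫⁻ t, ENNReal.ofReal (Real.exp (-(θ * δ ^ s) * cutSum I (survivalIndicator I Δ) k δ t))
        ∂treeMeasure ν ≤ ENNReal.ofReal (1 - K * θ) := by
    intro k
    have hbase : ∀ δ θ : ℝ, 1 < δ → 0 ≤ θ → θ ≤ θ₀ →
        ∫⁻ t, ENNReal.ofReal (Real.exp (-(θ * δ ^ s) * survivalIndicator I Δ t))
          ∂treeMeasure ν ≤ ENNReal.ofReal (1 - K * θ) := by
      intro δ θ hδ hθ hθ'
      refine lintegral_exp_survivalIndicator_le hΔc hΔ ν hθ (hθ'.trans hθ₀1) ?_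
      exact le_mul_of_one_le_right hθ (Real.one_le_rpow hδ.le hs)
    induction k with
    | zero =>
      intro δ θ hδ hθ hθ'
      exact hbase δ θ (by simpa using hδ) hθ hθ'
    | succ k ih =>
      intro δ θ hδ hθ hθ'
      have hδ0 : 0 < δ := (pow_pos (ha.trans_le h.le) _).trans hδ
      by_cases hδ1 : 1 < δ
      · simp only [cutSum, hδ1, if_true]
        exact hbase δ θ hδ1 hθ hθ'
      · have hr1 : ∀ l i, (I l).ratio i ^ s ≤ 1 := fun l i =>
          Real.rpow_le_one ((I l).ratio_pos i).le ((I l).ratio_lt_one i).le hs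
        have hr0 : ∀ l i, 0 ≤ (I l).ratio i ^ s := fun l i =>
          Real.rpow_nonneg ((I l).ratio_pos i).le s
        have hc0 : ∀ l i, 0 ≤ 1 - K * (θ * (I l).ratio i ^ s) := by
          intro l i
          have h3 : θ * (I l).ratio i ^ s ≤ 1 :=
            mul_le_one₀ (hθ'.trans hθ₀1) (hr0 l i) (hr1 l i)
          have h4 : 0 ≤ θ * (I l).ratio i ^ s := mul_nonneg hθ (hr0 l i)
          nlinarith
        refine (lintegral_exp_cutSum_succ_le ν (measurable_survivalIndicator hΔc hΔ) hδ1
          (c := fun l i => 1 - K * (θ * (I l).ratio i ^ s)) hc0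
          fun l i => ?_).trans (ENNReal.ofReal_le_ofReal ?_)
        · have hr := (I l).ratio_pos i
          have h6 := ih (δ / (I l).ratio i) (θ * (I l).ratio i ^ s) (h.pow_lt_div hδ l i)
            (mul_nonneg hθ (hr0 l i)) ((mul_le_of_le_one_right hθ (hr1 l i)).trans hθ')
          have h7 : θ * (I l).ratio i ^ s * (δ / (I l).ratio i) ^ s = θ * δ ^ s := by
            rw [Real.div_rpow hδ0.le hr.le]
            have := (Real.rpow_pos_of_pos hr s).ne'
            field_simp
          rwa [h7] at h6
        · have h8 : ∀ l, ∏ i, (1 - K * (θ * (I l).ratio i ^ s)) ≤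
              Real.exp (-(K * θ * (I l).ratioSum s)) := by
            intro l
            have h9 : -(K * θ * (I l).ratioSum s) = ∑ i, -(K * (θ * (I l).ratio i ^ s)) := by
              rw [SelfSimilarIFS.ratioSum, Finset.sum_neg_distrib, Finset.mul_sum]
              simp only [mul_assoc]
            rw [h9, Real.exp_sum]
            exact Finset.prod_le_prod (fun i _ => hc0 l i) fun i _ => Real.one_sub_le_exp_neg _
          refine (Finset.sum_le_sum fun l _ =>
            mul_le_mul_of_nonneg_left (h8 l) measureReal_nonneg).trans ?_
          have h9 : K * θ ≤ K * θ₀ := by gcongr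
          refine sum_mul_exp_neg_le (fun l => measureReal_nonneg)
            (sum_measureReal_singleton_eq_one ν)
            (N := N) (fun l => (I l).ratioSum_nonneg s) (h.ratioSum_le hs) (by positivity) ?_ ?_
          · exact le_trans (by gcongr) h1
          · exact le_trans (by gcongr) h2
  refine ⟨θ₀, hθ₀, 1 - K * θ₀, by nlinarith, by nlinarith, fun k δ θ hδ hθ => ?_⟩
  -- A larger `θ` only decreases the Laplace transform.
  refine le_trans (lintegral_mono fun t => ?_) (key k δ θ₀ hδ hθ₀.le le_rfl)
  have hδ0 : 0 < δ := (pow_pos (ha.trans_le h.le) _).trans hδ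
  have h3 := cutSum_survivalIndicator_nonneg (I := I) (Δ := Δ) k δ t
  have h4 : 0 < δ ^ s := Real.rpow_pos_of_pos hδ0 s
  refine ENNReal.ofReal_le_ofReal (Real.exp_le_exp.2 ?_)
  rw [neg_mul, neg_mul, neg_le_neg_iff]
  gcongr

/-- For `δ ≤ a ^ j` no cylinder stops before depth `j`, so each of the first `j` generations applies
the generating function once. Along a generation `θ` loses at most the factor `a ^ s`. -/
lemma lintegral_exp_neg_cutSum_le_iterate (h : RatioBounds I a b N) (hΔc : IsCompact Δ)
    (hΔ : ∀ l i, (I l).map i '' Δ ⊆ Δ) (ν : Measure Λ)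
    [IsProbabilityMeasure ν] {s : ℝ} (hs : 0 ≤ s) {θ₀ y : ℝ} (hθ₀ : 0 < θ₀) (hy : 0 ≤ y)
    (hbase : ∀ (k : ℕ) (δ θ : ℝ), b ^ k < δ → θ₀ ≤ θ →
      ∫⁻ t, ENNReal.ofReal (Real.exp (-(θ * δ ^ s) * cutSum I (survivalIndicator I Δ) k δ t))
        ∂treeMeasure ν ≤ ENNReal.ofReal y) (j : ℕ) :
    ∀ (k : ℕ) (δ θ : ℝ), b ^ k < δ → δ ≤ a ^ j → θ₀ ≤ θ * (a ^ s) ^ j →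
      ∫⁻ t, ENNReal.ofReal (Real.exp (-(θ * δ ^ s) * cutSum I (survivalIndicator I Δ) k δ t))
        ∂treeMeasure ν ≤
        ENNReal.ofReal ((genFun (fun l => ν.real {l}) (fun l => (I l).card))^[j] y) := by
  have ha := h.pos
  induction j with
  | zero =>
    intro k δ θ hδ _ hθ
    exact hbase k δ θ hδ (by simpa using hθ)
  | succ j ih =>
    intro k δ θ hδ hδa hθ
    have hδ0 : 0 < δ := (pow_pos (ha.trans_le h.le) _).trans hδ
    have ha1 : a < 1 := h.le.trans_lt h.lt_one
    have hδ1 : δ < 1 := hδa.trans_lt (pow_lt_one₀ ha.le ha1 (by simp))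
    have hasp : 0 < a ^ s := Real.rpow_pos_of_pos ha s
    have hθ0 : 0 < θ := by
      by_contra hle
      have : θ * (a ^ s) ^ (j + 1) ≤ 0 := mul_nonpos_of_nonpos_of_nonneg (not_lt.1 hle)
        (by positivity)
      linarith
    obtain ⟨k, rfl⟩ : ∃ k', k = k' + 1 := by
      cases k with
      | zero => simp at hδ; linarith
      | succ k => exact ⟨k, rfl⟩
    have hit := genFun_iterate_nonneg (p := fun l => ν.real {l}) (n := fun l => (I l).card)
      (fun l => measureReal_nonneg) hy j
    refine (lintegral_exp_cutSum_succ_le ν (measurable_survivalIndicator hΔc hΔ)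
      (not_lt.2 hδ1.le) (c := fun l i =>
        (genFun (fun l => ν.real {l}) (fun l => (I l).card))^[j] y) (fun l i => hit)
        fun l i => ?_).trans (le_of_eq ?_)
    · have hr := (I l).ratio_pos i
      have hra := h.le_ratio l i
      have h1 : δ / (I l).ratio i ≤ a ^ j := by
        rw [div_le_iff₀ hr]
        refine hδa.trans ?_
        rw [pow_succ]
        gcongr
      have h2 : θ₀ ≤ θ * (I l).ratio i ^ s * (a ^ s) ^ j := by
        refine hθ.trans ?_
        rw [pow_succ', ← mul_assoc]
        gcongr
      have h6 := ih k (δ / (I l).ratio i) (θ * (I l).ratio i ^ s) (h.pow_lt_div hδ l i) h1 h2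
      have h7 : θ * (I l).ratio i ^ s * (δ / (I l).ratio i) ^ s = θ * δ ^ s := by
        rw [Real.div_rpow hδ0.le hr.le]
        have := (Real.rpow_pos_of_pos hr s).ne'
        field_simp
      rwa [h7] at h6
    · rw [Function.iterate_succ_apply']
      simp [genFun]

/-- The probability that a surviving tree has few surviving cylinders. -/
lemma measure_cutSum_le_of_lintegral_le (hΔc : IsCompact Δ)
    (hΔ : ∀ l i, (I l).map i '' Δ ⊆ Δ) (ν : Measure Λ)
    [IsProbabilityMeasure ν] {k : ℕ} {δ τ c : ℝ} (hc : 0 ≤ c)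
    (hle : ∫⁻ t, ENNReal.ofReal (Real.exp (-τ * cutSum I (survivalIndicator I Δ) k δ t))
        ∂treeMeasure ν ≤ ENNReal.ofReal (extinctionProb I Δ ν + c)) :
    treeMeasure ν {t | (limitSet I Δ t).Nonempty ∧
      τ * cutSum I (survivalIndicator I Δ) k δ t ≤ 1} ≤ ENNReal.ofReal (Real.exp 1 * c) := by
  set A := {t : List ℕ → Λ | (limitSet I Δ t).Nonempty} with hA
  have hAm : MeasurableSet A := measurableSet_limitSet_nonempty hΔc hΔ
  set B := {t : List ℕ → Λ | (limitSet I Δ t).Nonempty ∧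
      τ * cutSum I (survivalIndicator I Δ) k δ t ≤ 1} with hB
  have hBm : MeasurableSet B := hAm.inter (measurableSet_le
    ((measurable_cutSum (measurable_survivalIndicator hΔc hΔ) k δ).const_mul τ)
    measurable_const)
  -- On extinction the count is zero and the exponential is `1`; on `B` it is at least `exp (-1)`.
  -- After integration the extinction probability cancels, leaving only `c`.
  have h1 : ∀ t, Aᶜ.indicator 1 t + ENNReal.ofReal (Real.exp (-1)) * B.indicator 1 t ≤
      ENNReal.ofReal (Real.exp (-τ * cutSum I (survivalIndicator I Δ) k δ t)) := by
    intro t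
    by_cases ht : t ∈ A
    · rw [indicator_of_notMem (by simpa using ht)]
      by_cases htB : t ∈ B
      · rw [indicator_of_mem htB]
        simp only [Pi.one_apply, mul_one, zero_add]
        refine ENNReal.ofReal_le_ofReal (Real.exp_le_exp.2 ?_)
        have := htB.2
        linarith
      · simp [indicator_of_notMem htB]
    · have htB : t ∉ B := fun h => ht h.1
      rw [indicator_of_notMem htB, indicator_of_mem (by simpa using ht),
        cutSum_survivalIndicator_eq_zero hΔ k δ ht]
      simp
  have h2 := (lintegral_mono h1).trans hle
  have hq : extinctionProb I Δ ν = (treeMeasure ν).real Aᶜ := rfl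
  rw [lintegral_add_left (measurable_one.indicator hAm.compl),
    lintegral_const_mul _ (measurable_one.indicator hBm), lintegral_indicator_one hBm,
    lintegral_indicator_one hAm.compl, hq, ENNReal.ofReal_add measureReal_nonneg hc,
    ofReal_measureReal, ENNReal.add_le_add_iff_left (measure_ne_top _ _)] at h2
  calc treeMeasure ν B = ENNReal.ofReal (Real.exp 1) *
        (ENNReal.ofReal (Real.exp (-1)) * treeMeasure ν B) := by
        rw [← mul_assoc, ← ENNReal.ofReal_mul (Real.exp_pos _).le, ← Real.exp_add]
        simp
    _ ≤ ENNReal.ofReal (Real.exp 1) * ENNReal.ofReal c := by gcongr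
    _ = _ := (ENNReal.ofReal_mul (Real.exp_pos _).le).symm

/-- Almost surely on survival, the numbers of surviving cylinders grow at the expected rate. -/
lemma exists_ae_eventually_lt_cutSum (h : RatioBounds I a b N) (hΔc : IsCompact Δ)
    (hΔn : Δ.Nonempty) (hΔ : ∀ l i, (I l).map i '' Δ ⊆ Δ) (ν : Measure Λ)
    [IsProbabilityMeasure ν] {s s' : ℝ} (hs' : 0 ≤ s') (hs : s' < s)
    (hE : 1 < ∑ l, ν.real {l} * (I l).ratioSum s) :
    ∃ α : ℝ, 0 < α ∧ α < 1 ∧ ∃ c > 0, ∃ κ : ℕ → ℕ, (∀ n, b ^ κ n < α ^ n) ∧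
      ∀ᵐ t ∂treeMeasure ν, (limitSet I Δ t).Nonempty → ∀ᶠ n : ℕ in atTop,
        c * (α ^ n) ^ (-s') ≤ cutSum I (survivalIndicator I Δ) (κ n) (α ^ n) t := by
  have ha := h.pos
  have ha1 : a < 1 := h.le.trans_lt h.lt_one
  have hs0 : 0 < s := hs'.trans_lt hs
  set p : Λ → ℝ := fun l => ν.real {l} with hp
  set nn : Λ → ℕ := fun l => (I l).card with hnn
  have hp0 : ∀ l, 0 ≤ p l := fun l => measureReal_nonneg
  have hp1 : ∑ l, p l = 1 := sum_measureReal_singleton_eq_one ν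
  have hmean : 1 < ∑ l, p l * nn l := by
    refine hE.trans_le (Finset.sum_le_sum fun l _ => mul_le_mul_of_nonneg_left ?_ (hp0 l))
    calc (I l).ratioSum s ≤ ∑ _i : Fin (I l).card, (1 : ℝ) :=
          Finset.sum_le_sum fun i _ =>
            Real.rpow_le_one ((I l).ratio_pos i).le ((I l).ratio_lt_one i).le hs0.le
      _ = (I l).card := by simp
  obtain ⟨x₂, hx₂, hx₂1, hx₂f, hγ1⟩ := exists_genFun_lt hp0 hp1 hmean
  set γ := ∑ l, p l * (nn l * x₂ ^ (nn l - 1)) with hγ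
  have hγ0 : 0 ≤ γ := Finset.sum_nonneg fun l _ => mul_nonneg (hp0 l) (by positivity)
  have hqx : extinctionProb I Δ ν ≤ x₂ := extinctionProb_le hΔc hΔn hΔ ν hx₂.le hx₂f.le
  have hq0 : 0 ≤ extinctionProb I Δ ν := measureReal_nonneg
  obtain ⟨θ₀, hθ₀, y, hy0, hy1, hbase⟩ := exists_lintegral_exp_neg_cutSum_le h hΔc hΔ ν
    (hqx.trans_lt hx₂1) hs0.le hE
  obtain ⟨K, hK, hgrow⟩ := exists_mul_one_sub_le hp0 hp1 hx₂ hx₂1 hx₂f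
  -- `m` iterations bring `y` below `x₂`; `n` further ones bring it within `γ ^ n` of the extinction
  -- probability.
  obtain ⟨m, hm⟩ : ∃ m : ℕ, 1 < (1 + K) ^ m * (1 - y) := by
    obtain ⟨m, hm⟩ := pow_unbounded_of_one_lt (1 / (1 - y)) (by linarith : 1 < 1 + K)
    exact ⟨m, by rwa [div_lt_iff₀ (by linarith)] at hm⟩
  have hym := genFun_iterate_le_of_lt hp0 hx₂f.le hK hgrow hy0 hy1.le hm
  -- At scale `a ^ (J * n)` about `n` generations are spent on the iteration, at a cost `(a ^ s) ^
  -- n`. This choice of `J` lets the drop from `s` to `s'` pay for it.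
  obtain ⟨J, hJ⟩ : ∃ J : ℕ, s / (s - s') < J := exists_nat_gt _
  have hJ1 : 1 < (J : ℝ) := by
    refine lt_of_le_of_lt ?_ hJ
    rw [le_div_iff₀ (by linarith)]
    linarith
  have hJs : s' * J ≤ s * (J - 1) := by
    rw [div_lt_iff₀ (by linarith)] at hJ
    nlinarith
  have hJ2 : 2 ≤ J := by
    have : 1 < J := by exact_mod_cast hJ1
    omega
  set α : ℝ := a ^ J with hα
  have hα0 : 0 < α := pow_pos ha J
  have hα1 : α < 1 := pow_lt_one₀ ha.le ha1 (by omega)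
  have hκ : ∀ n : ℕ, ∃ k, b ^ k < α ^ n := fun n =>
    exists_pow_lt_of_lt_one (pow_pos hα0 n) h.lt_one
  choose κ hκ using hκ
  have hasp : 0 < a ^ s := Real.rpow_pos_of_pos ha s
  refine ⟨α, hα0, hα1, (a ^ s) ^ m / θ₀, by positivity, κ, hκ, ?_⟩
  -- What remains after losing `a ^ s` in each of `m + n` generations is exactly `θ₀`.
  set θ : ℕ → ℝ := fun n => θ₀ / (a ^ s) ^ (m + n) with hθ
  set B : ℕ → Set (List ℕ → Λ) := fun n => {t | (limitSet I Δ t).Nonempty ∧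
    θ (n) * (α ^ n) ^ s * cutSum I (survivalIndicator I Δ) (κ n) (α ^ n) t ≤ 1} with hB
  have hbound : ∀ n, m ≤ n → treeMeasure ν (B n) ≤ ENNReal.ofReal (Real.exp 1 * γ ^ n) := by
    intro n hmn
    refine measure_cutSum_le_of_lintegral_le hΔc hΔ ν (pow_nonneg hγ0 n) ?_
    refine (lintegral_exp_neg_cutSum_le_iterate h hΔc hΔ ν hs0.le hθ₀ hy0 hbase (m + n) (κ n)
      (α ^ n) (θ n) (hκ n) ?_ ?_).trans (ENNReal.ofReal_le_ofReal ?_)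
    · rw [hα, ← pow_mul]
      refine pow_le_pow_of_le_one ha.le ha1.le ?_
      nlinarith
    · rw [hθ]
      simp only
      rw [div_mul_cancel₀ _ (by positivity)]
    · rw [add_comm m n, Function.iterate_add_apply]
      exact genFun_iterate_le_add_pow hp0 hx₂.le hx₂1.le hx₂f.le hq0 hqx
        (genFun_extinctionProb hΔc hΔ ν) (genFun_iterate_nonneg hp0 hy0 m) hym n
  have hsum : ∑' n, treeMeasure ν (B (n + m)) ≠ ⊤ := by
    have hsm : Summable fun n => Real.exp 1 * γ ^ (n + m) :=
      Summable.mul_left _ ((summable_nat_add_iff m).2 (summable_geometric_of_lt_one hγ0 hγ1))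
    refine ne_top_of_le_ne_top ?_ (ENNReal.tsum_le_tsum fun n =>
      hbound (n + m) (Nat.le_add_left m n))
    rw [← ENNReal.ofReal_tsum_of_nonneg (fun n => by positivity) hsm]
    exact ENNReal.ofReal_ne_top
  filter_upwards [ae_eventually_notMem hsum] with t ht hne
  obtain ⟨n₀, hn₀⟩ := eventually_atTop.1 ht
  filter_upwards [eventually_ge_atTop (n₀ + m)] with n' hn'
  have hn := hn₀ (n' - m) (by omega)
  rw [Nat.sub_add_cancel (by omega)] at hn
  have h1 : 1 < θ n' * (α ^ n') ^ s * cutSum I (survivalIndicator I Δ) (κ n') (α ^ n') t := by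
    by_contra hle
    exact hn ⟨hne, not_lt.1 hle⟩
  have hαn : 0 < α ^ n' := pow_pos hα0 n'
  have hαs : 0 < (α ^ n') ^ s := Real.rpow_pos_of_pos hαn s
  have hθp : 0 < θ n' := by positivity
  have h2 : 1 / (θ n' * (α ^ n') ^ s) ≤
      cutSum I (survivalIndicator I Δ) (κ n') (α ^ n') t := by
    rw [div_le_iff₀ (by positivity)]
    linarith
  refine le_trans ?_ h2
  have h3 : 1 / (θ n' * (α ^ n') ^ s) =
      (a ^ s) ^ m / θ₀ * ((a ^ s) ^ n' * (α ^ n') ^ (-s)) := by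
    rw [hθ, Real.rpow_neg hαn.le]
    simp only
    rw [pow_add]
    field_simp
  rw [h3]
  have h4 : (α ^ n') ^ (-s') ≤ (a ^ s) ^ n' * (α ^ n') ^ (-s) := by
    have e1 : (α ^ n') ^ (-s') = a ^ (-(s' * J) * n') := by
      rw [hα, ← pow_mul, ← Real.rpow_natCast, ← Real.rpow_mul ha.le]
      congr 1
      push_cast
      ring
    have e2 : (a ^ s) ^ n' * (α ^ n') ^ (-s) = a ^ (-(s * (J - 1)) * n') := by
      rw [hα, ← pow_mul, ← Real.rpow_natCast, ← Real.rpow_natCast, ← Real.rpow_mul ha.le,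
        ← Real.rpow_mul ha.le, ← Real.rpow_add ha]
      congr 1
      push_cast
      ring
    rw [e1, e2]
    refine Real.rpow_le_rpow_of_exponent_ge ha ha1.le ?_
    have : (0 : ℝ) ≤ n' := Nat.cast_nonneg n'
    nlinarith
  gcongr

end LowerTail

/-! ### From cylinder counts to covering exponents, tree by tree. -/

section Deterministic

variable {d : ℕ} {Λ : Type*} {I : Λ → SelfSimilarIFS d}
  {Δ : Set (EuclideanSpace ℝ (Fin d))} {a b : ℝ} {N : ℕ}

lemma exists_pow_succ_near {α x : ℝ} (hα : 0 < α) (hα1 : α < 1) (hx : 0 < x) (m : ℕ)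
    (hxm : x ≤ α ^ m) : ∃ n, m ≤ n ∧ α ^ n < x ∧ α * x ≤ α ^ n := by
  obtain ⟨n, h1, h2⟩ := exists_nat_pow_near_of_lt_one hx
    (hxm.trans (pow_le_one₀ hα.le hα1.le)) hα hα1
  refine ⟨n + 1, ?_, h1, ?_⟩
  · exact ((pow_lt_pow_iff_right_of_lt_one₀ hα hα1).1 (h1.trans_le hxm)).le
  · rw [pow_succ']
    gcongr

/-- Global and local covering estimates for a tree whose cylinder numbers are controlled below
all nodes of logarithmic depth. -/
lemma coverNum_le_of_eventually_cutSum_le (h : RatioBounds I a b N) (hU : UniformOSC I)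
    (hΔc : IsCompact Δ) (hΔn : Δ.Nonempty) (hΔ : ∀ l i, (I l).map i '' Δ ⊆ Δ)
    {α ε σ : ℝ} (hα : 0 < α) (hα1 : α < 1) (hε : 0 < ε) (hα4 : α ^ (-ε) = 4) (hσ : 0 ≤ σ)
    {κ : ℕ → ℕ} (hκ : ∀ m, b ^ κ m < α ^ m) {t : List ℕ → Λ}
    (ht : ∀ᶠ m : ℕ in atTop, ∀ w : List ℕ, w.length ≤ 2 ^ m → (∀ x ∈ w, x < N) →
      cutSum I (fun _ => 1) (κ m) (α ^ m) (subtreeAt t w) ≤ (α ^ m) ^ (-σ)) :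
    ∃ C > 0, (∀ r : ℝ, 0 < r → r < 1 →
        ((coverNum r (limitSet I Δ t) : ℕ∞) : ℝ≥0∞) ≤ ENNReal.ofReal (C * r ^ (-σ))) ∧
      ∀ (r R : ℝ) (k : ℕ), 0 < r → r ≤ R → R < 1 → b ^ k < R → (k : ℝ) ^ 2 ≤ (R / r) ^ ε →
        ∀ x, ((coverNum r (limitSet I Δ t ∩ Metric.closedBall x R) : ℕ∞) : ℝ≥0∞) ≤
          ENNReal.ofReal (C * (R / r) ^ σ) := by
  obtain ⟨m₀, hm₀⟩ := eventually_atTop.1 ht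
  obtain ⟨M, hM0, hM⟩ := exists_card_cutWords_le h hU hΔc
  obtain ⟨y₀, hy₀⟩ := hΔn
  obtain ⟨D, hD1, hD⟩ : ∃ D : ℝ, 1 ≤ D ∧ ∀ x ∈ Δ, ∀ y ∈ Δ, dist x y ≤ D := by
    obtain ⟨D, hD⟩ := Metric.isBounded_iff.1 hΔc.isBounded
    exact ⟨max 1 D, le_max_left _ _, fun x hx y hy => (hD hx hy).trans (le_max_right _ _)⟩
  have hD0 : 0 < D := by linarith
  have hM1 : (1 : ℝ) ≤ M := by exact_mod_cast hM0
  set c : ℝ := α ^ (m₀ + 1) / D with hc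
  have hc0 : 0 < c := div_pos (pow_pos hα _) hD0
  -- Any relative scale `u` is replaced by a power `α ^ n` in the controlled range `n ≥ m₀`, at the
  -- price of the constant `c` only.
  have key : ∀ u : ℝ, 0 < u → u ≤ 1 → ∃ n, m₀ ≤ n ∧ α ^ n * D ≤ u ∧ α ^ n ≤ u ∧
      (α ^ n) ^ (-σ) ≤ c ^ (-σ) * u ^ (-σ) := by
    intro u hu hu1
    have hx : 0 < u * (α ^ m₀ / D) := by positivity
    obtain ⟨n, hn, h1, h2⟩ := exists_pow_succ_near hα hα1 hx m₀ (by
      calc u * (α ^ m₀ / D) ≤ 1 * (α ^ m₀ / 1) := by gcongr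
        _ = α ^ m₀ := by ring)
    have hα0 := pow_pos hα m₀
    have hα01 := pow_le_one₀ hα.le hα1.le (n := m₀)
    have h3 : α ^ n * D ≤ u := by
      calc α ^ n * D ≤ u * (α ^ m₀ / D) * D := by gcongr
        _ = u * α ^ m₀ := by field_simp
        _ ≤ u * 1 := by gcongr
        _ = u := mul_one u
    refine ⟨n, hn, h3, ?_, ?_⟩
    · exact (le_mul_of_one_le_right (pow_pos hα n).le hD1).trans h3
    · rw [← Real.mul_rpow hc0.le hu.le]
      refine Real.rpow_le_rpow_of_nonpos (by positivity) ?_ (by linarith)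
      calc c * u = α * (u * (α ^ m₀ / D)) := by rw [hc]; ring
        _ ≤ _ := h2
  refine ⟨M * c ^ (-σ), by positivity, ?_, ?_⟩
  · intro r hr hr1
    obtain ⟨n, hn, h1, -, h2⟩ := key r hr hr1.le
    have h3 := hm₀ n hn [] (by simp) (by simp)
    rw [subtreeAt_nil, cutSum_one] at h3
    calc ((coverNum r (limitSet I Δ t) : ℕ∞) : ℝ≥0∞)
        ≤ (((cutWords I (κ n) (α ^ n) t).card : ℕ∞) : ℝ≥0∞) :=
          ENat.toENNReal_le.2 (coverNum_limitSet_le h hΔ hD hy₀ (hκ n) h1 t)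
      _ = ENNReal.ofReal ((cutWords I (κ n) (α ^ n) t).card : ℝ) := by simp
      _ ≤ _ := by
          refine ENNReal.ofReal_le_ofReal (h3.trans (h2.trans ?_))
          rw [mul_assoc]
          exact le_mul_of_one_le_left (by positivity) hM1
  · intro r R k hr hrR hR1 hbk hk x
    have hR : 0 < R := hr.trans_le hrR
    have hu : 0 < r / R := div_pos hr hR
    obtain ⟨n, hn, h1, h1', h2⟩ := key (r / R) hu (div_le_one_of_le₀ hrR hR.le)
    -- The square of the depth is at most `(R / r) ^ ε ≤ (α ^ n) ^ (-ε) = 4 ^ n`, so the nodes of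
    -- size `R` are among those controlled at scale `α ^ n`.
    have hk2 : k ≤ 2 ^ n := by
      have h4 : ((k : ℝ)) ^ 2 ≤ ((2 : ℝ) ^ n) ^ 2 := by
        calc (k : ℝ) ^ 2 ≤ (R / r) ^ ε := hk
          _ = (r / R) ^ (-ε) := by rw [Real.rpow_neg hu.le, ← Real.inv_rpow hu.le, inv_div]
          _ ≤ (α ^ n) ^ (-ε) :=
              Real.rpow_le_rpow_of_nonpos (pow_pos hα n) h1' (by linarith)
          _ = (α ^ (-ε)) ^ n := by
              rw [← Real.rpow_natCast, ← Real.rpow_natCast, ← Real.rpow_mul hα.le,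
                ← Real.rpow_mul hα.le, mul_comm]
          _ = ((2 : ℝ) ^ n) ^ 2 := by
              rw [hα4, ← pow_mul, mul_comm, pow_mul]
              norm_num
      have h5 := le_of_sq_le_sq h4 (by positivity)
      exact_mod_cast h5
    have h3 : ∀ w ∈ cutWords I k R t, cutSum I (fun _ => 1) (κ n) (α ^ n) (subtreeAt t w) ≤
        (α ^ n) ^ (-σ) := fun w hw =>
      hm₀ n hn w ((length_le_of_mem_cutWords hw).trans hk2) (lt_of_mem_of_mem_cutWords h hw)
    refine (coverNum_limitSet_inter_closedBall_le h hΔ hD hy₀ hM hR1.le hbk (hκ n)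
      (by rw [le_div_iff₀ hR] at h1; linarith) (Real.rpow_nonneg (pow_pos hα n).le _)
      h3 x).trans (ENNReal.ofReal_le_ofReal ?_)
    have h6 : (R / r) ^ σ = (r / R) ^ (-σ) := by
      rw [Real.rpow_neg hu.le, ← Real.inv_rpow hu.le, inv_div]
    rw [h6, mul_assoc]
    gcongr

lemma div_rpow_one_add {R x : ℝ} (hR : 0 < R) : R / R ^ (1 + x) = R ^ (-x) := by
  rw [Real.rpow_add hR, Real.rpow_one, Real.rpow_neg hR.le]
  field_simp

lemma rpow_neg_eq_exp {R x : ℝ} (hR : 0 < R) (hR1 : R < 1) :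
    R ^ (-x) = Real.exp (x * |Real.log R|) := by
  rw [Real.rpow_def_of_pos hR, abs_of_neg (Real.log_neg hR hR1)]
  congr 1
  ring

lemma tendsto_abs_log_nhdsGT_zero : Tendsto (fun x => |Real.log x|) (𝓝[>] 0) atTop :=
  tendsto_abs_atBot_atTop.comp Real.tendsto_log_nhdsGT_zero

lemma eventually_mem_Ioo_nhdsGT_zero : ∀ᶠ x in 𝓝[>] (0 : ℝ), x ∈ Ioo (0 : ℝ) 1 :=
  Ioo_mem_nhdsGT one_pos

/-- In exponential form: `x ^ (-φ x)`, the quotient `R / r`, eventually exceeds every power of `|log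
x|`. -/
lemma eventually_mul_log_le_of_threshold_isLittleO {φ : ℝ → ℝ} (hφ : IsDimensionFunction φ)
    (hth : threshold =o[𝓝[>] 0] φ) (H : ℝ) (hH : 0 < H) :
    ∀ᶠ x in 𝓝[>] 0, H * Real.log |Real.log x| ≤ φ x * |Real.log x| := by
  filter_upwards [hth.bound (inv_pos.2 hH), eventually_mem_Ioo_nhdsGT_zero,
    tendsto_abs_log_nhdsGT_zero.eventually_gt_atTop 0] with x hx hx1 hl
  rw [Real.norm_eq_abs, Real.norm_eq_abs, abs_of_nonneg (hφ.nonneg x hx1), inv_mul_eq_div,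
    le_div_iff₀ hH] at hx
  have h1 : Real.log |Real.log x| / |Real.log x| * H ≤ φ x :=
    (mul_le_mul_of_nonneg_right (le_abs_self _) hH.le).trans hx
  calc H * Real.log |Real.log x| =
        Real.log |Real.log x| / |Real.log x| * H * |Real.log x| := by field_simp
    _ ≤ _ := by gcongr

lemma tendsto_mul_log_of_threshold_isLittleO {φ : ℝ → ℝ} (hφ : IsDimensionFunction φ)
    (hth : threshold =o[𝓝[>] 0] φ) :
    Tendsto (fun x => φ x * |Real.log x|) (𝓝[>] 0) atTop := by
  refine tendsto_atTop_mono' _ (eventually_mul_log_le_of_threshold_isLittleO hφ hth 1 one_pos) ?_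
  simp only [one_mul]
  exact Real.tendsto_log_atTop.comp tendsto_abs_log_nhdsGT_zero

/-- The exponents admissible in the definition of the `φ`-Assouad dimension. -/
def IsPhiAssouadExponent {X : Type*} [PseudoMetricSpace X] (φ : ℝ → ℝ) (F : Set X) (s : ℝ) :
    Prop :=
  0 ≤ s ∧ ∃ C : ℝ, 0 < C ∧ ∀ r R : ℝ, 0 < r → r = R ^ (1 + φ R) → r < R →
    0 < R → R < 1 → ∀ x ∈ F,
      ((coverNum r (F ∩ Metric.closedBall x R) : ℕ∞) : ℝ≥0∞) ≤ ENNReal.ofReal (C * (R / r) ^ s)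

/-- For small `R` the depth `k`, about `|log R| / |log b|`, meets the condition of the local bound
because `R / r` beats every power of `|log R|`. For `R ≥ R₀` the global bound suffices, with the
constant `R₀ ^ (-σ)`. -/
lemma isPhiAssouadExponent_of_coverNum_le {φ : ℝ → ℝ} (hφ : IsDimensionFunction φ)
    (hth : threshold =o[𝓝[>] 0] φ) {F : Set (EuclideanSpace ℝ (Fin d))} {C ε σ : ℝ}
    (hb : 0 < b) (hb1 : b < 1) (hC : 0 < C) (hε : 0 < ε) (hσ : 0 ≤ σ)
    (h1 : ∀ r : ℝ, 0 < r → r < 1 →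
        ((coverNum r F : ℕ∞) : ℝ≥0∞) ≤ ENNReal.ofReal (C * r ^ (-σ)))
    (h2 : ∀ (r R : ℝ) (k : ℕ), 0 < r → r ≤ R → R < 1 → b ^ k < R → (k : ℝ) ^ 2 ≤ (R / r) ^ ε →
        ∀ x, ((coverNum r (F ∩ Metric.closedBall x R) : ℕ∞) : ℝ≥0∞) ≤
          ENNReal.ofReal (C * (R / r) ^ σ)) :
    IsPhiAssouadExponent φ F σ := by
  have hlb : Real.log b < 0 := Real.log_neg hb hb1
  have hev : ∀ᶠ R in 𝓝[>] (0 : ℝ), R ∈ Ioo (0 : ℝ) 1 ∧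
      ∃ k : ℕ, b ^ k < R ∧ (k : ℝ) ^ 2 ≤ (R ^ (-φ R)) ^ ε := by
    -- The `4` comes from `k ≤ l ^ 2` with `l = |log R|`, hence `k ^ 2 ≤ l ^ 4`; the condition `l ≥
    -- |log b|⁻¹ + 1` makes `l * |log b|⁻¹ + 1 ≤ l ^ 2`.
    filter_upwards [eventually_mul_log_le_of_threshold_isLittleO hφ hth (4 / ε) (by positivity),
      eventually_mem_Ioo_nhdsGT_zero,
      tendsto_abs_log_nhdsGT_zero.eventually_ge_atTop (|Real.log b|⁻¹ + 1)] with R hR hR1 hl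
    refine ⟨hR1, ?_⟩
    set l := |Real.log R| with hl'
    have hb' : 0 < |Real.log b|⁻¹ := inv_pos.2 (abs_pos.2 hlb.ne)
    have hl1 : 1 ≤ l := by linarith
    refine ⟨⌊l * |Real.log b|⁻¹⌋₊ + 1, ?_, ?_⟩
    · have h3 : l * |Real.log b|⁻¹ < ((⌊l * |Real.log b|⁻¹⌋₊ + 1 : ℕ) : ℝ) := by
        push_cast
        exact Nat.lt_floor_add_one _
      generalize ⌊l * |Real.log b|⁻¹⌋₊ + 1 = m at h3 ⊢
      rw [← div_eq_mul_inv, div_lt_iff₀ (abs_pos.2 hlb.ne), abs_of_neg hlb, hl',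
        abs_of_neg (Real.log_neg hR1.1 hR1.2)] at h3
      rw [← Real.log_lt_log_iff (pow_pos hb _) hR1.1, Real.log_pow]
      linarith
    · have h4 : ((⌊l * |Real.log b|⁻¹⌋₊ + 1 : ℕ) : ℝ) ≤ l ^ 2 := by
        push_cast
        have := Nat.floor_le (by positivity : 0 ≤ l * |Real.log b|⁻¹)
        nlinarith
      calc ((⌊l * |Real.log b|⁻¹⌋₊ + 1 : ℕ) : ℝ) ^ 2 ≤ (l ^ 2) ^ 2 := by gcongr
        _ = Real.exp (4 * Real.log l) := by
            rw [← Real.rpow_natCast, ← Real.rpow_natCast, ← Real.rpow_mul (by linarith),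
              Real.rpow_def_of_pos (by linarith)]
            congr 1
            push_cast
            ring
        _ ≤ Real.exp (ε * (φ R * l)) := by
            refine Real.exp_le_exp.2 ?_
            rw [div_mul_eq_mul_div, div_le_iff₀ hε] at hR
            linarith
        _ = (R ^ (-φ R)) ^ ε := by
            rw [rpow_neg_eq_exp hR1.1 hR1.2, ← Real.exp_mul]
            congr 1
            ring
  obtain ⟨R₀, hR₀, hsub⟩ := mem_nhdsGT_iff_exists_Ioo_subset.1 hev
  have hR₀' : 0 < R₀ := hR₀
  refine ⟨hσ, C * (1 + R₀ ^ (-σ)), by positivity, ?_⟩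
  intro r R hr hrR hlt hR hR1 x _
  have hRr : 0 < R / r := div_pos hR hr
  have hpow : 0 < (R / r) ^ σ := Real.rpow_pos_of_pos hRr σ
  have hR₀p : 0 < R₀ ^ (-σ) := Real.rpow_pos_of_pos hR₀' _
  by_cases hcase : R < R₀
  · obtain ⟨-, k, hk1, hk2⟩ := hsub ⟨hR, hcase⟩
    refine (h2 r R k hr hlt.le hR1 hk1 ?_ x).trans (ENNReal.ofReal_le_ofReal ?_)
    · rwa [hrR, div_rpow_one_add hR]
    · gcongr
      nlinarith
  · refine (ENat.toENNReal_le.2 (coverNum_mono r inter_subset_left)).trans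
      ((h1 r hr (hlt.trans hR1)).trans (ENNReal.ofReal_le_ofReal ?_))
    have h3 : r ^ (-σ) = R ^ (-σ) * (R / r) ^ σ := by
      rw [Real.div_rpow hR.le hr.le, Real.rpow_neg hR.le, Real.rpow_neg hr.le]
      have := (Real.rpow_pos_of_pos hR σ).ne'
      field_simp
    have h4 : R ^ (-σ) ≤ R₀ ^ (-σ) :=
      Real.rpow_le_rpow_of_nonpos hR₀' (not_lt.1 hcase) (by linarith)
    rw [h3, mul_assoc]
    gcongr
    linarith

/-- Replacing `δ` by `δ / ratio i` multiplies the bound by `ratio i ^ s`. As these factors sum to at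
most one at every node, the bound passes from the children to the parent. -/
lemma cutSum_one_le_rpow (h : RatioBounds I a b N) {s : ℝ} (hs : 0 ≤ s) {k : ℕ} {δ : ℝ}
    (hδ : b ^ k < δ) (haδ : a * δ ≤ 1) {t : List ℕ → Λ} (ht : ∀ w, (I (t w)).ratioSum s ≤ 1) :
    cutSum I (fun _ => 1) k δ t ≤ (a * δ) ^ (-s) := by
  have hbase : ∀ δ : ℝ, 0 < δ → a * δ ≤ 1 → 1 ≤ (a * δ) ^ (-s) := fun δ h0 h1 =>
    Real.one_le_rpow_of_pos_of_le_one_of_nonpos (mul_pos h.pos h0) h1 (by linarith)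
  induction k generalizing δ t with
  | zero =>
    rw [pow_zero] at hδ
    exact hbase δ (by linarith) haδ
  | succ k ih =>
    have hδ0 : 0 < δ := (pow_pos (h.pos.trans_le h.le) _).trans hδ
    by_cases h1 : 1 < δ
    · simpa [cutSum, h1] using hbase δ hδ0 haδ
    · simp only [cutSum, h1, if_false]
      have haδ0 : 0 < a * δ := mul_pos h.pos hδ0
      calc ∑ i : Fin (I (t [])).card,
            cutSum I (fun _ => 1) k (δ / (I (t [])).ratio i) (subtree t i)
          ≤ ∑ i : Fin (I (t [])).card, (a * δ) ^ (-s) * (I (t [])).ratio i ^ s := by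
            refine Finset.sum_le_sum fun i _ => ?_
            have hr := (I (t [])).ratio_pos i
            have h3 : a * (δ / (I (t [])).ratio i) ≤ 1 := by
              rw [mul_div_assoc', div_le_one hr]
              nlinarith [h.le_ratio (t []) i, h.pos]
            refine (ih (h.pow_lt_div hδ _ i) h3 fun w => ht _).trans (le_of_eq ?_)
            rw [mul_div_assoc', Real.div_rpow haδ0.le hr.le, Real.rpow_neg hr.le, div_inv_eq_mul]
        _ = (a * δ) ^ (-s) * (I (t [])).ratioSum s := by
            rw [SelfSimilarIFS.ratioSum, Finset.mul_sum]
        _ ≤ (a * δ) ^ (-s) * 1 := by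
            gcongr
            exact ht []
        _ = _ := mul_one _

/-- The exponents admissible in the definition of the Assouad dimension. -/
def IsAssouadExponent {X : Type*} [PseudoMetricSpace X] (F : Set X) (s : ℝ) : Prop :=
  0 ≤ s ∧ ∃ C : ℝ, 0 < C ∧ ∀ r R : ℝ, 0 < r → r ≤ R → R < 1 → ∀ x ∈ F,
      ((coverNum r (F ∩ Metric.closedBall x R) : ℕ∞) : ℝ≥0∞) ≤ ENNReal.ofReal (C * (R / r) ^ s)

lemma isAssouadExponent_limitSet (h : RatioBounds I a b N) (hU : UniformOSC I)
    (hΔc : IsCompact Δ) (hΔn : Δ.Nonempty) (hΔ : ∀ l i, (I l).map i '' Δ ⊆ Δ) {s : ℝ}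
    (hs : 0 ≤ s) {t : List ℕ → Λ} (ht : ∀ w, (I (t w)).ratioSum s ≤ 1) :
    IsAssouadExponent (limitSet I Δ t) s := by
  obtain ⟨M, hM0, hM⟩ := exists_card_cutWords_le h hU hΔc
  obtain ⟨y₀, hy₀⟩ := hΔn
  obtain ⟨D, hD1, hD⟩ : ∃ D : ℝ, 1 ≤ D ∧ ∀ x ∈ Δ, ∀ y ∈ Δ, dist x y ≤ D := by
    obtain ⟨D, hD⟩ := Metric.isBounded_iff.1 hΔc.isBounded
    exact ⟨max 1 D, le_max_left _ _, fun x hx y hy => (hD hx hy).trans (le_max_right _ _)⟩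
  have hD0 : 0 < D := by linarith
  have ha := h.pos
  have ha1 : a < 1 := h.le.trans_lt h.lt_one
  have hM1 : (0 : ℝ) < M := by exact_mod_cast hM0
  refine ⟨hs, M * (a / D) ^ (-s), by positivity, fun r R hr hrR hR1 x _ => ?_⟩
  have hR : 0 < R := hr.trans_le hrR
  set δ := r / (R * D) with hδ
  have hδ0 : 0 < δ := by positivity
  have hδ1 : δ ≤ 1 := by
    rw [hδ, div_le_one (by positivity)]
    nlinarith
  obtain ⟨k, hk⟩ := exists_pow_lt_of_lt_one hR h.lt_one
  obtain ⟨k', hk'⟩ := exists_pow_lt_of_lt_one hδ0 h.lt_one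
  refine (coverNum_limitSet_inter_closedBall_le h hΔ hD hy₀ hM hR1.le hk hk'
    (le_of_eq ?_) (Real.rpow_nonneg (by positivity) _)
    (fun w _ => cutSum_one_le_rpow h hs hk' (by nlinarith) fun u => ht (w ++ u)) x).trans
    (le_of_eq ?_)
  · rw [hδ]
    field_simp
  · have h1 : a * δ = a / D * (r / R) := by
      rw [hδ]
      field_simp
    have h2 : (r / R) ^ (-s) = (R / r) ^ s := by
      rw [Real.rpow_neg (by positivity), ← Real.inv_rpow (by positivity), inv_div]
    rw [h1, Real.mul_rpow (by positivity) (by positivity), h2, mul_assoc]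

/-- Scales between consecutive powers of `α` lose a factor `α ^ s` by monotonicity; at scales above
`α ^ n₀` it is enough that the set is non-empty. -/
lemma exists_le_coverNum_of_eventually (h : RatioBounds I a b N) (hU : UniformOSC I)
    (hΔc : IsCompact Δ) (hΔ : ∀ l i, (I l).map i '' Δ ⊆ Δ) {α c s : ℝ} (hα : 0 < α)
    (hα1 : α < 1) (hc : 0 < c) (hs : 0 ≤ s) {κ : ℕ → ℕ} (hκ : ∀ m, b ^ κ m < α ^ m)
    {t : List ℕ → Λ} (hne : (limitSet I Δ t).Nonempty)
    (ht : ∀ᶠ n : ℕ in atTop,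
        c * (α ^ n) ^ (-s) ≤ cutSum I (survivalIndicator I Δ) (κ n) (α ^ n) t) :
    ∃ c' > 0, ∀ r : ℝ, 0 < r → r < 1 →
      ENNReal.ofReal (c' * r ^ (-s)) ≤ ((coverNum r (limitSet I Δ t) : ℕ∞) : ℝ≥0∞) := by
  obtain ⟨n₀, hn₀⟩ := eventually_atTop.1 ht
  obtain ⟨M, hM0, hM⟩ := exists_card_cutWords_le h hU hΔc
  have hM1 : (0 : ℝ) < M := by exact_mod_cast hM0
  have hc1 : 0 < c * α ^ s / M := by positivity
  have hc2 : 0 < (α ^ n₀) ^ s := by positivity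
  refine ⟨min (c * α ^ s / M) ((α ^ n₀) ^ s), lt_min hc1 hc2, fun r hr hr1 => ?_⟩
  have hrs : 0 < r ^ (-s) := Real.rpow_pos_of_pos hr _
  by_cases hcase : α ^ n₀ < r
  · refine le_trans (ENNReal.ofReal_le_ofReal (q := 1) ?_) ?_
    · calc min (c * α ^ s / M) ((α ^ n₀) ^ s) * r ^ (-s) ≤ (α ^ n₀) ^ s * (α ^ n₀) ^ (-s) := by
            exact mul_le_mul (min_le_right _ _)
              (Real.rpow_le_rpow_of_nonpos (pow_pos hα n₀) hcase.le (by linarith)) hrs.le hc2.le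
        _ = 1 := by rw [← Real.rpow_add (pow_pos hα n₀)]; simp
    · have h1 : (1 : ℕ∞) ≤ coverNum r (limitSet I Δ t) :=
        Order.one_le_iff_pos.2 (Metric.externalCoveringNumber_pos_iff.2 hne)
      simpa using ENat.toENNReal_le.2 h1
  · obtain ⟨n, h1, h2⟩ := exists_nat_pow_near_of_lt_one hr hr1.le hα hα1
    have hn : n₀ ≤ n := by
      have := (pow_lt_pow_iff_right_of_lt_one₀ hα hα1).1 (h1.trans_le (not_lt.1 hcase))
      omega
    have hαn := pow_pos hα n
    have h3 := cutSum_survivalIndicator_le h hΔ hM0 hM (g := id) one_pos (by simp)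
      (pow_le_one₀ hα.le hα1.le) (hκ n) t
    rw [image_id, one_mul] at h3
    have h4 := (ENNReal.ofReal_le_ofReal (hn₀ n hn)).trans h3
    have h5 : ENNReal.ofReal (c * (α ^ n) ^ (-s) / M) ≤
        ((coverNum (α ^ n) (limitSet I Δ t) : ℕ∞) : ℝ≥0∞) := by
      rw [ENNReal.ofReal_div_of_pos hM1, ENNReal.ofReal_natCast]
      exact ENNReal.div_le_of_le_mul' h4
    refine (le_trans (ENNReal.ofReal_le_ofReal ?_) h5).trans
      (ENat.toENNReal_le.2 (coverNum_anti h2 _))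
    have h6 : r ^ (-s) ≤ (α ^ n) ^ (-s) * α ^ (-s) := by
      rw [← Real.mul_rpow hαn.le hα.le, ← pow_succ]
      exact Real.rpow_le_rpow_of_nonpos (pow_pos hα _) h1.le (by linarith)
    calc min (c * α ^ s / M) ((α ^ n₀) ^ s) * r ^ (-s)
        ≤ c * α ^ s / M * ((α ^ n) ^ (-s) * α ^ (-s)) := by
          gcongr
          exact min_le_left _ _
      _ = c * (α ^ n) ^ (-s) / M * (α ^ s * α ^ (-s)) := by ring
      _ = c * (α ^ n) ^ (-s) / M := by rw [← Real.rpow_add hα]; simp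

end Deterministic

/-! ### Chaining scales: local exponents dominate lower box-counting exponents. -/

section Doubling

lemma exists_closedBall_cover_half (E : Type*) [NormedAddCommGroup E] [NormedSpace ℝ E]
    [ProperSpace E] :
    ∃ A : ℕ, ∀ (x : E) (R : ℝ), 0 < R → ∃ T : Finset E, T.card ≤ A ∧
      ∀ y, dist y x ≤ R → ∃ z ∈ T, dist y z ≤ R / 2 := by
  classical
  obtain ⟨T, -, hT⟩ := (isCompact_closedBall (0 : E) 1).elim_finite_subcover_image
    (b := univ) (c := fun y => Metric.ball y (1 / 2)) (fun _ _ => Metric.isOpen_ball)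
    (fun y _ => mem_iUnion₂.2 ⟨y, mem_univ _, Metric.mem_ball_self (by positivity)⟩)
  obtain ⟨hTf, hT⟩ := hT
  refine ⟨hTf.toFinset.card, fun x R hR => ⟨hTf.toFinset.image fun z => x + R • z,
    Finset.card_image_le, fun y hy => ?_⟩⟩
  have h1 : R⁻¹ • (y - x) ∈ Metric.closedBall (0 : E) 1 := by
    rw [mem_closedBall_zero_iff, norm_smul, ← dist_eq_norm, Real.norm_of_nonneg (by positivity),
      inv_mul_le_iff₀ hR, mul_one]
    exact hy
  obtain ⟨z, hz, hyz⟩ := mem_iUnion₂.1 (hT h1)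
  refine ⟨x + R • z, Finset.mem_image_of_mem _ (by simpa using hz), ?_⟩
  have h2 : y = x + R • (R⁻¹ • (y - x)) := by rw [smul_inv_smul₀ hR.ne']; abel
  rw [h2, dist_add_left, dist_smul₀, Real.norm_of_nonneg hR.le]
  have := Metric.mem_ball.1 hyz
  nlinarith

/-- The balls of an optimal `R`-cover need not be centred in `F`. Each is split into `A` balls of
radius `R / 2`, and one that meets `F` has its part of `F` inside a ball of radius `R` about a point
of `F`. -/
lemma toNat_coverNum_le_mul {E : Type*} [NormedAddCommGroup E] [NormedSpace ℝ E]
    {A : ℕ} (hA : ∀ (x : E) (R : ℝ), 0 < R → ∃ T : Finset E, T.card ≤ A ∧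
      ∀ y, dist y x ≤ R → ∃ z ∈ T, dist y z ≤ R / 2)
    {F : Set E} (hF : TotallyBounded F) {r R B : ℝ} (hr : 0 < r) (hR : 0 < R) (hB : 0 ≤ B)
    (h : ∀ x ∈ F, ((coverNum r (F ∩ Metric.closedBall x R) : ℕ∞) : ℝ≥0∞) ≤
      ENNReal.ofReal B) :
    ((coverNum r F).toNat : ℝ) ≤ (coverNum R F).toNat * (A * B) := by
  classical
  obtain ⟨T, hTc, hT⟩ := exists_finset_card_eq_coverNum hR.le (coverNum_ne_top hR hF)
  have h1 : ∀ z : E, ∃ S : Finset E, (S.card : ℝ) ≤ B ∧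
      ∀ y ∈ F, dist y z ≤ R / 2 → ∃ u ∈ S, dist y u ≤ r := by
    intro z
    by_cases hz : ∃ x ∈ F, dist x z ≤ R / 2
    · obtain ⟨x, hx, hxz⟩ := hz
      have h2 := h x hx
      obtain ⟨S, hSc, hS⟩ := exists_finset_card_eq_coverNum hr.le
        (coverNum_ne_top hr (hF.subset (inter_subset_left (t := Metric.closedBall x R))))
      refine ⟨S, ?_, fun y hy hyz => hS y ⟨hy, ?_⟩⟩
      · rw [← hSc, ENat.toENNReal_coe, ← ENNReal.ofReal_natCast] at h2
        exact (ENNReal.ofReal_le_ofReal_iff hB).1 h2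
      · rw [Metric.mem_closedBall]
        have := dist_triangle y z x
        rw [dist_comm z x] at this
        linarith
    · exact ⟨∅, by simpa using hB, fun y hy hyz => absurd ⟨y, hy, hyz⟩ hz⟩
  choose S hSc hS using h1
  choose V hVc hV using fun x : E => hA x R hR
  have h2 : coverNum r F ≤ (T.biUnion fun x => (V x).biUnion S).card := by
    refine coverNum_le_card hr.le fun y hy => ?_
    obtain ⟨x, hx, hyx⟩ := hT y hy
    obtain ⟨z, hz, hyz⟩ := hV x y hyx
    obtain ⟨u, hu, hyu⟩ := hS z y hy hyz
    exact ⟨u, Finset.mem_biUnion.2 ⟨x, hx, Finset.mem_biUnion.2 ⟨z, hz, hu⟩⟩, hyu⟩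
  have h3 : (coverNum r F).toNat ≤ (T.biUnion fun x => (V x).biUnion S).card := by
    have := ENat.toNat_le_toNat h2 (ENat.natCast_ne_top _)
    simpa using this
  have h4 : ((T.biUnion fun x => (V x).biUnion S).card : ℝ) ≤ T.card * (A * B) := by
    calc ((T.biUnion fun x => (V x).biUnion S).card : ℝ)
        ≤ ∑ x ∈ T, (((V x).biUnion S).card : ℝ) := by exact_mod_cast Finset.card_biUnion_le
      _ ≤ ∑ x ∈ T, ((A : ℝ) * B) := by
          refine Finset.sum_le_sum fun x _ => ?_
          calc (((V x).biUnion S).card : ℝ) ≤ ∑ z ∈ V x, ((S z).card : ℝ) := by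
                exact_mod_cast Finset.card_biUnion_le
            _ ≤ ∑ z ∈ V x, B := Finset.sum_le_sum fun z _ => hSc z
            _ = (V x).card * B := by simp
            _ ≤ A * B := by
                gcongr
                exact hVc x
      _ = _ := by simp
  have h5 : (coverNum R F).toNat = T.card := by rw [← hTc]; simp
  rw [h5]
  exact (by exact_mod_cast h3 : ((coverNum r F).toNat : ℝ) ≤ _).trans h4

/-- The exponents of the `φ`-Assouad dimension dominate the lower box-counting exponents. -/
lemma le_of_isPhiAssouadExponent {E : Type*} [NormedAddCommGroup E] [NormedSpace ℝ E]
    [ProperSpace E] {F : Set E} (hF : TotallyBounded F) {φ : ℝ → ℝ}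
    (hφ : Tendsto (fun x => φ x * |Real.log x|) (𝓝[>] 0) atTop) {s u c : ℝ} (hc : 0 < c)
    (hlow : ∀ r : ℝ, 0 < r → r < 1 →
      ENNReal.ofReal (c * r ^ (-s)) ≤ ((coverNum r F : ℕ∞) : ℝ≥0∞))
    (hu : IsPhiAssouadExponent φ F u) : s ≤ u := by
  by_contra! hlt
  obtain ⟨-, C, hC, hu⟩ := hu
  obtain ⟨A, hA⟩ := exists_closedBall_cover_half E
  set n : ℝ → ℝ := fun r => ((coverNum r F).toNat : ℝ) with hn
  have hnlow : ∀ r : ℝ, 0 < r → r < 1 → c * r ^ (-s) ≤ n r := by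
    intro r hr hr1
    have h1 := hlow r hr hr1
    have h2 : ((coverNum r F : ℕ∞) : ℝ≥0∞) = ENNReal.ofReal (n r) := by
      rw [hn, ENNReal.ofReal_natCast, ← ENat.toENNReal_coe,
        ENat.natCast_toNat (coverNum_ne_top hr hF)]
    rw [h2] at h1
    exact (ENNReal.ofReal_le_ofReal_iff (Nat.cast_nonneg _)).1 h1
  have hnpos : ∀ r : ℝ, 0 < r → r < 1 → 0 < n r := fun r hr hr1 =>
    lt_of_lt_of_le (mul_pos hc (Real.rpow_pos_of_pos hr _)) (hnlow r hr hr1)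
  set K := max (Real.log (A * C)) 1 with hK
  have hK1 : 1 ≤ K := le_max_right _ _
  -- Each chaining step multiplies the covering number by an unwanted constant of logarithm at most
  -- `K`. If `log (R / r) ≥ H`, half of the gap `s - u` absorbs it.
  set H := 2 * K / (s - u) with hH
  have hH0 : 0 < H := div_pos (by linarith) (by linarith)
  obtain ⟨R₀, hR₀, hsub⟩ := mem_nhdsGT_iff_exists_Ioo_subset.1
    ((hφ.eventually_ge_atTop H).and eventually_mem_Ioo_nhdsGT_zero)
  have hR₀' : 0 < R₀ := hR₀
  set R₁ := R₀ / 2 with hR₁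
  have hR₁0 : 0 < R₁ := by positivity
  have hR₁1 : R₁ < 1 := (hsub (show R₁ ∈ Ioo 0 R₀ from ⟨hR₁0, by linarith⟩)).2.2
  -- Along `R ↦ R ^ (1 + φ R)` the logarithmic scale gains at least `H` per step, while `log (n R)`
  -- grows at rate at most `(s + u) / 2`. In the limit this contradicts growth at rate `s`.
  have key : ∀ k : ℕ, ∃ R, 0 < R ∧ R ≤ R₁ ∧ -Real.log R₁ + k * H ≤ -Real.log R ∧
      Real.log (n R) ≤ Real.log (n R₁) + (s + u) / 2 * (-Real.log R + Real.log R₁) := by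
    intro k
    induction k with
    | zero => exact ⟨R₁, hR₁0, le_rfl, by simp, by simp⟩
    | succ k ih =>
      obtain ⟨R, hR0, hRR, hRl, hRn⟩ := ih
      have hR1 : R < 1 := hRR.trans_lt hR₁1
      have hφR := (hsub (show R ∈ Ioo 0 R₀ from ⟨hR0, by linarith⟩)).1
      have hlog : Real.log R < 0 := Real.log_neg hR0 hR1
      rw [abs_of_neg hlog] at hφR
      set r := R ^ (1 + φ R) with hr
      have hr0 : 0 < r := Real.rpow_pos_of_pos hR0 _
      have hrlog : Real.log r = (1 + φ R) * Real.log R := Real.log_rpow hR0 _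
      have hrR : r < R := by
        rw [← Real.log_lt_log_iff hr0 hR0, hrlog]
        linarith
      have h1 := toNat_coverNum_le_mul hA hF hr0 hR0 (by positivity)
        (hu r R hr0 hr hrR hR0 hR1)
      refine ⟨r, hr0, hrR.le.trans hRR, ?_, ?_⟩
      · rw [hrlog]
        push_cast
        linarith
      · have hnR := hnpos R hR0 hR1
        have hnr := hnpos r hr0 (hrR.trans hR1)
        have hRr : 0 < R / r := div_pos hR0 hr0
        have hApos : (0 : ℝ) < A := by
          rcases Nat.eq_zero_or_pos A with h0 | h0
          · exfalso
            simp only [hn] at hnr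
            rw [h0, Nat.cast_zero, zero_mul, mul_zero] at h1
            linarith
          · exact_mod_cast h0
        have h2 : Real.log (n r) ≤ Real.log (n R) + (Real.log (A * C) +
            u * (Real.log R - Real.log r)) := by
          have h3 := Real.log_le_log hnr h1
          rw [← mul_assoc (A : ℝ) C, Real.log_mul hnR.ne' (by positivity),
            Real.log_mul (by positivity) (by positivity), Real.log_rpow hRr,
            Real.log_div hR0.ne' hr0.ne'] at h3
          exact h3
        have h4 : Real.log (A * C) ≤ K := le_max_left _ _
        have h5 : Real.log R - Real.log r ≥ H := by
          rw [hrlog]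
          linarith
        have h6 : (s - u) / 2 * H = K := by
          rw [hH]
          have : s - u ≠ 0 := by linarith
          field_simp
        have h7 : (s - u) / 2 * H ≤ (s - u) / 2 * (Real.log R - Real.log r) := by
          gcongr
        linarith
  obtain ⟨k, hk⟩ := exists_nat_gt ((Real.log (n R₁) + (s + u) / 2 * Real.log R₁ - Real.log c -
    (s - u) / 2 * (-Real.log R₁)) / ((s - u) / 2 * H))
  rw [div_lt_iff₀ (mul_pos (by linarith) hH0)] at hk
  obtain ⟨R, hR0, hRR, hRl, hRn⟩ := key k
  have h1 := Real.log_le_log (by positivity) (hnlow R hR0 (hRR.trans_lt hR₁1))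
  rw [Real.log_mul hc.ne' (by positivity), Real.log_rpow hR0] at h1
  have h2 : (s - u) / 2 * (-Real.log R₁ + k * H) ≤ (s - u) / 2 * (-Real.log R) := by
    gcongr
  linarith

end Doubling

/-! ### Exceptional subtrees with a constant label. -/

section FullSubtrees

variable {d : ℕ} {Λ : Type*} {I : Λ → SelfSimilarIFS d}
  {Δ : Set (EuclideanSpace ℝ (Fin d))} {a b : ℝ} {N : ℕ}

/-- The trees all of whose labels up to depth `k` are `l`, and all of whose nodes at depth `k`
survive. -/
def fullTrees (I : Λ → SelfSimilarIFS d) (Δ : Set (EuclideanSpace ℝ (Fin d))) (l : Λ) :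
    ℕ → Set (List ℕ → Λ)
  | 0 => {t | (limitSet I Δ t).Nonempty}
  | k + 1 => {t | t [] = l ∧ ∀ i : Fin (I l).card, subtree t i ∈ fullTrees I Δ l k}

/-- The trees that have no subtree in `A` at depth `n`. -/
def avoidTrees (I : Λ → SelfSimilarIFS d) (A : Set (List ℕ → Λ)) : ℕ → Set (List ℕ → Λ)
  | 0 => Aᶜ
  | n + 1 => {t | ∀ i : Fin (I (t [])).card, subtree t i ∈ avoidTrees I A n}

lemma limitSet_nonempty_of_mem_fullTrees (hΔ : ∀ l i, (I l).map i '' Δ ⊆ Δ) {l : Λ}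
    (hl : 0 < (I l).card) {k : ℕ} {t : List ℕ → Λ} (ht : t ∈ fullTrees I Δ l k) :
    (limitSet I Δ t).Nonempty := by
  induction k generalizing t with
  | zero => exact ht
  | succ k ih =>
    obtain ⟨rfl, h⟩ := ht
    exact (limitSet_nonempty_iff_exists hΔ t).2 ⟨⟨0, hl⟩, ih (h ⟨0, hl⟩)⟩

lemma card_pos_of_one_le_ratioSum {S : SelfSimilarIFS d} {s : ℝ} (h : 1 ≤ S.ratioSum s) :
    0 < S.card := by
  by_contra h0
  have h1 : S.card = 0 := by omega
  have : IsEmpty (Fin S.card) := by rw [h1]; infer_instance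
  rw [SelfSimilarIFS.ratioSum, Finset.univ_eq_empty, Finset.sum_empty] at h
  linarith

/-- While all labels are `l`, the weights `ratio i ^ s` sum to at least one, so the bound `δ ^ (-s)`
passes from the children to the parent. By `b ^ k < δ` the recursion stops before the full
generations run out. -/
lemma rpow_le_cutSum_of_mem_fullTrees (h : RatioBounds I a b N)
    (hΔ : ∀ l i, (I l).map i '' Δ ⊆ Δ) {l : Λ} {s : ℝ} (hs : 0 ≤ s)
    (hl : 1 ≤ (I l).ratioSum s) {k : ℕ} {δ : ℝ} (hδ : b ^ k < δ) {t : List ℕ → Λ}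
    (ht : t ∈ fullTrees I Δ l k) : δ ^ (-s) ≤ cutSum I (survivalIndicator I Δ) k δ t := by
  have hne := limitSet_nonempty_of_mem_fullTrees hΔ (card_pos_of_one_le_ratioSum hl) ht
  have hbase : ∀ δ : ℝ, 1 < δ → δ ^ (-s) ≤ survivalIndicator I Δ t := by
    intro δ hδ
    rw [survivalIndicator, if_pos hne]
    exact Real.rpow_le_one_of_one_le_of_nonpos hδ.le (by linarith)
  induction k generalizing δ t with
  | zero => exact hbase δ (by simpa using hδ)
  | succ k ih =>
    have hδ0 : 0 < δ := (pow_pos (h.pos.trans_le h.le) _).trans hδ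
    by_cases h1 : 1 < δ
    · simpa [cutSum, h1] using hbase δ h1
    · obtain ⟨rfl, hsub⟩ := ht
      simp only [cutSum, h1, if_false]
      calc δ ^ (-s) ≤ δ ^ (-s) * (I (t [])).ratioSum s :=
            le_mul_of_one_le_right (Real.rpow_nonneg hδ0.le _) hl
        _ = ∑ i : Fin (I (t [])).card, (δ / (I (t [])).ratio i) ^ (-s) := by
            rw [SelfSimilarIFS.ratioSum, Finset.mul_sum]
            refine Finset.sum_congr rfl fun i _ => ?_
            have hr := (I (t [])).ratio_pos i
            rw [Real.div_rpow hδ0.le hr.le, Real.rpow_neg hr.le, div_inv_eq_mul]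
        _ ≤ _ := by
            refine Finset.sum_le_sum fun i _ => ?_
            have hne' := limitSet_nonempty_of_mem_fullTrees hΔ (card_pos_of_one_le_ratioSum hl)
              (hsub i)
            refine ih (h.pow_lt_div hδ _ i) (hsub i) hne' fun δ hδ => ?_
            rw [survivalIndicator, if_pos hne']
            exact Real.rpow_le_one_of_one_le_of_nonpos hδ.le (by linarith)

/-- The map `g` composes the maps along a path of length `n` to a node whose subtree lies in `A`. -/
lemma exists_copy_of_notMem_avoidTrees (h : RatioBounds I a b N)
    (hΔ : ∀ l i, (I l).map i '' Δ ⊆ Δ) {A : Set (List ℕ → Λ)} {n : ℕ} {t : List ℕ → Λ}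
    (ht : t ∉ avoidTrees I A n) :
    ∃ (g : EuclideanSpace ℝ (Fin d) → EuclideanSpace ℝ (Fin d)) (c : ℝ) (u : List ℕ → Λ),
      a ^ n ≤ c ∧ c ≤ b ^ n ∧ (∀ x y, dist (g x) (g y) = c * dist x y) ∧
      g '' limitSet I Δ u ⊆ limitSet I Δ t ∧ u ∈ A := by
  induction n generalizing t with
  | zero => exact ⟨id, 1, t, by simp, by simp, by simp, by simp, not_not.1 ht⟩
  | succ n ih =>
    obtain ⟨i, hi⟩ := not_forall.1 ht
    obtain ⟨g, c, u, h1, h2, h3, h4, h5⟩ := ih hi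
    have hb0 := h.pos.trans_le h.le
    have hc0 : 0 < c := (pow_pos h.pos n).trans_le h1
    refine ⟨(I (t [])).map i ∘ g, (I (t [])).ratio i * c, u, ?_, ?_, fun x y => ?_, ?_, h5⟩
    · rw [pow_succ']
      exact mul_le_mul (h.le_ratio _ i) h1 (pow_nonneg h.pos.le n) ((I _).ratio_pos i).le
    · rw [pow_succ']
      exact mul_le_mul (h.ratio_le _ i) h2 hc0.le hb0.le
    · rw [Function.comp, Function.comp, (I (t [])).dist_map, h3, mul_assoc]
    · rw [image_comp, limitSet_eq hΔ t]
      exact (image_mono h4).trans (subset_iUnion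
        (fun i : Fin (I (t [])).card => (I (t [])).map i '' limitSet I Δ (subtree t i)) i)

lemma subset_avoidTrees (hΔ : ∀ l i, (I l).map i '' Δ ⊆ Δ) {A : Set (List ℕ → Λ)}
    (hA : ∀ t ∈ A, (limitSet I Δ t).Nonempty) (n : ℕ) {t : List ℕ → Λ}
    (ht : ¬ (limitSet I Δ t).Nonempty) : t ∈ avoidTrees I A n := by
  induction n generalizing t with
  | zero => exact fun h => ht (hA t h)
  | succ n ih =>
    intro i
    refine ih fun hi => ht ?_
    exact (limitSet_nonempty_iff_exists hΔ t).2 ⟨i, hi⟩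

variable [MeasurableSpace Λ] [MeasurableSingletonClass Λ]

lemma measurableSet_root_and_subtree (n : ℕ) (l : Λ) {A : Set (List ℕ → Λ)}
    (hA : MeasurableSet A) :
    MeasurableSet {t : List ℕ → Λ | t [] = l ∧ ∀ i : Fin n, subtree t i ∈ A} := by
  have h1 : {t : List ℕ → Λ | ∀ i : Fin n, subtree t i ∈ A} =
      ⋂ i : Fin n, (fun t : List ℕ → Λ => subtree t i) ⁻¹' A := by
    ext t
    simp
  have h2 : MeasurableSet {t : List ℕ → Λ | ∀ i : Fin n, subtree t i ∈ A} := by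
    rw [h1]
    exact MeasurableSet.iInter fun i => measurable_subtree _ hA
  exact ((measurable_pi_apply [] : Measurable fun t : List ℕ → Λ => t [])
    (measurableSet_singleton l)).inter h2

variable [Fintype Λ]

lemma measurableSet_fullTrees (hΔc : IsCompact Δ) (hΔ : ∀ l i, (I l).map i '' Δ ⊆ Δ) (l : Λ)
    (k : ℕ) : MeasurableSet (fullTrees I Δ l k) := by
  induction k with
  | zero => exact measurableSet_limitSet_nonempty hΔc hΔ
  | succ k ih => exact measurableSet_root_and_subtree _ l ih

lemma measurableSet_avoidTrees {A : Set (List ℕ → Λ)} (hA : MeasurableSet A) (n : ℕ) :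
    MeasurableSet (avoidTrees I A n) := by
  induction n with
  | zero => exact hA.compl
  | succ n ih => exact measurableSet_forall_subtree ih

lemma measureReal_avoidTrees (ν : Measure Λ) [IsProbabilityMeasure ν] {A : Set (List ℕ → Λ)}
    (hA : MeasurableSet A) (n : ℕ) :
    (treeMeasure ν).real (avoidTrees I A n) =
      (genFun (fun l => ν.real {l}) (fun l => (I l).card))^[n] (1 - (treeMeasure ν).real A) := by
  induction n with
  | zero => exact probReal_compl_eq_one_sub hA
  | succ n ih =>
    rw [Function.iterate_succ_apply', ← ih]
    exact measureReal_forall_subtree I ν (measurableSet_avoidTrees hA n)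

lemma measureReal_root_and_subtree (ν : Measure Λ) [IsProbabilityMeasure ν] (n : ℕ) (l : Λ)
    {A : Set (List ℕ → Λ)} (hA : MeasurableSet A) :
    (treeMeasure ν).real {t : List ℕ → Λ | t [] = l ∧ ∀ i : Fin n, subtree t i ∈ A} =
      ν.real {l} * (treeMeasure ν).real A ^ n := by
  classical
  have h1 := lintegral_root_mul_prod ν (({l} : Set Λ).indicator 1) n
    (G := fun _ => A.indicator 1) (fun i => measurable_one.indicator hA)
  have h2 : ∀ t : List ℕ → Λ, ({l} : Set Λ).indicator (1 : Λ → ℝ≥0∞) (t []) *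
      ∏ i : Fin n, A.indicator (1 : (List ℕ → Λ) → ℝ≥0∞) (subtree t i) =
      {t : List ℕ → Λ | t [] = l ∧ ∀ i : Fin n, subtree t i ∈ A}.indicator 1 t := by
    intro t
    by_cases ht : t [] = l
    · by_cases hs : ∀ i : Fin n, subtree t i ∈ A
      · rw [indicator_of_mem (show t ∈ {t : List ℕ → Λ |
          t [] = l ∧ ∀ i : Fin n, subtree t i ∈ A} from ⟨ht, hs⟩)]
        simp [ht, hs]
      · rw [indicator_of_notMem (show t ∉ {t : List ℕ → Λ |
          t [] = l ∧ ∀ i : Fin n, subtree t i ∈ A} from fun h => hs h.2)]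
        push Not at hs
        obtain ⟨i, hi⟩ := hs
        rw [Finset.prod_eq_zero (Finset.mem_univ i) (by simp [hi]), mul_zero]
    · rw [indicator_of_notMem (show t ∉ {t : List ℕ → Λ |
        t [] = l ∧ ∀ i : Fin n, subtree t i ∈ A} from fun h => ht h.1)]
      simp [ht]
  simp_rw [h2] at h1
  rw [lintegral_indicator_one (measurableSet_root_and_subtree n l hA),
    lintegral_indicator_one (measurableSet_singleton l)] at h1
  simp only [lintegral_indicator_one hA, Finset.prod_const, Finset.card_univ,
    Fintype.card_fin] at h1
  simp [measureReal_def, h1]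

/-- A full tree of depth `k + 1` needs the root label `l` and one independent full tree of depth `k`
per child. The probability is doubly exponentially small in `k`, which is why depth of order `log n`
is attainable. -/
lemma pow_le_measureReal_fullTrees (hΔc : IsCompact Δ) (hΔ : ∀ l i, (I l).map i '' Δ ⊆ Δ)
    (ν : Measure Λ) [IsProbabilityMeasure ν] (l : Λ) (k : ℕ) :
    (ν.real {l} * (1 - extinctionProb I Δ ν)) ^ ((I l).card + 1) ^ k ≤
      (treeMeasure ν).real (fullTrees I Δ l k) := by
  set β := ν.real {l} * (1 - extinctionProb I Δ ν) with hβ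
  have hp0 : 0 ≤ ν.real {l} := measureReal_nonneg
  have hp1 : ν.real {l} ≤ 1 := measureReal_le_one
  have hq0 : 0 ≤ extinctionProb I Δ ν := measureReal_nonneg
  have hq1 : extinctionProb I Δ ν ≤ 1 := measureReal_le_one
  have hβ0 : 0 ≤ β := mul_nonneg hp0 (by linarith)
  have hβp : β ≤ ν.real {l} := mul_le_of_le_one_right hp0 (by linarith)
  have hβ1 : β ≤ 1 := hβp.trans hp1
  induction k with
  | zero =>
    have h1 : (treeMeasure ν).real (fullTrees I Δ l 0) = 1 - extinctionProb I Δ ν := by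
      have := probReal_compl_eq_one_sub (μ := treeMeasure ν)
        (measurableSet_limitSet_nonempty (I := I) hΔc hΔ)
      have h2 : extinctionProb I Δ ν =
        (treeMeasure ν).real {t : List ℕ → Λ | (limitSet I Δ t).Nonempty}ᶜ := rfl
      rw [h2, this]
      simp [fullTrees]
    rw [h1, pow_zero, pow_one]
    exact mul_le_of_le_one_left (by linarith) hp1
  | succ k ih =>
    have h1 := measureReal_root_and_subtree ν (I l).card l
      (measurableSet_fullTrees hΔc hΔ l k)
    rw [fullTrees, h1]
    set B := ((I l).card + 1) ^ k with hB
    have hB1 : 1 ≤ B := Nat.one_le_pow _ _ (Nat.succ_pos _)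
    calc β ^ ((I l).card + 1) ^ (k + 1) ≤ β ^ (1 + B * (I l).card) := by
          refine pow_le_pow_of_le_one hβ0 hβ1 ?_
          rw [pow_succ, ← hB]
          nlinarith
      _ = β * (β ^ B) ^ (I l).card := by rw [pow_add, pow_one, pow_mul]
      _ ≤ _ := by gcongr

/-- Almost surely on survival, there are infinitely many `n` such that some node at depth `n` has
a full subtree whose depth is of order `log n`. -/
lemma ae_frequently_notMem_avoidTrees (hΔc : IsCompact Δ) (hΔn : Δ.Nonempty)
    (hΔ : ∀ l i, (I l).map i '' Δ ⊆ Δ) (ν : Measure Λ) [IsProbabilityMeasure ν]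
    (hmean : 1 < ∑ l, ν.real {l} * (I l).card) {l : Λ} (hl : 0 < ν.real {l})
    (hcard : 0 < (I l).card) :
    ∀ᵐ t ∂treeMeasure ν, (limitSet I Δ t).Nonempty → ∃ᶠ n : ℕ in atTop,
      t ∉ avoidTrees I (fullTrees I Δ l (Nat.log (((I l).card + 1) ^ 2) n)) n := by
  set p : Λ → ℝ := fun l => ν.real {l} with hp
  set nn : Λ → ℕ := fun l => (I l).card with hnn
  have hp0 : ∀ l, 0 ≤ p l := fun l => measureReal_nonneg
  have hp1 : ∑ l, p l = 1 := sum_measureReal_singleton_eq_one ν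
  obtain ⟨x₂, hx₂, hx₂1, hx₂f, hγ1⟩ := exists_genFun_lt hp0 hp1 hmean
  set γ := ∑ l, p l * (nn l * x₂ ^ (nn l - 1)) with hγ
  have hγ0 : 0 ≤ γ := Finset.sum_nonneg fun l _ => mul_nonneg (hp0 l) (by positivity)
  have hqx : extinctionProb I Δ ν ≤ x₂ := extinctionProb_le hΔc hΔn hΔ ν hx₂.le hx₂f.le
  have hq0 : 0 ≤ extinctionProb I Δ ν := measureReal_nonneg
  obtain ⟨K, hK, hgrow⟩ := exists_mul_one_sub_le hp0 hp1 hx₂ hx₂1 hx₂f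
  set β := ν.real {l} * (1 - extinctionProb I Δ ν) with hβ
  have hβ0 : 0 < β := mul_pos hl (by linarith)
  -- Each factor `β` in the probability of a full tree is compensated by `Q` generations of growth,
  -- so `Q * B ^ k` generations suffice.
  obtain ⟨Q, hQ⟩ : ∃ Q : ℕ, 1 < (1 + K) ^ Q * β := by
    obtain ⟨Q, hQ⟩ := pow_unbounded_of_one_lt (1 / β) (by linarith : 1 < 1 + K)
    exact ⟨Q, by rwa [div_lt_iff₀ hβ0] at hQ⟩
  set B := (I l).card + 1 with hB
  -- The base `B ^ 2` gives `B ^ k n ≤ √n`, so that `Q * B ^ k n ≤ n / 2` once `n > 4 * Q ^ 2`; the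
  -- other half of the generations drives the probability towards extinction.
  set k : ℕ → ℕ := fun n => Nat.log (B ^ 2) n with hk
  set W : ℕ → Set (List ℕ → Λ) := fun n => avoidTrees I (fullTrees I Δ l (k n)) n with hW
  have hsurv := measurableSet_limitSet_nonempty (I := I) hΔc hΔ
  have hWm : ∀ n, MeasurableSet (W n) := fun n =>
    measurableSet_avoidTrees (measurableSet_fullTrees hΔc hΔ l (k n)) n
  have hbound : ∀ n, 4 * Q ^ 2 + 1 ≤ n →
      (treeMeasure ν).real ({t | (limitSet I Δ t).Nonempty} ∩ W n) ≤ γ ^ (n / 2) := by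
    intro n hn
    set x := B ^ k n with hx
    have hx1 : 1 ≤ x := Nat.one_le_pow _ _ (Nat.succ_pos _)
    have hxn : x ^ 2 ≤ n := by
      rw [hx, ← pow_mul, mul_comm, pow_mul]
      exact Nat.pow_log_le_self _ (by omega)
    have hQx : 2 * (Q * x) ≤ n := by
      rcases le_total (2 * Q) x with hc | hc
      · nlinarith
      · nlinarith
    set g := (treeMeasure ν).real (fullTrees I Δ l (k n)) with hg
    have hg1 : g ≤ 1 := measureReal_le_one
    have hg0 : β ^ x ≤ g := pow_le_measureReal_fullTrees hΔc hΔ ν l (k n)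
    have hgrow' : 1 < (1 + K) ^ (Q * x) * (1 - (1 - g)) := by
      calc (1 : ℝ) < ((1 + K) ^ Q * β) ^ x := one_lt_pow₀ hQ (by omega)
        _ = (1 + K) ^ (Q * x) * β ^ x := by rw [mul_pow, ← pow_mul]
        _ ≤ (1 + K) ^ (Q * x) * (1 - (1 - g)) := by
            gcongr
            linarith
    have h0g : 0 ≤ g := measureReal_nonneg
    have h1 := genFun_iterate_le_of_lt hp0 hx₂f.le hK hgrow (by linarith : 0 ≤ 1 - g)
      (by linarith) hgrow'
    have h2 := genFun_iterate_le_add_pow hp0 hx₂.le hx₂1.le hx₂f.le hq0 hqx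
        (genFun_extinctionProb hΔc hΔ ν)
        (genFun_iterate_nonneg hp0 (by linarith : 0 ≤ 1 - g) (Q * x)) h1 (n - Q * x)
    rw [← Function.iterate_add_apply, Nat.sub_add_cancel (by omega)] at h2
    have h3 : (treeMeasure ν).real (W n) = (genFun p nn)^[n] (1 - g) :=
      measureReal_avoidTrees ν (measurableSet_fullTrees hΔc hΔ l (k n)) n
    -- Extinct trees have no full subtree, so they contribute exactly the extinction probability,
    -- which cancels against the fixed point in `h2`.
    have h4 : (treeMeasure ν).real (W n) =
        (treeMeasure ν).real ({t | (limitSet I Δ t).Nonempty} ∩ W n) +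
          extinctionProb I Δ ν := by
      rw [← measureReal_inter_add_sdiff (s := W n) hsurv, inter_comm, extinctionProb]
      congr 2
      ext t
      constructor
      · exact fun ht => ht.2
      · exact fun ht => ⟨subset_avoidTrees hΔ (fun t ht =>
          limitSet_nonempty_of_mem_fullTrees hΔ hcard ht) n ht, ht⟩
    have h5 : γ ^ (n - Q * x) ≤ γ ^ (n / 2) :=
      pow_le_pow_of_le_one hγ0 hγ1.le (by omega)
    linarith
  -- Avoiding at all `n ≥ n₀` is contained in each single event, whose probability tends to zero;
  -- for infinitely many occurrences no independence between levels is needed.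
  have hnull : ∀ n₀ : ℕ, treeMeasure ν ({t | (limitSet I Δ t).Nonempty} ∩
      ⋂ n ≥ n₀, W n) = 0 := by
    intro n₀
    rw [← measureReal_eq_zero_iff]
    refine le_antisymm ?_ measureReal_nonneg
    have hlim : Tendsto (fun n : ℕ => γ ^ (n / 2)) atTop (𝓝 0) :=
      (tendsto_pow_atTop_nhds_zero_of_lt_one hγ0 hγ1).comp
        (Nat.tendsto_div_const_atTop (by norm_num))
    refine ge_of_tendsto hlim ?_
    filter_upwards [eventually_ge_atTop (max n₀ (4 * Q ^ 2 + 1))] with n hn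
    refine le_trans ?_ (hbound n ((le_max_right _ _).trans hn))
    refine measureReal_mono (inter_subset_inter_right _ ?_)
    exact iInter₂_subset n ((le_max_left _ _).trans hn)
  have hae : ∀ᵐ t ∂treeMeasure ν, ∀ n₀ : ℕ, ¬ (t ∈ {t | (limitSet I Δ t).Nonempty} ∩
      ⋂ n ≥ n₀, W n) := ae_all_iff.2 fun n₀ => measure_eq_zero_iff_ae_notMem.1 (hnull n₀)
  filter_upwards [hae] with t ht hne
  rw [frequently_atTop]
  intro n₀
  by_contra! hcon
  exact ht n₀ ⟨hne, mem_iInter₂.2 fun n hn => hcon n hn⟩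

end FullSubtrees

/-! ### Full subtrees force large `φ`-Assouad exponents. -/

section AssouadLower

variable {d : ℕ} {Λ : Type*} {I : Λ → SelfSimilarIFS d}
  {Δ : Set (EuclideanSpace ℝ (Fin d))} {a b : ℝ} {N : ℕ}

lemma eventually_mul_log_le_of_isLittleO_threshold {φ : ℝ → ℝ}
    (hth : φ =o[𝓝[>] 0] threshold) {ε : ℝ} (hε : 0 < ε) :
    ∀ᶠ x in 𝓝[>] 0, φ x * |Real.log x| ≤ ε * Real.log |Real.log x| := by
  filter_upwards [hth.bound hε,
    tendsto_abs_log_nhdsGT_zero.eventually_gt_atTop 1] with x hx hl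
  have h0 : 0 < |Real.log x| := by linarith
  have h1 : 0 ≤ threshold x := div_nonneg (Real.log_nonneg hl.le) h0.le
  rw [Real.norm_eq_abs, Real.norm_eq_abs, abs_of_nonneg h1] at hx
  calc φ x * |Real.log x| ≤ ε * threshold x * |Real.log x| := by
        gcongr
        exact (le_abs_self _).trans hx
    _ = _ := by
        rw [threshold]
        field_simp

/-- At a full subtree of depth `k` below a node at depth `n`, the scales from `R` to `r` fit inside
the `k` full generations. The local covering number is then of order at least `(R / r) ^ s`, and `R
/ r` tends to infinity. -/
lemma le_of_isPhiAssouadExponent_of_frequently (h : RatioBounds I a b N) (hU : UniformOSC I)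
    (hΔc : IsCompact Δ) (hΔ : ∀ l i, (I l).map i '' Δ ⊆ Δ) {φ : ℝ → ℝ}
    (hth : φ =o[𝓝[>] 0] threshold)
    (hφ : Tendsto (fun x => φ x * |Real.log x|) (𝓝[>] 0) atTop) {l : Λ} {s u : ℝ} (hs : 0 ≤ s)
    (hl : 1 ≤ (I l).ratioSum s) {t : List ℕ → Λ}
    (ht : ∃ᶠ n : ℕ in atTop,
      t ∉ avoidTrees I (fullTrees I Δ l (Nat.log (((I l).card + 1) ^ 2) n)) n)
    (hu : IsPhiAssouadExponent φ (limitSet I Δ t) u) : s ≤ u := by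
  by_contra! hlt
  obtain ⟨-, C, hC, hu⟩ := hu
  obtain ⟨M, hM0, hM⟩ := exists_card_cutWords_le h hU hΔc
  obtain ⟨D, hD1, hD⟩ : ∃ D : ℝ, 1 ≤ D ∧ ∀ x ∈ Δ, ∀ y ∈ Δ, dist x y ≤ D := by
    obtain ⟨D, hD⟩ := Metric.isBounded_iff.1 hΔc.isBounded
    exact ⟨max 1 D, le_max_left _ _, fun x hx y hy => (hD hx hy).trans (le_max_right _ _)⟩
  have hD0 : 0 < D := by linarith
  have ha := h.pos
  have ha1 : a < 1 := h.le.trans_lt h.lt_one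
  have hb0 : 0 < b := ha.trans_le h.le
  have hcard := card_pos_of_one_le_ratioSum hl
  set B := (I l).card + 1 with hB
  have hB2 : 2 ≤ B := by omega
  have hlogB : 0 < Real.log B := Real.log_pos (by exact_mod_cast hB2)
  have hlogb : Real.log b < 0 := Real.log_neg hb0 h.lt_one
  have hloga : Real.log a < 0 := Real.log_neg ha ha1
  -- With `log n ≤ 2 * (k + 1) * log B`, this makes `log (R / r)` at most about `k * |log b| / 2`.
  -- The other half of `k * |log b|` absorbs the bounded terms once `k ≥ k₀`.
  set ε := -Real.log b / (4 * Real.log B) with hε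
  have hε0 : 0 < ε := div_pos (by linarith) (by linarith)
  have hev : ∀ᶠ R in 𝓝[>] (0 : ℝ), R < 1 ∧ D < Real.exp (φ R * |Real.log R|) ∧
      M * C * D ^ s < Real.exp ((s - u) * (φ R * |Real.log R|)) ∧
      φ R * |Real.log R| ≤ ε * Real.log |Real.log R| ∧ 1 < |Real.log R| := by
    filter_upwards [eventually_mem_Ioo_nhdsGT_zero,
      (Real.tendsto_exp_atTop.comp hφ).eventually_gt_atTop D,
      (Real.tendsto_exp_atTop.comp (hφ.const_mul_atTop (sub_pos.2 hlt))).eventually_gt_atTop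
        (M * C * D ^ s),
      eventually_mul_log_le_of_isLittleO_threshold hth hε0,
      tendsto_abs_log_nhdsGT_zero.eventually_gt_atTop 1] with R h1 h2 h3 h4 h5
    exact ⟨h1.2, h2, h3, h4, h5⟩
  obtain ⟨R₀, hR₀, hsub⟩ := mem_nhdsGT_iff_exists_Ioo_subset.1 hev
  have hR₀' : 0 < R₀ := hR₀
  obtain ⟨n₁, hn₁⟩ := exists_pow_lt_of_lt_one (div_pos hR₀' hD0) h.lt_one
  obtain ⟨k₀, hk₀⟩ := exists_nat_gt
    ((-Real.log b / 2 + ε * Real.log (-Real.log a)) / (-Real.log b / 2))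
  rw [div_lt_iff₀ (by linarith)] at hk₀
  obtain ⟨n, hn, htn⟩ := (frequently_atTop.1 ht) (max (max n₁ ((B ^ 2) ^ k₀)) 1)
  have hnn₁ : n₁ ≤ n := (le_max_left _ _).trans ((le_max_left _ _).trans hn)
  have hnk₀ : (B ^ 2) ^ k₀ ≤ n := (le_max_right _ _).trans ((le_max_left _ _).trans hn)
  have hn1 : 1 ≤ n := (le_max_right _ _).trans hn
  have hn0 : (0 : ℝ) < n := by exact_mod_cast hn1
  obtain ⟨g, c, v, hac, hcb, hg, hgsub, hv⟩ := exists_copy_of_notMem_avoidTrees h hΔ htn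
  set k := Nat.log (B ^ 2) n with hk
  have hB4 : 1 < B ^ 2 := by nlinarith
  have hkk₀ : (k₀ : ℝ) ≤ k := by
    exact_mod_cast (Nat.le_log_iff_pow_le hB4 (by omega)).2 hnk₀
  have hlogn : Real.log n ≤ 2 * (k + 1) * Real.log B := by
    have h1 : n < (B ^ 2) ^ (k + 1) := Nat.lt_pow_succ_log_self hB4 n
    have h2 : (n : ℝ) ≤ ((B : ℝ) ^ 2) ^ (k + 1) := by exact_mod_cast h1.le
    have h3 := Real.log_le_log hn0 h2
    rw [← pow_mul, Real.log_pow] at h3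
    push_cast at h3
    linarith
  have hc0 : 0 < c := (pow_pos ha n).trans_le hac
  -- `R` bounds the diameter of the similar copy, so the copy lies in the ball of radius `R` about
  -- any of its points.
  set R := c * D with hR
  have hR0 : 0 < R := mul_pos hc0 hD0
  have hRR₀ : R < R₀ := by
    have h1 : c < R₀ / D := hcb.trans_lt
      ((pow_le_pow_of_le_one hb0.le h.lt_one.le hnn₁).trans_lt hn₁)
    rwa [lt_div_iff₀ hD0] at h1
  obtain ⟨hR1, hDQ, hCQ, hQε, hlR⟩ := hsub (show R ∈ Ioo 0 R₀ from ⟨hR0, hRR₀⟩)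
  have hlogR : Real.log R < 0 := Real.log_neg hR0 hR1
  set Q := Real.exp (φ R * |Real.log R|) with hQ
  have hQ0 : 0 < Q := Real.exp_pos _
  set r := R ^ (1 + φ R) with hr
  have hr0 : 0 < r := Real.rpow_pos_of_pos hR0 _
  have hRr : R / r = Q := by rw [hr, div_rpow_one_add hR0, rpow_neg_eq_exp hR0 hR1]
  have hMpos : (0 : ℝ) < M := by exact_mod_cast hM0
  have hQ1 : 1 < Q := hD1.trans_lt hDQ
  have hrR : r < R := by
    rw [← hRr, one_lt_div hr0] at hQ1
    exact hQ1
  -- The threshold inside the copy for which `c * δ` is the covering radius `r`.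
  set δ := D / Q with hδ
  have hδ0 : 0 < δ := div_pos hD0 hQ0
  have hδ1 : δ ≤ 1 := div_le_one_of_le₀ hDQ.le hQ0.le
  have hcδ : c * δ = r := by
    rw [hδ, ← hRr, hR]
    field_simp
  have hbk : b ^ k < δ := by
    have h1 : |Real.log R| ≤ n * -Real.log a := by
      have h2 : Real.log (a ^ n) ≤ Real.log R :=
        Real.log_le_log (pow_pos ha n) (hac.trans (le_mul_of_one_le_right hc0.le hD1))
      rw [Real.log_pow] at h2
      rw [abs_of_neg hlogR]
      linarith
    have h2 : Real.log |Real.log R| ≤ Real.log n + Real.log (-Real.log a) := by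
      rw [← Real.log_mul hn0.ne' (by linarith)]
      exact Real.log_le_log (by linarith) h1
    have h3 : φ R * |Real.log R| < k * -Real.log b := by
      have h4 : ε * Real.log |Real.log R| ≤
          ε * (2 * (k + 1) * Real.log B + Real.log (-Real.log a)) := by
        gcongr
        linarith
      have h5 : ε * (2 * (k + 1) * Real.log B) = (k + 1) * (-Real.log b / 2) := by
        rw [hε]
        field_simp
        ring
      have h6 : (k₀ : ℝ) * (-Real.log b / 2) ≤ k * (-Real.log b / 2) := by
        gcongr
        linarith
      linarith
    have h4 : Q * b ^ k < 1 := by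
      have h5 : b ^ k = Real.exp (-(k * -Real.log b)) := by
        rw [← Real.exp_log (pow_pos hb0 k), Real.log_pow]
        congr 1
        ring
      rw [h5, hQ, ← Real.exp_add, Real.exp_lt_one_iff]
      linarith
    rw [hδ, lt_div_iff₀ hQ0]
    linarith
  obtain ⟨z, hz⟩ := limitSet_nonempty_of_mem_fullTrees hΔ hcard hv
  have h1 := hu r R hr0 hr hrR hR0 hR1 (g z) (hgsub ⟨z, hz, rfl⟩)
  have h2 : coverNum r (g '' limitSet I Δ v) ≤
      coverNum r (limitSet I Δ t ∩ Metric.closedBall (g z) R) := by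
    refine coverNum_mono r (subset_inter hgsub ?_)
    rintro _ ⟨y, hy, rfl⟩
    rw [Metric.mem_closedBall, hg]
    exact mul_le_mul_of_nonneg_left (hD _ (limitSet_subset _ hy) _ (limitSet_subset _ hz)) hc0.le
  have h3 := cutSum_survivalIndicator_le h hΔ hM0 hM hc0 hg hδ1 hbk v
  rw [hcδ] at h3
  have h4 : ENNReal.ofReal (δ ^ (-s)) ≤ ENNReal.ofReal (M * (C * Q ^ u)) := by
    calc ENNReal.ofReal (δ ^ (-s)) ≤ _ := ENNReal.ofReal_le_ofReal
          (rpow_le_cutSum_of_mem_fullTrees h hΔ hs hl hbk hv)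
      _ ≤ _ := h3
      _ ≤ M * ENNReal.ofReal (C * (R / r) ^ u) := by
          gcongr
          exact (ENat.toENNReal_le.2 h2).trans h1
      _ = _ := by
          rw [hRr, ENNReal.ofReal_mul hMpos.le, ENNReal.ofReal_natCast]
  rw [ENNReal.ofReal_le_ofReal_iff (by positivity)] at h4
  have h5 : δ ^ (-s) = Q ^ s / D ^ s := by
    rw [hδ, Real.div_rpow hD0.le hQ0.le, Real.rpow_neg hD0.le, Real.rpow_neg hQ0.le]
    field_simp
  have h6 : Q ^ s = Q ^ u * Real.exp ((s - u) * (φ R * |Real.log R|)) := by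
    rw [hQ, ← Real.exp_mul, ← Real.exp_mul, ← Real.exp_add]
    congr 1
    ring
  rw [h5, h6, div_le_iff₀ (by positivity)] at h4
  have h7 : 0 < Q ^ u := Real.rpow_pos_of_pos hQ0 u
  nlinarith

end AssouadLower

/-! ### From bounds on exponents to dimensions; the empty set. -/

section Dimensions

variable {X : Type*} [PseudoMetricSpace X] {F : Set X} {s : ℝ}

/-- The strict inequalities between `σ` and `x` absorb the multiplicative constants, since `-log r`
tends to infinity. -/
lemma hasBoxDim_of_bounds (hF : TotallyBounded F)
    (hup : ∀ x > s, ∃ σ < x, ∃ C > 0, ∀ r : ℝ, 0 < r → r < 1 →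
      ((coverNum r F : ℕ∞) : ℝ≥0∞) ≤ ENNReal.ofReal (C * r ^ (-σ)))
    (hlow : ∀ x < s, ∃ σ > x, ∃ c > 0, ∀ r : ℝ, 0 < r → r < 1 →
      ENNReal.ofReal (c * r ^ (-σ)) ≤ ((coverNum r F : ℕ∞) : ℝ≥0∞)) : HasBoxDim F s := by
  refine ⟨hF, ?_⟩
  set n : ℝ → ℝ := fun r => ((coverNum r F).toNat : ℝ) with hn
  have hcn : ∀ r : ℝ, 0 < r → ((coverNum r F : ℕ∞) : ℝ≥0∞) = ENNReal.ofReal (n r) := by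
    intro r hr
    rw [hn, ENNReal.ofReal_natCast, ← ENat.toENNReal_coe,
      ENat.natCast_toNat (coverNum_ne_top hr hF)]
  have hn0 : ∀ r : ℝ, 0 < r → r < 1 → 0 < n r := by
    intro r hr hr1
    obtain ⟨σ, -, c, hc, h⟩ := hlow (s - 1) (by linarith)
    have h1 := h r hr hr1
    rw [hcn r hr] at h1
    have h2 : 0 < c * r ^ (-σ) := mul_pos hc (Real.rpow_pos_of_pos hr _)
    exact h2.trans_le ((ENNReal.ofReal_le_ofReal_iff (Nat.cast_nonneg _)).1 h1)
  have hlog : Tendsto (fun r : ℝ => -Real.log r) (𝓝[>] 0) atTop :=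
    tendsto_neg_atBot_atTop.comp Real.tendsto_log_nhdsGT_zero
  rw [tendsto_order]
  constructor
  · intro x hx
    obtain ⟨σ, hσ, c, hc, h⟩ := hlow x hx
    filter_upwards [eventually_mem_Ioo_nhdsGT_zero,
      (hlog.const_mul_atTop (sub_pos.2 hσ)).eventually_gt_atTop (-Real.log c)] with r hr hr2
    have h1 := h r hr.1 hr.2
    rw [hcn r hr.1, ENNReal.ofReal_le_ofReal_iff (Nat.cast_nonneg _)] at h1
    have h2 := Real.log_le_log (mul_pos hc (Real.rpow_pos_of_pos hr.1 _)) h1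
    rw [Real.log_mul hc.ne' (Real.rpow_pos_of_pos hr.1 _).ne', Real.log_rpow hr.1] at h2
    rw [lt_div_iff₀ (neg_pos.2 (Real.log_neg hr.1 hr.2))]
    linarith
  · intro x hx
    obtain ⟨σ, hσ, C, hC, h⟩ := hup x hx
    filter_upwards [eventually_mem_Ioo_nhdsGT_zero,
      (hlog.const_mul_atTop (sub_pos.2 hσ)).eventually_gt_atTop (Real.log C)] with r hr hr2
    have h0 := mul_pos hC (Real.rpow_pos_of_pos hr.1 (-σ))
    have h1 := h r hr.1 hr.2
    rw [hcn r hr.1, ENNReal.ofReal_le_ofReal_iff h0.le] at h1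
    have h2 := Real.log_le_log (hn0 r hr.1 hr.2) h1
    rw [Real.log_mul hC.ne' (Real.rpow_pos_of_pos hr.1 _).ne', Real.log_rpow hr.1] at h2
    rw [div_lt_iff₀ (neg_pos.2 (Real.log_neg hr.1 hr.2))]
    linarith

lemma hasBoxDim_empty : HasBoxDim (∅ : Set X) 0 := by
  refine ⟨totallyBounded_empty, ?_⟩
  simp [coverNum, Metric.externalCoveringNumber_empty]

lemma isPhiAssouadExponent_empty (φ : ℝ → ℝ) (hs : 0 ≤ s) :
    IsPhiAssouadExponent φ (∅ : Set X) s :=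
  ⟨hs, 1, one_pos, fun _ _ _ _ _ _ _ _ hx => hx.elim⟩

lemma isAssouadExponent_empty (hs : 0 ≤ s) : IsAssouadExponent (∅ : Set X) s :=
  ⟨hs, 1, one_pos, fun _ _ _ _ _ _ hx => hx.elim⟩

lemma IsAssouadExponent.isPhiAssouadExponent (h : IsAssouadExponent F s) (φ : ℝ → ℝ) :
    IsPhiAssouadExponent φ F s := by
  obtain ⟨hs, C, hC, h⟩ := h
  exact ⟨hs, C, hC, fun r R hr _ hrR _ hR1 x hx => h r R hr hrR.le hR1 x hx⟩

lemma phiAssouadDim_le (φ : ℝ → ℝ) (h : IsPhiAssouadExponent φ F s) : phiAssouadDim φ F ≤ s :=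
  csInf_le ⟨0, fun _ hx => hx.1⟩ h

lemma le_phiAssouadDim (φ : ℝ → ℝ) {u : ℝ} (hu : IsPhiAssouadExponent φ F u)
    (h : ∀ u, IsPhiAssouadExponent φ F u → s ≤ u) : s ≤ phiAssouadDim φ F :=
  le_csInf ⟨u, hu⟩ h

lemma assouadDim_le (h : IsAssouadExponent F s) : assouadDim F ≤ s :=
  csInf_le ⟨0, fun _ hx => hx.1⟩ h

lemma phiAssouadDim_le_assouadDim (φ : ℝ → ℝ) (h : IsAssouadExponent F s) :
    phiAssouadDim φ F ≤ assouadDim F :=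
  le_csInf ⟨s, h⟩ fun _ hu => phiAssouadDim_le φ (IsAssouadExponent.isPhiAssouadExponent hu φ)

lemma phiAssouadDim_empty (φ : ℝ → ℝ) : phiAssouadDim φ (∅ : Set X) = 0 :=
  le_antisymm (phiAssouadDim_le φ (isPhiAssouadExponent_empty φ le_rfl))
    (Real.sInf_nonneg fun _ hx => hx.1)

lemma assouadDim_empty : assouadDim (∅ : Set X) = 0 :=
  le_antisymm (assouadDim_le (isAssouadExponent_empty le_rfl))
    (Real.sInf_nonneg fun _ hx => hx.1)

end Dimensions

/-! ### Critical exponents and the almost sure statements. -/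

section Almost

variable {d : ℕ} {Λ : Type*} {I : Λ → SelfSimilarIFS d}
  {Δ : Set (EuclideanSpace ℝ (Fin d))} {a b : ℝ} {N : ℕ}

/-- The factor `b ^ (s - s')` makes the monotonicity in the exponent quantitative: a mean of at
least one at `s` exceeds one strictly at any smaller exponent. -/
lemma RatioBounds.ratioSum_le_rpow_mul (h : RatioBounds I a b N) {s s' : ℝ} (hs : s' ≤ s)
    (l : Λ) : (I l).ratioSum s ≤ b ^ (s - s') * (I l).ratioSum s' := by
  rw [SelfSimilarIFS.ratioSum, SelfSimilarIFS.ratioSum, Finset.mul_sum]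
  refine Finset.sum_le_sum fun i _ => ?_
  have hr := (I l).ratio_pos i
  calc (I l).ratio i ^ s = (I l).ratio i ^ (s - s') * (I l).ratio i ^ s' := by
        rw [← Real.rpow_add hr, sub_add_cancel]
    _ ≤ _ := mul_le_mul_of_nonneg_right
        (Real.rpow_le_rpow hr.le (h.ratio_le l i) (by linarith)) (Real.rpow_nonneg hr.le _)

lemma RatioBounds.exists_ratioSum_le_half (h : RatioBounds I a b N) :
    ∃ s : ℝ, 0 ≤ s ∧ ∀ l, (I l).ratioSum s ≤ 1 / 2 := by
  have hb0 : 0 < b := h.pos.trans_le h.le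
  have h1 : Tendsto (fun s : ℝ => b ^ s * N) atTop (𝓝 (0 * N)) :=
    (tendsto_rpow_atTop_of_base_lt_one b (by linarith) h.lt_one).mul_const _
  rw [zero_mul] at h1
  obtain ⟨s, hs, hs0⟩ := ((h1.eventually_le_const (by norm_num : (0 : ℝ) < 1 / 2)).and
    (eventually_ge_atTop 0)).exists
  refine ⟨s, hs0, fun l => (h.ratioSum_le_rpow_mul hs0 l).trans (le_trans ?_ hs)⟩
  rw [sub_zero]
  exact mul_le_mul_of_nonneg_left (h.ratioSum_le le_rfl l) (Real.rpow_nonneg hb0.le _)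

lemma two_le_card_of_one_le_ratioSum {S : SelfSimilarIFS d} {s : ℝ} (hs : 0 < s)
    (h : 1 ≤ S.ratioSum s) : 2 ≤ S.card := by
  by_contra! hlt
  have h1 := card_pos_of_one_le_ratioSum h
  have : Subsingleton (Fin S.card) := Fin.subsingleton_iff_le_one.2 (by omega)
  rw [SelfSimilarIFS.ratioSum, Fintype.sum_subsingleton _ ⟨0, h1⟩] at h
  exact absurd h (Real.rpow_lt_one (S.ratio_pos _).le (S.ratio_lt_one _) hs).not_ge

lemma totallyBounded_limitSet (hΔc : IsCompact Δ) (t : List ℕ → Λ) :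
    TotallyBounded (limitSet I Δ t) :=
  hΔc.totallyBounded.subset (limitSet_subset t)

variable [MeasurableSpace Λ] [Fintype Λ]

lemma RatioBounds.one_lt_sum_ratioSum (h : RatioBounds I a b N) (ν : Measure Λ) {s s' : ℝ}
    (hs : s' < s) (hE : 1 ≤ ∑ l, ν.real {l} * (I l).ratioSum s) :
    1 < ∑ l, ν.real {l} * (I l).ratioSum s' := by
  have hb0 : 0 < b := h.pos.trans_le h.le
  have hq0 : 0 < b ^ (s - s') := Real.rpow_pos_of_pos hb0 _
  have hq1 : b ^ (s - s') < 1 := Real.rpow_lt_one hb0.le h.lt_one (by linarith)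
  have h1 : ∑ l, ν.real {l} * (I l).ratioSum s ≤
      b ^ (s - s') * ∑ l, ν.real {l} * (I l).ratioSum s' := by
    rw [Finset.mul_sum]
    refine Finset.sum_le_sum fun l _ => ?_
    rw [mul_left_comm]
    exact mul_le_mul_of_nonneg_left (h.ratioSum_le_rpow_mul hs.le l) measureReal_nonneg
  by_contra! hle
  nlinarith

variable [MeasurableSingletonClass Λ]

lemma ae_isPhiAssouadExponent (h : RatioBounds I a b N) (hU : UniformOSC I)
    (hΔc : IsCompact Δ) (hΔn : Δ.Nonempty) (hΔ : ∀ l i, (I l).map i '' Δ ⊆ Δ) (ν : Measure Λ)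
    [IsProbabilityMeasure ν] {φ : ℝ → ℝ} (hφ : IsDimensionFunction φ)
    (hth : threshold =o[𝓝[>] 0] φ) {s σ : ℝ} (hs : 0 ≤ s)
    (hE : ∑ l, ν.real {l} * (I l).ratioSum s < 1) (hσ : s < σ) :
    ∀ᵐ t ∂treeMeasure ν, IsPhiAssouadExponent φ (limitSet I Δ t) σ ∧
      ∃ C > 0, ∀ r : ℝ, 0 < r → r < 1 →
        ((coverNum r (limitSet I Δ t) : ℕ∞) : ℝ≥0∞) ≤ ENNReal.ofReal (C * r ^ (-σ)) := by
  obtain ⟨α, hα, hα1, hα4, κ, hκ, hae⟩ :=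
    exists_ae_eventually_cutSum_le h ν hs hE (sub_pos.2 hσ)
  rw [add_sub_cancel] at hae
  have hσ0 : 0 ≤ σ := hs.trans hσ.le
  filter_upwards [hae] with t ht
  obtain ⟨C, hC, h1, h2⟩ := coverNum_le_of_eventually_cutSum_le h hU hΔc hΔn hΔ hα hα1
    (sub_pos.2 hσ) hα4 hσ0 hκ ht
  exact ⟨isPhiAssouadExponent_of_coverNum_le hφ hth (h.pos.trans_le h.le) h.lt_one hC
    (sub_pos.2 hσ) hσ0 h1 h2, C, hC, h1⟩

lemma ae_exists_le_coverNum (h : RatioBounds I a b N) (hU : UniformOSC I)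
    (hΔc : IsCompact Δ) (hΔn : Δ.Nonempty) (hΔ : ∀ l i, (I l).map i '' Δ ⊆ Δ) (ν : Measure Λ)
    [IsProbabilityMeasure ν] {s s' : ℝ} (hs : s' < s)
    (hE : 0 ≤ s → 1 ≤ ∑ l, ν.real {l} * (I l).ratioSum s) :
    ∀ᵐ t ∂treeMeasure ν, (limitSet I Δ t).Nonempty → ∃ c > 0, ∀ r : ℝ, 0 < r → r < 1 →
      ENNReal.ofReal (c * r ^ (-s')) ≤ ((coverNum r (limitSet I Δ t) : ℕ∞) : ℝ≥0∞) := by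
  rcases lt_or_ge s' 0 with hs' | hs'
  · refine ae_of_all _ fun t ht => ⟨1, one_pos, fun r hr hr1 => ?_⟩
    have h1 : (1 : ℕ∞) ≤ coverNum r (limitSet I Δ t) :=
      Order.one_le_iff_pos.2 (Metric.externalCoveringNumber_pos_iff.2 ht)
    calc ENNReal.ofReal (1 * r ^ (-s')) ≤ ENNReal.ofReal 1 := by
          refine ENNReal.ofReal_le_ofReal ?_
          rw [one_mul]
          exact Real.rpow_le_one hr.le hr1.le (by linarith)
      _ ≤ _ := by
          rw [ENNReal.ofReal_one]
          exact_mod_cast h1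
  -- At the midpoint the mean is strictly above one, and room remains above `s'`.
  · obtain ⟨α, hα, hα1, c, hc, κ, hκ, hae⟩ := exists_ae_eventually_lt_cutSum h hΔc hΔn hΔ ν hs'
      (by linarith : s' < (s' + s) / 2)
      (h.one_lt_sum_ratioSum ν (by linarith) (hE (by linarith)))
    filter_upwards [hae] with t ht hne
    exact exists_le_coverNum_of_eventually h hU hΔc hΔ hα hα1 hc hs' hκ hne (ht hne)

/-- Above the threshold, the `φ`-Assouad dimension is almost surely the box-counting dimension. -/
lemma ae_hasBoxDim_phiAssouadDim (hU : UniformOSC I)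
    (hΔc : IsCompact Δ) (hΔn : Δ.Nonempty) (hΔ : ∀ l i, (I l).map i '' Δ ⊆ Δ) (ν : Measure Λ)
    [IsProbabilityMeasure ν] {φ : ℝ → ℝ} (hφ : IsDimensionFunction φ)
    (hth : threshold =o[𝓝[>] 0] φ) :
    ∀ᵐ t ∂treeMeasure ν, HasBoxDim (limitSet I Δ t) (phiAssouadDim φ (limitSet I Δ t)) := by
  obtain ⟨a, b, N, h⟩ := exists_ratioBounds I
  -- The infimum of `T` is the common value of both dimensions on survival.
  set T : Set ℝ := {s | 0 ≤ s ∧ ∑ l, ν.real {l} * (I l).ratioSum s < 1} with hT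
  have hTb : BddBelow T := ⟨0, fun s hs => hs.1⟩
  have hTn : T.Nonempty := by
    obtain ⟨s, hs, hs2⟩ := h.exists_ratioSum_le_half
    refine ⟨s, hs, ?_⟩
    calc ∑ l, ν.real {l} * (I l).ratioSum s ≤ ∑ l, ν.real {l} * (1 / 2) :=
          Finset.sum_le_sum fun l _ => mul_le_mul_of_nonneg_left (hs2 l) measureReal_nonneg
      _ < 1 := by
          rw [← Finset.sum_mul, sum_measureReal_singleton_eq_one ν]
          norm_num
  -- Countably many exponents approach the critical one from each side, so that one null set serves
  -- for all.
  obtain ⟨u, -, hu, hut⟩ := exists_seq_strictAnti_tendsto (sInf T)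
  obtain ⟨v, -, hv, hvt⟩ := exists_seq_strictMono_tendsto (sInf T)
  have hup : ∀ᵐ t ∂treeMeasure ν, ∀ n, IsPhiAssouadExponent φ (limitSet I Δ t) (u n) ∧
      ∃ C > 0, ∀ r : ℝ, 0 < r → r < 1 →
        ((coverNum r (limitSet I Δ t) : ℕ∞) : ℝ≥0∞) ≤ ENNReal.ofReal (C * r ^ (-u n)) := by
    refine ae_all_iff.2 fun n => ?_
    obtain ⟨s, hs, hsu⟩ := exists_lt_of_csInf_lt hTn (hu n)
    exact ae_isPhiAssouadExponent h hU hΔc hΔn hΔ ν hφ hth hs.1 hs.2 hsu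
  have hlow : ∀ᵐ t ∂treeMeasure ν, ∀ n, (limitSet I Δ t).Nonempty → ∃ c > 0, ∀ r : ℝ,
      0 < r → r < 1 →
      ENNReal.ofReal (c * r ^ (-v n)) ≤ ((coverNum r (limitSet I Δ t) : ℕ∞) : ℝ≥0∞) := by
    refine ae_all_iff.2 fun n => ?_
    obtain ⟨s, hs1, hs2⟩ := exists_between (hv n)
    refine ae_exists_le_coverNum h hU hΔc hΔn hΔ ν hs1 fun hs0 => ?_
    by_contra! hlt
    exact notMem_of_lt_csInf hs2 hTb ⟨hs0, hlt⟩
  filter_upwards [hup, hlow] with t ht1 ht2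
  have hTB := totallyBounded_limitSet (I := I) hΔc t
  rcases (limitSet I Δ t).eq_empty_or_nonempty with he | hne
  · rw [he, phiAssouadDim_empty]
    exact hasBoxDim_empty
  · have hdim : phiAssouadDim φ (limitSet I Δ t) = sInf T := by
      refine le_antisymm (ge_of_tendsto' hut fun n => phiAssouadDim_le φ (ht1 n).1)
        (le_of_tendsto' hvt fun n => le_phiAssouadDim φ (ht1 0).1 fun x hx => ?_)
      obtain ⟨c, hc, hlow⟩ := ht2 n hne
      exact le_of_isPhiAssouadExponent hTB (tendsto_mul_log_of_threshold_isLittleO hφ hth) hc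
        hlow hx
    rw [hdim]
    refine hasBoxDim_of_bounds hTB (fun x hx => ?_) fun x hx => ?_
    · obtain ⟨n, hn⟩ := (hut.eventually_lt_const hx).exists
      exact ⟨u n, hn, (ht1 n).2⟩
    · obtain ⟨n, hn⟩ := (hvt.eventually_const_lt hx).exists
      exact ⟨v n, hn, ht2 n hne⟩

lemma ae_le_of_isPhiAssouadExponent (hU : UniformOSC I)
    (hΔc : IsCompact Δ) (hΔn : Δ.Nonempty) (hΔ : ∀ l i, (I l).map i '' Δ ⊆ Δ) (ν : Measure Λ)
    [IsProbabilityMeasure ν] {φ : ℝ → ℝ} (hth : φ =o[𝓝[>] 0] threshold)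
    (hφ : Tendsto (fun x => φ x * |Real.log x|) (𝓝[>] 0) atTop) {l : Λ} (hl : 0 < ν.real {l})
    {s : ℝ} (hs : 0 < s) (hls : 1 ≤ (I l).ratioSum s) :
    ∀ᵐ t ∂treeMeasure ν, (limitSet I Δ t).Nonempty →
      ∀ u, IsPhiAssouadExponent φ (limitSet I Δ t) u → s ≤ u := by
  obtain ⟨a, b, N, h⟩ := exists_ratioBounds I
  have hcard := two_le_card_of_one_le_ratioSum hs hls
  -- If survival has positive probability, the extinction probability is a fixed point below one,
  -- and a label with at least two maps forces a mean above one. Otherwise survival is a null event.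
  rcases (measureReal_le_one : extinctionProb I Δ ν ≤ 1).lt_or_eq with hq | hq
  · have hmean := one_lt_mean_of_genFun_eq (fun l => measureReal_nonneg)
      (sum_measureReal_singleton_eq_one ν) (measureReal_nonneg : 0 ≤ extinctionProb I Δ ν) hq
      (genFun_extinctionProb hΔc hΔ ν) hl hcard
    filter_upwards [ae_frequently_notMem_avoidTrees hΔc hΔn hΔ ν hmean hl (by omega)]
      with t ht hne u hu
    exact le_of_isPhiAssouadExponent_of_frequently h hU hΔc hΔ hth hφ hs.le hls (ht hne) hu
  · have hm := measurableSet_limitSet_nonempty (I := I) hΔc hΔ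
    have h1 : (treeMeasure ν).real {t | (limitSet I Δ t).Nonempty} = 0 := by
      have h2 := probReal_compl_eq_one_sub (μ := treeMeasure ν) hm
      have h3 : extinctionProb I Δ ν =
        (treeMeasure ν).real {t : List ℕ → Λ | (limitSet I Δ t).Nonempty}ᶜ := rfl
      linarith [h2.symm.trans (h3.symm.trans hq)]
    rw [measureReal_eq_zero_iff] at h1
    filter_upwards [measure_eq_zero_iff_ae_notMem.1 h1] with t ht hne
    exact absurd hne ht

/-- Below the threshold, the `φ`-Assouad dimension is almost surely the Assouad dimension. -/
lemma ae_phiAssouadDim_eq_assouadDim (hU : UniformOSC I)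
    (hΔc : IsCompact Δ) (hΔn : Δ.Nonempty) (hΔ : ∀ l i, (I l).map i '' Δ ⊆ Δ) (ν : Measure Λ)
    [IsProbabilityMeasure ν] {φ : ℝ → ℝ} (hth : φ =o[𝓝[>] 0] threshold)
    (hφ : Tendsto (fun x => φ x * |Real.log x|) (𝓝[>] 0) atTop) :
    ∀ᵐ t ∂treeMeasure ν,
      phiAssouadDim φ (limitSet I Δ t) = assouadDim (limitSet I Δ t) := by
  obtain ⟨a, b, N, h⟩ := exists_ratioBounds I
  -- Here the worst label of positive probability counts, not the mean; labels of probability zero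
  -- almost surely occur at no node.
  set T : Set ℝ := {s | 0 ≤ s ∧ ∀ l, 0 < ν.real {l} → (I l).ratioSum s < 1} with hT
  have hTb : BddBelow T := ⟨0, fun s hs => hs.1⟩
  have hTn : T.Nonempty := by
    obtain ⟨s, hs, hs2⟩ := h.exists_ratioSum_le_half
    exact ⟨s, hs, fun l _ => (hs2 l).trans_lt (by norm_num)⟩
  have hpos : ∀ᵐ t ∂treeMeasure ν, ∀ w, 0 < ν.real {t w} := by
    refine ae_all_iff.2 fun w => ?_
    have h1 : ∀ᵐ l ∂ν, 0 < ν.real {l} := by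
      rw [ae_iff_of_countable]
      intro l hl
      exact ENNReal.toReal_pos hl (measure_ne_top _ _)
    exact (measurePreserving_eval_infinitePi (fun _ : List ℕ => ν) w).quasiMeasurePreserving.ae h1
  obtain ⟨v, -, hv, hvt⟩ := exists_seq_strictMono_tendsto (sInf T)
  have hlow : ∀ᵐ t ∂treeMeasure ν, ∀ n, (limitSet I Δ t).Nonempty →
      ∀ x, IsPhiAssouadExponent φ (limitSet I Δ t) x → v n ≤ x := by
    refine ae_all_iff.2 fun n => ?_
    rcases lt_or_ge (v n) 0 with hv0 | hv0
    · exact ae_of_all _ fun t _ x hx => hv0.le.trans hx.1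
    · obtain ⟨s, hs1, hs2⟩ := exists_between (hv n)
      have hs0 : 0 < s := hv0.trans_lt hs1
      obtain ⟨l, hl, hls⟩ : ∃ l, 0 < ν.real {l} ∧ 1 ≤ (I l).ratioSum s := by
        by_contra! hcon
        exact notMem_of_lt_csInf hs2 hTb ⟨hs0.le, hcon⟩
      filter_upwards [ae_le_of_isPhiAssouadExponent hU hΔc hΔn hΔ ν hth hφ hl hs0 hls]
        with t ht hne x hx
      exact hs1.le.trans (ht hne x hx)
  filter_upwards [hpos, hlow] with t ht1 ht2
  rcases (limitSet I Δ t).eq_empty_or_nonempty with he | hne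
  · rw [he, phiAssouadDim_empty, assouadDim_empty]
  · have hT2 : ∀ s ∈ T, IsAssouadExponent (limitSet I Δ t) s := fun s hs =>
      isAssouadExponent_limitSet h hU hΔc hΔn hΔ hs.1 fun w => (hs.2 _ (ht1 w)).le
    obtain ⟨s, hs⟩ := hTn
    refine le_antisymm (phiAssouadDim_le_assouadDim φ (hT2 s hs)) ?_
    calc assouadDim (limitSet I Δ t) ≤ sInf T :=
          le_csInf ⟨s, hs⟩ fun x hx => assouadDim_le (hT2 x hx)
      _ ≤ _ := le_of_tendsto' hvt fun n =>
          le_phiAssouadDim φ ((hT2 s hs).isPhiAssouadExponent φ) (ht2 n hne)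

end Almost

theorem mainTheorem5 {d : ℕ} {Λ : Type*} [Finite Λ] [MeasurableSpace Λ]
    [MeasurableSingletonClass Λ]
    (I : Λ → SelfSimilarIFS d) (hU : UniformOSC I)
    (Δ : Set (EuclideanSpace ℝ (Fin d))) (hΔc : IsCompact Δ) (hΔn : Δ.Nonempty)
    (hΔ : ∀ l i, (I l).map i '' Δ ⊆ Δ)
    {Ω : Type*} [MeasurableSpace Ω] (P : Measure Ω) [IsProbabilityMeasure P]
    (L : List ℕ → Ω → Λ) (hLm : ∀ w, Measurable (L w)) (hLindep : iIndepFun L P)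
    (hLident : ∀ w, IdentDistrib (L w) (L []) P P) :
    (∀ φ : ℝ → ℝ, IsDimensionFunction φ → threshold =o[𝓝[>] 0] φ →
      ∀ᵐ ω ∂P, HasBoxDim (treeLimitSet Δ fun w => I (L w ω))
        (phiAssouadDim φ (treeLimitSet Δ fun w => I (L w ω)))) ∧
    (∀ φ : ℝ → ℝ, IsDimensionFunction φ → φ =o[𝓝[>] 0] threshold →
      Tendsto (fun x => φ x * |Real.log x|) (𝓝[>] 0) atTop →
      ∀ᵐ ω ∂P, phiAssouadDim φ (treeLimitSet Δ fun w => I (L w ω)) =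
        assouadDim (treeLimitSet Δ fun w => I (L w ω))) := by
  have := Fintype.ofFinite Λ
  have : IsProbabilityMeasure (P.map (L [])) :=
    Measure.isProbabilityMeasure_map (hLm []).aemeasurable
  have hm : Measurable fun ω w => L w ω := measurable_pi_lambda _ hLm
  -- Independence and equal laws identify the joint law of the labels with the product measure, so
  -- the almost sure statements transfer from the space of trees.
  have hmap : P.map (fun ω w => L w ω) = treeMeasure (P.map (L [])) := by
    rw [hLindep.map_fun_eq_infinitePi_map₀ hm.aemeasurable]
    congr 1
    ext1 w
    exact (hLident w).map_eq
  refine ⟨fun φ hφ hth => ?_, fun φ _ hth hφ => ?_⟩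
  · have h := ae_hasBoxDim_phiAssouadDim hU hΔc hΔn hΔ (P.map (L [])) hφ hth
    rw [← hmap] at h
    exact ae_of_ae_map hm.aemeasurable h
  · have h := ae_phiAssouadDim_eq_assouadDim hU hΔc hΔn hΔ (P.map (L [])) hth hφ
    rw [← hmap] at h
    exact ae_of_ae_map hm.aemeasurable h
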